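/- Let $n\ge 1$, let $w_1,\dots,w_n$ be positive integers, $w_0:=1$, $\mu:=1+w_1+\cdots+w_n$ and $\kappa:=\prod_{i=1}^n w_i^{-w_i}$. Let $U=(\mathbb C^*)^n$ with coordinates $u_1,\dots,u_n$, let $X=\mathbb C^*$ with coordinate $x$, and put $u_0:=u_1^{-w_1}\cdots u_n^{-w_n}$, $\omega_0:=\frac{du_1}{u_1}\wedge\cdots\wedge\frac{du_n}{u_n}$, $$F(u,x)=u_1+\cdots+u_n+x\,u_0 .$$ Let $\theta=\tau^{-1}$ and $$G=\frac{\Omega^n(U)[\tau,\tau^{-1},x,x^{-1}]}{(d_u-\tau d_uF)\wedge\Omega^{n-1}(U)[\tau,\tau^{-1},x,x^{-1}]},\qquad G_0=\frac{\Omega^n(U)[\theta,x,x^{-1}]}{(\theta d_u-d_uF)\wedge\Omega^{n-1}(U)[\theta,x,x^{-1}]},$$ where $\Omega^k(U)$ are the algebraic forms and $d_u$ is the differential in $u$ only. On $G$ there is the connection $\nabla_{\partial_\tau}[\omega]=[\partial_\tau\omega-F\omega]$, $\nabla_{\partial_\theta}=-\tau^2\nabla_{\partial_\tau}$, $\nabla_\xi[\omega]=[\xi(\omega)-\tau\,\xi(F)\,\omega]$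 for a vector field $\xi$ on $X$ (acting on coefficients). Define $a(k)\in\mathbb N^{n+1}$ by $a(0)=0$ and $a(k+1)=a(k)+e_{j}$, where $j\in\{0,\dots,n\}$ is the least index for which $a(k)_j/w_j$ is minimal, and put $$\omega_k=\Big(\prod_{i=1}^n w_i^{-a(k)_i}\Big)\,u_0^{a(k)_0}u_1^{a(k)_1}\cdots u_n^{a(k)_n}\,\omega_0\in G_0\qquad(0\le k\le\mu-1).$$ Then $\omega=(\omega_0,\dots,\omega_{\mu-1})$ is a basis of $G_0$ over $\mathbb C[\theta,x,x^{-1}]$, and its image in $G$ is a basis of $G$ over $\mathbb C[\theta,\theta^{-1},x,x^{-1}]$. Hence there is a unique form $S:G_0\times G_0\to\mathbb C[\theta,x,x^{-1}]\theta^n$, bilinear over $\mathbb C[x,x^{-1}]$, with $p(\theta)S(\varepsilon,\eta)=S(p(\theta)\varepsilon,\eta)=S(\varepsilon,p(-\theta)\eta)$, such that $$S(\omega_0,\omega_n)=S(\omega_n,\omega_0)=x^{-1}\theta^n,\quad S(\omega_k,\omega_{n-k})=x^{-2}\theta^n\ (1\le k\le n-1),\quad S(\omega_k,\omega_{\mu+n-k})=\kappa\,x^{-1}\theta^n\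 (n+1\le k\le\mu-1)$$ and $S(\omega_i,\omega_j)=0$ otherwise. Extend $S$ to $G$ by the same rules. Then: (1) $S$ is symmetric, in the sense that $S(\omega_i,\omega_j)=S(\omega_j,\omega_i)$ for all $i,j$, and $\theta^{-n}S(\eta,\varepsilon)$ is obtained from $\theta^{-n}S(\varepsilon,\eta)$ by $\theta\mapsto-\theta$ for all $\varepsilon,\eta\in G_0$. It is nondegenerate: $\varepsilon\mapsto\theta^{-n}S(\varepsilon,\cdot)$ is a bijection from $G_0$ onto the maps $\varphi:G_0\to\mathbb C[\theta,x,x^{-1}]$ that are additive with $\varphi(c(\theta,x)\eta)=c(-\theta,x)\varphi(\eta)$. It is $\nabla$-flat: for all $\varepsilon,\eta\in G$ and every vector field $\xi$ on $X$, $$\partial_\theta S(\varepsilon,\eta)=S(\nabla_{\partial_\theta}\varepsilon,\eta)+S(\varepsilon,\check\nabla_{\partial_\theta}\eta),\qquad \xi S(\varepsilon,\eta)=S(\nabla_\xi\varepsilon,\eta)+S(\varepsilon,\nabla_\xi\eta),$$ where $\check\nabla_{\partial_\theta}=-\nabla_{\partial_\theta}$ is the pull-back of $\nabla_{\partial_\theta}$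 by $\theta\mapsto-\theta$. (2) Let $G_\infty\subset G$ be the $\mathbb C[\tau,x,x^{-1}]$-submodule generated by $\omega$ (so that $G_0$ and $G_\infty$ define a trivial bundle on $\mathbb P^1\times X$), $E:=G_0/\theta G_0$ and $E_\infty:=G_\infty/\tau G_\infty$. There is an isomorphism $E\cong E_\infty$ of $\mathbb C[x,x^{-1}]$-modules that maps the class of $\varepsilon$ to the class of $\varepsilon$ for every $\varepsilon\in G_0\cap G_\infty$. The operators $\theta^2\nabla_{\partial_\theta}$ and $\theta\nabla_\xi$ preserve $G_0$, the operators $\tau\nabla_{\partial_\tau}$ and $\nabla_\xi$ preserve $G_\infty$, and, with $E_\infty$ identified with $E$, the formulas $$R_0[\varepsilon]=[\theta^2\nabla_{\partial_\theta}\varepsilon],\quad \Phi_\xi[\varepsilon]=[\theta\nabla_\xi\varepsilon],\quad g([\varepsilon],[\eta])=\text{coefficient of }\theta^n\text{ in }S(\varepsilon,\eta)\qquad(\varepsilon,\eta\in G_0),$$ $$R_\infty[s]=[-\tau\nabla_{\partial_\tau}s],\quad \triangledown_\xi[s]=[\nabla_\xi s]\qquad(s\in G_\infty)$$ define a Frobenius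 type structure with metric $(X,E,R_0,R_\infty,\Phi,\triangledown,g)$ on $X$. That is: $E$ is free of finite rank over $\mathbb C[x,x^{-1}]$; $R_0$, $R_\infty$, $\Phi_\xi$ are $\mathbb C[x,x^{-1}]$-linear and $\Phi_\xi,\triangledown_\xi$ are $\mathbb C[x,x^{-1}]$-linear in $\xi$; $\triangledown$ is a connection; $g$ is $\mathbb C[x,x^{-1}]$-bilinear, symmetric, and identifies $E$ with its dual; and $$\triangledown^2=0,\quad \triangledown(R_\infty)=0,\quad \Phi\wedge\Phi=0,\quad [R_0,\Phi]=0,\quad \triangledown(\Phi)=0,\quad \triangledown(R_0)+\Phi=[R_\infty,\Phi],$$ $$\triangledown(g)=0,\quad \Phi^*=\Phi,\quad R_0^*=R_0,\quad R_\infty+R_\infty^*=n\,\mathrm{Id},$$ where $^*$ is the adjoint with respect to $g$. -/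

import Mathlib

open Polynomial LaurentPolynomial

noncomputable section

namespace BrieskornLattice

/-! ### Rings -/

/-- `ℂ[x, x⁻¹]`, the ring of functions on `X = ℂ^*`. -/
abbrev OX : Type := LaurentPolynomial ℂ

/-- The coordinate `x` on `X`. -/
abbrev xX : OX := LaurentPolynomial.T 1

/-- `ℂ[x, x⁻¹, θ]`; the variable is `θ = τ⁻¹`. -/
abbrev OXθ : Type := Polynomial OX

/-- `ℂ[x, x⁻¹, θ, θ⁻¹] = ℂ[x, x⁻¹, τ, τ⁻¹]`; the variable is `θ`, so `T k` is `θ ^ k = τ ^ (-k)`. -/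
abbrev OXθθ : Type := LaurentPolynomial OX

/-- The element `τ = θ⁻¹`. -/
abbrev tau : OXθθ := LaurentPolynomial.T (-1)

/-- `B[u₁, u₁⁻¹, …, uₙ, uₙ⁻¹]`; the monomial `u^a` is `single a 1`. -/
abbrev Torus (n : ℕ) (B : Type) [CommRing B] : Type := AddMonoidAlgebra B (Fin n → ℤ)

/-! ### Derivations of monoid algebras -/

/-- A derivation of the coefficient ring, acting coefficientwise on `B[M]`. -/
def coeffDer {B M : Type} [CommRing B] [Algebra ℂ B] [AddCommMonoid M]
    (δ : Derivation ℂ B B) :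
    Derivation ℂ (AddMonoidAlgebra B M) (AddMonoidAlgebra B M) :=
  Derivation.mk'
    { toFun := fun f => AddMonoidAlgebra.map (δ : B →ₗ[ℂ] B).toAddMonoidHom f
      map_add' := fun f g => by ext m; simp
      map_smul' := fun c f => by ext m; simp }
    (fun f g => by
      induction f using AddMonoidAlgebra.induction_linear with
      | zero => simp
      | add f₁ f₂ h₁ h₂ =>
        simp only [add_mul, map_add, h₁, h₂, add_smul, smul_add]; abel
      | single a b =>
        induction g using AddMonoidAlgebra.induction_linear with
        | zero => simp
        | add g₁ g₂ h₁ h₂ =>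
          simp only [mul_add, map_add, h₁, h₂, add_smul, smul_add]; abel
        | single a' b' =>
          simp [AddMonoidAlgebra.single_mul_single, add_comm a a'])

/-- For additive `φ : M → ℤ`, the `B`-linear derivation of `B[M]` with `u^a ↦ φ(a) u^a`. -/
def degDer (B : Type) {M : Type} [CommRing B] [AddCommMonoid M] (φ : M →+ ℤ) :
    Derivation B (AddMonoidAlgebra B M) (AddMonoidAlgebra B M) :=
  Derivation.mk'
    { toFun := fun f => f.coeff.sum fun m c => AddMonoidAlgebra.single m ((φ m : B) * c)
      map_add' := fun f g => by
        rw [AddMonoidAlgebra.coeff_add, Finsupp.sum_add_index']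
        · intro m; simp
        · intro m c c'; simp [mul_add, AddMonoidAlgebra.single_add]
      map_smul' := fun c f => by
        change (c • f.coeff).sum _ = _
        rw [Finsupp.sum_smul_index' (by intro m; simp)]
        simp only [Finsupp.sum, Finset.smul_sum, AddMonoidAlgebra.smul_single, smul_eq_mul,
          RingHom.id_apply, mul_left_comm] }
    (fun f g => by
      induction f using AddMonoidAlgebra.induction_linear with
      | zero => simp
      | add f₁ f₂ h₁ h₂ =>
        simp only [add_mul, map_add, h₁, h₂, add_smul, smul_add]; abel
      | single a b =>
        induction g using AddMonoidAlgebra.induction_linear with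
        | zero => simp
        | add g₁ g₂ h₁ h₂ =>
          simp only [mul_add, map_add, h₁, h₂, add_smul, smul_add]; abel
        | single a' b' =>
          simp only [AddMonoidAlgebra.single_mul_single, LinearMap.coe_mk, AddHom.coe_mk,
            AddMonoidAlgebra.coeff_single, mul_zero, AddMonoidAlgebra.single_zero,
            Finsupp.sum_single_index, smul_eq_mul, add_comm a' a, map_add,
            ← AddMonoidAlgebra.single_add]
          congr 1
          push_cast
          ring)

/-- The logarithmic derivation `uᵢ ∂/∂uᵢ`. -/
def uD {n : ℕ} (B : Type) [CommRing B] (i : Fin n) : Derivation B (Torus n B) (Torus n B) :=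
  degDer B (Pi.evalAddMonoidHom (fun _ : Fin n => ℤ) i)

/-- A vector field `ξ` on `X`, as a derivation of `ℂ[x, x⁻¹, θ, θ⁻¹]` that kills `θ`. -/
def vfDer (ξ : Derivation ℂ OX OX) : Derivation ℂ OXθθ OXθθ := coeffDer ξ

/-- `∂/∂θ` on `ℂ[x, x⁻¹, θ, θ⁻¹]`. -/
def dθ : Derivation ℂ OXθθ OXθθ :=
  (LaurentPolynomial.T (-1) : OXθθ) • (degDer OX (AddMonoidHom.id ℤ)).restrictScalars ℂ

/-- `∂/∂τ = -θ² ∂/∂θ` on `ℂ[x, x⁻¹, τ, τ⁻¹]`. -/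
def dτ : Derivation ℂ OXθθ OXθθ := -((LaurentPolynomial.T 2 : OXθθ) • dθ)

/-! ### The Gauss-Manin system and the Brieskorn lattice -/

/-- `F(u, x) = u₁ + ⋯ + uₙ + x u₀`, where `u₀ = u₁^(-w₁) ⋯ uₙ^(-wₙ)`. -/
def potential {n : ℕ} (w : Fin n → ℕ) (B : Type) [CommRing B] [Algebra OX B] : Torus n B :=
  (∑ i, AddMonoidAlgebra.single (Pi.single i (1 : ℤ)) (1 : B)) +
    AddMonoidAlgebra.single (fun i => -(w i : ℤ)) (algebraMap OX B xX)

/-- The operator `p d_u - q d_uF ∧` from `(n-1)`-forms to `n`-forms on the torus with coefficients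
in `B`. Put `ω₀ = du₁/u₁ ∧ ⋯ ∧ duₙ/uₙ`. The `n`-form `g ω₀` is represented by `g`; the
`(n-1)`-form `∑ᵢ βᵢ (-1)^(i-1) du₁/u₁ ∧ ⋯ (omit i) ⋯ ∧ duₙ/uₙ` is represented by the family `β`.
Its relative differential is `(∑ᵢ uᵢ ∂βᵢ/∂uᵢ) ω₀` and its product with `d_uF` is
`(∑ᵢ (uᵢ ∂F/∂uᵢ) βᵢ) ω₀`. -/
def twistedD {n : ℕ} (w : Fin n → ℕ) (B : Type) [CommRing B] [Algebra OX B] (p q : B) :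
    (Fin n → Torus n B) →ₗ[B] Torus n B where
  toFun β := ∑ i, (p • uD B i (β i) - q • (uD B i (potential w B) * β i))
  map_add' β γ := by
    simp only [Pi.add_apply, map_add, mul_add, smul_add, ← Finset.sum_add_distrib]
    exact Finset.sum_congr rfl fun i _ => by abel
  map_smul' c β := by
    simp only [Pi.smul_apply, Derivation.map_smul, mul_smul_comm, RingHom.id_apply,
      Finset.smul_sum, smul_sub, smul_comm c]

theorem twistedD_apply {n : ℕ} (w : Fin n → ℕ) (B : Type) [CommRing B] [Algebra OX B] (p q : B)
    (β : Fin n → Torus n B) : twistedD w B p q β =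
      ∑ i, (p • uD B i (β i) - q • (uD B i (potential w B) * β i)) := rfl

/-- The Brieskorn lattice
`G₀ = Ωⁿ(U)[τ⁻¹, x, x⁻¹] / (τ⁻¹ d_u - d_uF ∧) Ωⁿ⁻¹(U)[τ⁻¹, x, x⁻¹]`. -/
abbrev G0 {n : ℕ} (w : Fin n → ℕ) : Type :=
  Torus n OXθ ⧸ LinearMap.range (twistedD w OXθ Polynomial.X 1)

/-- The Gauss-Manin system
`G = Ωⁿ(U)[τ, τ⁻¹, x, x⁻¹] / (d_u - τ d_uF ∧) Ωⁿ⁻¹(U)[τ, τ⁻¹, x, x⁻¹]`. -/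
abbrev G {n : ℕ} (w : Fin n → ℕ) : Type :=
  Torus n OXθθ ⧸ LinearMap.range (twistedD w OXθθ 1 tau)

theorem coeffDer_single {B M : Type} [CommRing B] [Algebra ℂ B] [AddCommMonoid M]
    (δ : Derivation ℂ B B) (m : M) (c : B) :
    coeffDer δ (AddMonoidAlgebra.single m c) = AddMonoidAlgebra.single m (δ c) := by
  simp [coeffDer]

theorem degDer_single {B M : Type} [CommRing B] [AddCommMonoid M] (φ : M →+ ℤ) (m : M) (c : B) :
    degDer B φ (AddMonoidAlgebra.single m c) = AddMonoidAlgebra.single m ((φ m : B) * c) := by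
  simp [degDer]

theorem uD_map {n : ℕ} {B B' : Type} [CommRing B] [CommRing B']
    (f : B →+* B') (i : Fin n) (g : Torus n B) :
    uD B' i (AddMonoidAlgebra.mapRingHom _ f g) = AddMonoidAlgebra.mapRingHom _ f (uD B i g) := by
  induction g using AddMonoidAlgebra.induction_linear with
  | zero => simp
  | add g₁ g₂ h₁ h₂ => simp only [map_add, h₁, h₂]
  | single a b => simp [uD, degDer_single]

theorem coeffDer_uD {n : ℕ} {B : Type} [CommRing B] [Algebra ℂ B] (δ : Derivation ℂ B B)
    (i : Fin n) (g : Torus n B) : coeffDer δ (uD B i g) = uD B i (coeffDer δ g) := by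
  induction g using AddMonoidAlgebra.induction_linear with
  | zero => simp
  | add g₁ g₂ h₁ h₂ => simp only [map_add, h₁, h₂]
  | single a b => simp [uD, degDer_single, coeffDer_single]

theorem map_potential {n : ℕ} (w : Fin n → ℕ) :
    AddMonoidAlgebra.mapRingHom _ (Polynomial.toLaurent : OXθ →+* OXθθ) (potential w OXθ) =
      potential w OXθθ := by
  have h : (Polynomial.toLaurent : OXθ →+* OXθθ) (algebraMap OX OXθ xX) =
      algebraMap OX OXθθ xX := Polynomial.toLaurent_C _
  simp only [potential, map_add, map_sum, AddMonoidAlgebra.mapRingHom_single, map_one, h]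

theorem map_smul_forms {n : ℕ} (c : OXθ) (g : Torus n OXθ) :
    AddMonoidAlgebra.mapRingHom _ (Polynomial.toLaurent : OXθ →+* OXθθ) (c • g) =
      Polynomial.toLaurent c •
        AddMonoidAlgebra.mapRingHom _ (Polynomial.toLaurent : OXθ →+* OXθθ) g := by
  ext m; simp

theorem map_twistedD {n : ℕ} (w : Fin n → ℕ) (β : Fin n → Torus n OXθ) :
    AddMonoidAlgebra.mapRingHom _ (Polynomial.toLaurent : OXθ →+* OXθθ)
      (twistedD w OXθ Polynomial.X 1 β) =
    twistedD w OXθθ 1 tau ((LaurentPolynomial.T 1 : OXθθ) • fun i =>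
      AddMonoidAlgebra.mapRingHom _ (Polynomial.toLaurent : OXθ →+* OXθθ) (β i)) := by
  have h : tau * (LaurentPolynomial.T 1 : OXθθ) = 1 := by
    rw [← LaurentPolynomial.T_add]; simp
  rw [twistedD_apply, twistedD_apply, map_sum]
  refine Finset.sum_congr rfl fun i _ => ?_
  rw [map_sub, map_smul_forms, one_smul, one_smul, map_mul, ← uD_map, ← uD_map, map_potential,
    Pi.smul_apply, Derivation.map_smul, mul_smul_comm, smul_smul, h, one_smul,
    Polynomial.toLaurent_X]

/-- The natural map `G₀ → G`, linear over `ℂ[x, x⁻¹, θ] → ℂ[x, x⁻¹, θ, θ⁻¹]`. -/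
def toG {n : ℕ} (w : Fin n → ℕ) :
    G0 w →ₛₗ[(Polynomial.toLaurent : OXθ →+* OXθθ)] G w :=
  Submodule.mapQ _ _
    ({ toFun := AddMonoidAlgebra.mapRingHom _ (Polynomial.toLaurent : OXθ →+* OXθθ)
       map_add' := map_add _
       map_smul' := map_smul_forms } :
      Torus n OXθ →ₛₗ[(Polynomial.toLaurent : OXθ →+* OXθθ)] Torus n OXθθ)
    (by
      rintro _ ⟨β, rfl⟩
      exact ⟨_, (map_twistedD w β).symm⟩)

theorem smul_eq_single_mul {n : ℕ} (c : OXθθ) (g : Torus n OXθθ) :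
    c • g = AddMonoidAlgebra.single 0 c * g := by
  ext m; simp

theorem dτ_tau : dτ tau = 1 := by
  have h : degDer OX (AddMonoidHom.id ℤ) (AddMonoidAlgebra.single (-1 : ℤ) (1 : OX)) =
      -(tau : OXθθ) := by
    rw [degDer_single, mul_one]
    simp only [AddMonoidHom.id_apply, Int.cast_neg, Int.cast_one, AddMonoidAlgebra.single_neg]
    rfl
  change -((LaurentPolynomial.T 2 : OXθθ) * ((LaurentPolynomial.T (-1) : OXθθ) *
    degDer OX (AddMonoidHom.id ℤ) (AddMonoidAlgebra.single (-1 : ℤ) (1 : OX)))) = 1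
  rw [h]
  have h2 : (LaurentPolynomial.T 2 : OXθθ) * (LaurentPolynomial.T (-1) * tau) = 1 := by
    rw [← LaurentPolynomial.T_add, ← LaurentPolynomial.T_add]; simp
  linear_combination h2

theorem dτ_C (f : OX) : dτ (LaurentPolynomial.C f) = 0 := by
  change -((LaurentPolynomial.T 2 : OXθθ) * ((LaurentPolynomial.T (-1) : OXθθ) *
    degDer OX (AddMonoidHom.id ℤ) (AddMonoidAlgebra.single (0 : ℤ) f))) = 0
  rw [degDer_single]
  simp

theorem vfDer_tau (ξ : Derivation ℂ OX OX) : vfDer ξ tau = 0 := by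
  change coeffDer ξ (AddMonoidAlgebra.single (-1 : ℤ) (1 : OX)) = 0
  rw [coeffDer_single]; simp

theorem twisted_commute {n : ℕ} (w : Fin n → ℕ) (δ : Derivation ℂ OXθθ OXθθ) (h : Torus n OXθθ)
    (hh : ∀ i, uD OXθθ i h = coeffDer δ (tau • uD OXθθ i (potential w OXθθ)))
    (β : Fin n → Torus n OXθθ) :
    coeffDer δ (twistedD w OXθθ 1 tau β) - h * twistedD w OXθθ 1 tau β =
      twistedD w OXθθ 1 tau fun i => coeffDer δ (β i) - h * β i := by
  rw [twistedD_apply, twistedD_apply, map_sum, Finset.mul_sum, ← Finset.sum_sub_distrib]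
  refine Finset.sum_congr rfl fun i _ => ?_
  simp only [one_smul, ← smul_mul_assoc, map_sub, Derivation.leibniz, ← hh, coeffDer_uD, smul_eq_mul]
  ring

/-- `coeffDer δ - h` descends to the Gauss-Manin system as soon as it commutes with the
twisted differential. -/
def descend {n : ℕ} (w : Fin n → ℕ) (δ : Derivation ℂ OXθθ OXθθ) (h : Torus n OXθθ)
    (hh : ∀ i, uD OXθθ i h = coeffDer δ (tau • uD OXθθ i (potential w OXθθ))) :
    G w →ₗ[ℂ] G w :=
  (Submodule.Quotient.restrictScalarsEquiv ℂ (LinearMap.range (twistedD w OXθθ 1 tau))).toLinearMap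
    ∘ₗ Submodule.mapQ ((LinearMap.range (twistedD w OXθθ 1 tau)).restrictScalars ℂ)
      ((LinearMap.range (twistedD w OXθθ 1 tau)).restrictScalars ℂ)
      ((coeffDer δ : Derivation ℂ (Torus n OXθθ) (Torus n OXθθ)).toLinearMap -
        LinearMap.mulLeft ℂ h)
      (by
        rintro _ ⟨β, rfl⟩
        exact ⟨_, (twisted_commute w δ h hh β).symm⟩)
    ∘ₗ (Submodule.Quotient.restrictScalarsEquiv ℂ
      (LinearMap.range (twistedD w OXθθ 1 tau))).symm.toLinearMap

/-- `∇_{∂τ} [ω] = [∂ω/∂τ - F ω]`. -/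
def nablaτ {n : ℕ} (w : Fin n → ℕ) : G w →ₗ[ℂ] G w :=
  descend w dτ (potential w OXθθ) (fun i => by
    have h0 : coeffDer dτ (potential w OXθθ) = 0 := by
      simp [potential, coeffDer_single, dτ_C]
    rw [smul_eq_single_mul, Derivation.leibniz, coeffDer_uD, h0, coeffDer_single, dτ_tau,
      smul_eq_mul, smul_eq_mul, ← AddMonoidAlgebra.one_def]
    simp)

/-- `∇_{∂θ} = -τ² ∇_{∂τ}`. -/
def nablaθ {n : ℕ} (w : Fin n → ℕ) : G w →ₗ[ℂ] G w :=
  -((LaurentPolynomial.T (-2) : OXθθ) • nablaτ w)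

/-- The pull-back `∇̌_{∂θ}` of `∇_{∂θ}` by `j : θ ↦ -θ`. Here `j^*G` is the group `G` with `p(θ)`
acting as `p(-θ)`, and `∇̌_{∂θ} = -∇_{∂θ}` as a map of this group: if `A(θ, x)` is the matrix of
`∇_{∂θ}` in a basis of `G`, then `-A(-θ, x)` is the matrix of `∇̌_{∂θ}` in the same basis
of `j^*G`. -/
def nablaθCheck {n : ℕ} (w : Fin n → ℕ) : G w →ₗ[ℂ] G w := -nablaθ w

/-- `∇_ξ [ω] = [ξ(ω) - τ ξ(F) ω]` for a vector field `ξ` on `X`. -/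
def nablaX {n : ℕ} (w : Fin n → ℕ) (ξ : Derivation ℂ OX OX) : G w →ₗ[ℂ] G w :=
  descend w (vfDer ξ) (tau • coeffDer (vfDer ξ) (potential w OXθθ)) (fun i => by
    rw [smul_eq_single_mul tau (uD _ _ _), Derivation.leibniz, coeffDer_uD, coeffDer_single,
      vfDer_tau, Derivation.map_smul, smul_eq_single_mul]
    simp)

/-! ### The sections `ω₀, …, ω_{μ-1}` -/

/-- `μ = 1 + w₁ + ⋯ + wₙ`. -/
def mu {n : ℕ} (w : Fin n → ℕ) : ℕ := 1 + ∑ i, w i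

/-- The weights `(w₀, w₁, …, wₙ)`, with `w₀ = 1`. -/
def weights {n : ℕ} (w : Fin n → ℕ) : Fin (n + 1) → ℕ := Fin.cons 1 w

theorem minimizers_nonempty {n : ℕ} (w : Fin n → ℕ) (a : Fin (n + 1) → ℕ) :
    (Finset.univ.filter fun j => ∀ i,
      (a j : ℚ) / (weights w j : ℚ) ≤ (a i : ℚ) / (weights w i : ℚ)).Nonempty := by
  obtain ⟨j, -, hj⟩ := Finset.exists_min_image (Finset.univ : Finset (Fin (n + 1)))
    (fun i => (a i : ℚ) / (weights w i : ℚ)) Finset.univ_nonempty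
  exact ⟨j, by simpa using hj⟩

/-- The least `j ∈ {0, …, n}` for which `a_j / w_j` is minimal. -/
def nextIndex {n : ℕ} (w : Fin n → ℕ) (a : Fin (n + 1) → ℕ) : Fin (n + 1) :=
  (Finset.univ.filter fun j => ∀ i,
      (a j : ℚ) / (weights w j : ℚ) ≤ (a i : ℚ) / (weights w i : ℚ)).min'
    (minimizers_nonempty w a)

/-- The multi-indices `a(k) ∈ ℕⁿ⁺¹`: `a(0) = 0` and `a(k+1) = a(k) + e_j`, where `j` is the least
index for which `a(k)_j / w_j` is minimal. -/
def multiIndex {n : ℕ} (w : Fin n → ℕ) : ℕ → Fin (n + 1) → ℕ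
  | 0 => 0
  | k + 1 => multiIndex w k + Pi.single (nextIndex w (multiIndex w k)) 1

/-- `ω_k = (∏ᵢ wᵢ^(-a(k)ᵢ)) u₀^{a(k)₀} u₁^{a(k)₁} ⋯ uₙ^{a(k)ₙ} ω₀` in `G₀`. Thus
`ω₁ = u₀ ω₀`, and `ω_{k+1} = (u_j / w_j) ω_k` for the index `j` of step `k`. -/
def omega {n : ℕ} (w : Fin n → ℕ) (k : ℕ) : G0 w :=
  Submodule.Quotient.mk
    (AddMonoidAlgebra.single
      (fun i : Fin n => (multiIndex w k i.succ : ℤ) - (multiIndex w k 0 : ℤ) * (w i : ℤ))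
      (algebraMap ℂ OXθ (∏ i : Fin n, ((w i : ℂ) ^ multiIndex w k i.succ)⁻¹)))

/-! ### The form `S` -/

/-- `κ = ∏ᵢ wᵢ^(-wᵢ)`. -/
def kappa {n : ℕ} (w : Fin n → ℕ) : ℂ := ∏ i, ((w i : ℂ) ^ w i)⁻¹

/-- `θ⁻ⁿ S(ω_i, ω_j)`. -/
def gramX {n : ℕ} (w : Fin n → ℕ) (i j : Fin (mu w)) : OX :=
  if (i : ℕ) + j = n then
    if (i : ℕ) = 0 ∨ (j : ℕ) = 0 then LaurentPolynomial.T (-1) else LaurentPolynomial.T (-2)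
  else if n + 1 ≤ (i : ℕ) ∧ (i : ℕ) + j = mu w + n then
    LaurentPolynomial.C (kappa w) * LaurentPolynomial.T (-1)
  else 0

/-- The form with Gram matrix `s` in the basis `b`, linear in the first and `σ`-linear in the
second argument. -/
def sesqForm {B M ι : Type} [CommRing B] [AddCommGroup M] [Module B M] [Fintype ι]
    (σ : B →+* B) (b : Module.Basis ι B M) (s : ι → ι → B) (ε η : M) : B :=
  ∑ i, ∑ j, b.repr ε i * σ (b.repr η j) * s i j

/-- `θ ↦ -θ` on `ℂ[x, x⁻¹, θ]`. -/
def conjθ : OXθ →+* OXθ := Polynomial.compRingHom (-Polynomial.X)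

/-- `θ ↦ -θ` on `ℂ[x, x⁻¹, θ, θ⁻¹]`. -/
def conjθθ : OXθθ →+* OXθθ :=
  LaurentPolynomial.eval₂ LaurentPolynomial.C
    (-(LaurentPolynomial.isUnit_T (R := OX) 1).unit)

/-- The form `S` on `G₀`, with `S(ω_i, ω_j)` prescribed on the basis `b = ω`, and
`p(θ) S(ε, η) = S(p(θ) ε, η) = S(ε, p(-θ) η)`. -/
def formS {n : ℕ} (w : Fin n → ℕ) (b : Module.Basis (Fin (mu w)) OXθ (G0 w)) :
    G0 w → G0 w → OXθ :=
  sesqForm conjθ b fun i j => Polynomial.C (gramX w i j) * Polynomial.X ^ n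

/-- The extension of `S` to `G = G₀[θ⁻¹]`, with the same rules and the same values on `ω`. -/
def formSG {n : ℕ} (w : Fin n → ℕ) (b : Module.Basis (Fin (mu w)) OXθθ (G w)) :
    G w → G w → OXθθ :=
  sesqForm conjθθ b fun i j => LaurentPolynomial.C (gramX w i j) * LaurentPolynomial.T n

/-! ### The trivial bundle on `ℙ¹ × X` and its restrictions -/

/-- `E = G₀ / θ G₀`, the restriction to `θ = 0`. -/
abbrev E0 {n : ℕ} (w : Fin n → ℕ) : Type :=
  G0 w ⧸ (Ideal.span {(Polynomial.X : OXθ)} • (⊤ : Submodule OXθ (G0 w)))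

/-- The class of a section in `E`. -/
def cls0 {n : ℕ} (w : Fin n → ℕ) (ε : G0 w) : E0 w := Submodule.Quotient.mk ε

/-- `G_∞`, the `ℂ[x, x⁻¹, τ]`-submodule of `G` generated by `ω₀, …, ω_{μ-1}` (the sections of the
bundle on the chart `τ ≠ ∞`), as a `ℂ[x, x⁻¹]`-module. -/
def Ginf {n : ℕ} (w : Fin n → ℕ) : Submodule OX (G w) :=
  Submodule.span OX
    (Set.range fun p : ℕ × Fin (mu w) => tau ^ p.1 • toG w (omega w p.2))

/-- `E_∞ = G_∞ / τ G_∞`, the restriction to `τ = 0`. -/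
abbrev Einf {n : ℕ} (w : Fin n → ℕ) : Type :=
  Ginf w ⧸ ((Ginf w).map ((tau • LinearMap.id : G w →ₗ[OXθθ] G w).restrictScalars OX)).submoduleOf
    (Ginf w)

/-- The class of a section in `E_∞`. -/
def clsInf {n : ℕ} (w : Fin n → ℕ) (s : Ginf w) : Einf w := Submodule.Quotient.mk s

/-! ### Frobenius type structures -/

/-- Frobenius type structures with metric on the affine variety with ring of functions `O`.
`Φ` and the connection `D` are given by their contractions `Φ_ξ`, `D_ξ` with vector fields `ξ`; `r` is the constant in
`R_∞ + R_∞^* = r Id`. -/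
structure IsFrobeniusTypeStructure {O E : Type} [CommRing O] [Algebra ℂ O] [AddCommGroup E]
    [Module O E] [Module ℂ E] [IsScalarTower ℂ O E]
    (R0 Rinf : E →ₗ[O] E)
    (Φ : Derivation ℂ O O →ₗ[O] (E →ₗ[O] E))
    (D : Derivation ℂ O O →ₗ[O] (E →ₗ[ℂ] E))
    (g : E →ₗ[O] E →ₗ[O] O) (r : ℂ) : Prop where
  free : Module.Free O E
  finite : Module.Finite O E
  /-- `D` is a connection -/
  leibniz : ∀ ξ (f : O) (e : E), D ξ (f • e) = ξ f • e + f • D ξ e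
  /-- `g` is symmetric -/
  symm : ∀ e e', g e e' = g e' e
  /-- `g` is nondegenerate: it identifies `E` with its dual -/
  nondegenerate : Function.Bijective g
  /-- `D² = 0` -/
  flat : ∀ ξ ζ e, D ξ (D ζ e) - D ζ (D ξ e) = D ⁅ξ, ζ⁆ e
  /-- `D(R_∞) = 0` -/
  flat_Rinf : ∀ ξ e, D ξ (Rinf e) = Rinf (D ξ e)
  /-- `Φ ∧ Φ = 0` -/
  higgs : ∀ ξ ζ e, Φ ξ (Φ ζ e) = Φ ζ (Φ ξ e)
  /-- `[R₀, Φ] = 0` -/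
  comm_R0 : ∀ ξ e, R0 (Φ ξ e) = Φ ξ (R0 e)
  /-- `D(Φ) = 0` -/
  flat_Φ : ∀ ξ ζ e,
    (D ξ (Φ ζ e) - Φ ζ (D ξ e)) - (D ζ (Φ ξ e) - Φ ξ (D ζ e)) = Φ ⁅ξ, ζ⁆ e
  /-- `D(R₀) + Φ = [R_∞, Φ]` -/
  deriv_R0 : ∀ ξ e, (D ξ (R0 e) - R0 (D ξ e)) + Φ ξ e = Rinf (Φ ξ e) - Φ ξ (Rinf e)
  /-- `D(g) = 0` -/
  flat_g : ∀ ξ e e', ξ (g e e') = g (D ξ e) e' + g e (D ξ e')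
  /-- `Φ^* = Φ` -/
  adjoint_Φ : ∀ ξ e e', g (Φ ξ e) e' = g e (Φ ξ e')
  /-- `R₀^* = R₀` -/
  adjoint_R0 : ∀ e e', g (R0 e) e' = g e (R0 e')
  /-- `R_∞ + R_∞^* = r Id` -/
  adjoint_Rinf : ∀ e e', g (Rinf e) e' + g e (Rinf e') = r • g e e'

end BrieskornLattice
end

noncomputable section

namespace BrieskornLattice

/-! ### The multi-indices and the slopes -/

/-! In the quotient, the exact form built from `u^m` in the `i`-th logarithmic direction gives `[u_i
u^m] = w_i [x u₀ u^m] + θ m_i [u^m]`. For `1 ≤ k < μ` the greedy index `j` of step `k` is not `0`,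
the exponent of `u_j` in `ω_k` is `a(k)_j - w_j`, and the relation becomes `x u₀ ω_k = ω_{k+1} - θ
(α_k - 1) ω_k`, where `α_k = a(k)_j / w_j` is the slope. Moreover `x u₀ ω₀ = x ω₁`, and `ω_μ = κ ω₀`
because `a(μ) = (1, w)` and `u₀ u^w = 1`. So `x u₀` acts on the `ω_k` as a weighted cyclic shift
minus `θ` times a constant diagonal matrix.

This shows that the `ω_k` generate. For independence the action is rebuilt on the free module `B^μ`:
put `N = shift - θ (diagonal + x ∂/∂x)` and `q = x⁻¹ N`, and send `u₀^{a₀} u^a` to `q^{a₀} ∏ᵢ ∏_{l <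
aᵢ} (wᵢ N + l θ) e₀`. Since `q N = (N - θ) q`, compatibility with `u₀ u^w = 1` reduces to one
equation of hypergeometric type for `e₀`, and the greedy path from `0` to `(1, w)` proves it
(`monVec_omega`, `monVec_add_weights`, `exists_model_family`). The resulting map kills exact forms
and inverts `e_k ↦ [ω_k]` (`exists_basis_omegaForm`). The argument is run once for `p d - q dF` with
`p = θ q` and `q` a unit, which covers both `G₀` and `G`.

Summing the relations over `i` gives `[F u^m] = μ [x u₀ u^m] + θ (∑ mᵢ) [u^m]`. Hence in the basis
`ω` both connections are explicit combinations of the shift and of constant diagonal matrices with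
entries affine in `α_k` (`nablaX_fromModel`, `nablaτ_fromModel`). What remains are three facts about
these matrices. The shift is self-adjoint for the pairing of indices with sum `n` modulo `μ`
(`sum_shiftMap_mul`). The slopes are the numbers `l / wᵢ` in increasing order, so `l ↦ wᵢ - l`
yields `α_k + α_{μ+n-k} = 1` (`slope_add_slope`), which gives flatness of `S` and `R_∞ + R_∞^* = n`.
The commutator of the flat connection with the shift is governed by the differences of the spectral
numbers `k - μ α_k` (`mul_commutator_modelD_shiftMap`), which gives the relation between `R₀`, `R_∞`
and `Φ`. Constant terms of coordinates at `θ = 0` and at `τ = 0` identify `E` and `E_∞` with the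
model and carry the structure over. -/

/-- The minimal value of `a(k)_j / w_j`. -/
def slope {n : ℕ} (w : Fin n → ℕ) (k : ℕ) : ℚ :=
  (multiIndex w k (nextIndex w (multiIndex w k)) : ℚ) /
    (weights w (nextIndex w (multiIndex w k)) : ℚ)

variable {n : ℕ} {w : Fin n → ℕ}

theorem weights_pos (hw : ∀ i, 0 < w i) (i : Fin (n + 1)) : 0 < weights w i := by
  refine Fin.cases ?_ (fun j => ?_) i
  · simp [weights]
  · simpa [weights] using hw j

theorem weights_pos_rat (hw : ∀ i, 0 < w i) (i : Fin (n + 1)) : (0 : ℚ) < weights w i := by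
  exact_mod_cast weights_pos hw i

theorem sum_weights : ∑ i, weights w i = mu w := by
  simp [weights, mu, Fin.sum_univ_succ]

theorem slope_le (k : ℕ) (i : Fin (n + 1)) :
    slope w k ≤ (multiIndex w k i : ℚ) / weights w i := by
  have h := Finset.min'_mem _ (minimizers_nonempty w (multiIndex w k))
  exact (Finset.mem_filter.mp h).2 i

theorem multiIndex_succ (k : ℕ) : multiIndex w (k + 1) =
    multiIndex w k + Pi.single (nextIndex w (multiIndex w k)) 1 := rfl

theorem multiIndex_le_succ (k : ℕ) (i : Fin (n + 1)) :
    multiIndex w k i ≤ multiIndex w (k + 1) i := by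
  simp [multiIndex_succ]

theorem sum_multiIndex (k : ℕ) : ∑ i, multiIndex w k i = k := by
  induction k with
  | zero => simp [multiIndex]
  | succ k ih => simp [multiIndex_succ, Finset.sum_add_distrib, ih]

theorem slope_nonneg (k : ℕ) : 0 ≤ slope w k := by
  unfold slope; positivity

theorem slope_mul_weight (hw : ∀ i, 0 < w i) (k : ℕ) :
    slope w k * weights w (nextIndex w (multiIndex w k)) =
      multiIndex w k (nextIndex w (multiIndex w k)) :=
  div_mul_cancel₀ _ (weights_pos_rat hw _).ne'

/-- If all quotients were at least `1`, the entries, whose sum is `k`, would add up to at least `μ`.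
-/
theorem slope_lt_one (hw : ∀ i, 0 < w i) {k : ℕ} (hk : k < mu w) : slope w k < 1 := by
  by_contra! h
  have : ∀ i, weights w i ≤ multiIndex w k i := fun i => by
    have := (le_div_iff₀ (weights_pos_rat hw i)).mp (h.trans (slope_le k i))
    rw [one_mul] at this
    exact_mod_cast this
  have := Finset.sum_le_sum fun i (_ : i ∈ Finset.univ) => this i
  rw [sum_weights, sum_multiIndex] at this
  omega

theorem multiIndex_nextIndex_lt (hw : ∀ i, 0 < w i) {k : ℕ} (hk : k < mu w) :
    multiIndex w k (nextIndex w (multiIndex w k)) <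
      weights w (nextIndex w (multiIndex w k)) := by
  have h := slope_lt_one hw hk
  rw [slope, div_lt_one (weights_pos_rat hw _)] at h
  exact_mod_cast h

theorem multiIndex_le_weights (hw : ∀ i, 0 < w i) {k : ℕ} (hk : k ≤ mu w) (i : Fin (n + 1)) :
    multiIndex w k i ≤ weights w i := by
  induction k with
  | zero => simp [multiIndex]
  | succ k ih =>
    rw [multiIndex_succ, Pi.add_apply]
    rcases eq_or_ne i (nextIndex w (multiIndex w k)) with rfl | hi
    · simpa using multiIndex_nextIndex_lt hw (k := k) (by omega)
    · simpa [Pi.single_eq_of_ne hi] using ih (by omega)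

theorem multiIndex_mu (hw : ∀ i, 0 < w i) : multiIndex w (mu w) = weights w := by
  funext i
  refine (Finset.sum_eq_sum_iff_of_le fun j _ => multiIndex_le_weights hw le_rfl j).mp ?_ i
    (Finset.mem_univ i)
  rw [sum_weights, sum_multiIndex]

/-- All quotients tie at `0`, and ties go to the least index. The path therefore starts with `u₀`,
and since `w₀ = 1` it does not use `u₀` again before step `μ`. -/
theorem nextIndex_zero : nextIndex w (multiIndex w 0) = 0 := by
  refine le_antisymm (Finset.min'_le _ _ ?_) (Fin.zero_le _)
  simp [multiIndex]

theorem multiIndex_one : multiIndex w 1 = Pi.single 0 1 := by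
  rw [multiIndex_succ, nextIndex_zero]
  simp [multiIndex]

theorem multiIndex_apply_zero (hw : ∀ i, 0 < w i) {k : ℕ} (h1 : 1 ≤ k) (hk : k ≤ mu w) :
    multiIndex w k 0 = 1 := by
  refine le_antisymm (by simpa [weights] using multiIndex_le_weights hw hk 0) ?_
  calc 1 = multiIndex w 1 0 := by simp [multiIndex_one]
    _ ≤ multiIndex w k 0 := monotone_nat_of_le_succ (f := fun k => multiIndex w k 0)
      (fun k => multiIndex_le_succ k 0) h1

theorem nextIndex_ne_zero (hw : ∀ i, 0 < w i) {k : ℕ} (h1 : 1 ≤ k) (hk : k < mu w) :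
    nextIndex w (multiIndex w k) ≠ 0 := fun h => by
  have := multiIndex_nextIndex_lt hw hk
  rw [h, multiIndex_apply_zero hw h1 hk.le] at this
  simp [weights] at this

theorem slope_le_slope_succ (hw : ∀ i, 0 < w i) (k : ℕ) : slope w k ≤ slope w (k + 1) := by
  refine (slope_le k (nextIndex w (multiIndex w (k + 1)))).trans ?_
  have := weights_pos_rat hw (nextIndex w (multiIndex w (k + 1)))
  unfold slope
  gcongr
  exact multiIndex_le_succ k _

/-- Just after being raised at step `l`, an entry equals `slope w l * wᵢ + 1`; slopes never decrease
afterwards. -/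
theorem multiIndex_le_slope (hw : ∀ i, 0 < w i) (k : ℕ) (i : Fin (n + 1)) :
    (multiIndex w k i : ℚ) ≤ slope w k * weights w i + 1 := by
  induction k with
  | zero =>
    have := mul_nonneg (slope_nonneg (w := w) 0) (weights_pos_rat hw i).le
    simp only [multiIndex, Pi.zero_apply, Nat.cast_zero]
    linarith
  | succ k ih =>
    have h := mul_le_mul_of_nonneg_right (slope_le_slope_succ hw k) (weights_pos_rat hw i).le
    rw [multiIndex_succ, Pi.add_apply]
    rcases eq_or_ne i (nextIndex w (multiIndex w k)) with rfl | hi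
    · rw [slope_mul_weight hw] at h
      simpa using h
    · rw [Pi.single_eq_of_ne hi, add_zero]
      linarith

/-- The number of pairs `(i, l)` with `l / w_i < t`, for `0 ≤ t ≤ 1`. -/
def countLt (w : Fin n → ℕ) (t : ℚ) : ℤ := ∑ i, ⌈t * weights w i⌉

/-- The number of pairs `(i, l)` with `l / w_i ≤ t`, for `0 ≤ t < 1`. -/
def countLe (w : Fin n → ℕ) (t : ℚ) : ℤ := ∑ i, (⌊t * weights w i⌋ + 1)

theorem countLt_slope_le (hw : ∀ i, 0 < w i) (k : ℕ) : countLt w (slope w k) ≤ k := by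
  calc countLt w (slope w k) ≤ ∑ i, (multiIndex w k i : ℤ) := Finset.sum_le_sum fun i _ => by
        rw [Int.ceil_le, Int.cast_natCast]
        exact (le_div_iff₀ (weights_pos_rat hw i)).mp (slope_le k i)
    _ = k := by exact_mod_cast sum_multiIndex k

theorem lt_countLe_slope (hw : ∀ i, 0 < w i) (k : ℕ) : (k : ℤ) < countLe w (slope w k) := by
  calc (k : ℤ) = ∑ i, (multiIndex w k i : ℤ) := by exact_mod_cast (sum_multiIndex k).symm
    _ < countLe w (slope w k) := Finset.sum_lt_sum
      (fun i _ => by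
        rw [← sub_le_iff_le_add, Int.le_floor]
        have := multiIndex_le_slope hw k i
        push_cast
        linarith)
      ⟨nextIndex w (multiIndex w k), Finset.mem_univ _, by
        rw [slope_mul_weight hw]
        simp⟩

theorem countLe_le_countLt (hw : ∀ i, 0 < w i) {s t : ℚ} (h : s < t) :
    countLe w s ≤ countLt w t := Finset.sum_le_sum fun i _ => by
  rw [Int.add_one_le_iff, Int.lt_ceil]
  exact (Int.floor_le _).trans_lt (mul_lt_mul_of_pos_right h (weights_pos_rat hw i))

/-- By `countLe_le_countLt` the intervals `[countLt t, countLe t)` for distinct `t` are disjoint,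
and `k` lies in the one attached to `slope w k`. In other words, the slopes for `k < μ` enumerate
the numbers `l / wᵢ` in increasing order. -/
theorem slope_eq_of_count (hw : ∀ i, 0 < w i) {k : ℕ} {t : ℚ} (h₁ : countLt w t ≤ k)
    (h₂ : (k : ℤ) < countLe w t) : slope w k = t := by
  rcases lt_trichotomy (slope w k) t with h | h | h
  · linarith [countLe_le_countLt hw h, lt_countLe_slope hw k]
  · exact h
  · linarith [countLe_le_countLt hw h, countLt_slope_le hw k]

theorem slope_eq_zero (hw : ∀ i, 0 < w i) {k : ℕ} (hk : k ≤ n) : slope w k = 0 :=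
  slope_eq_of_count hw (by simp [countLt]) (by simp [countLe]; omega)

theorem sum_weights_int : ∑ i, (weights w i : ℤ) = mu w := by
  exact_mod_cast sum_weights

/-- The reflection `l ↦ wᵢ - l` exchanges strict and weak inequalities; for the sums this is the
exchange of ceiling and floor under negation. -/
theorem countLt_one_sub (t : ℚ) : countLt w (1 - t) = mu w + n + 1 - countLe w t := by
  have : ∀ i, ⌈(1 - t) * weights w i⌉ = weights w i - ⌊t * weights w i⌋ := fun i => by
    rw [sub_mul, one_mul, sub_eq_neg_add, Int.ceil_add_natCast, Int.ceil_neg]; ring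
  simp only [countLt, countLe, this, Finset.sum_sub_distrib, Finset.sum_add_distrib,
    sum_weights_int]
  simp
  ring

theorem countLe_one_sub (t : ℚ) : countLe w (1 - t) = mu w + n + 1 - countLt w t := by
  have : ∀ i, ⌊(1 - t) * weights w i⌋ = weights w i - ⌈t * weights w i⌉ := fun i => by
    rw [sub_mul, one_mul, sub_eq_neg_add, Int.floor_add_natCast, Int.floor_neg]; ring
  simp only [countLt, countLe, this, Finset.sum_sub_distrib, Finset.sum_add_distrib,
    sum_weights_int]
  simp
  ring

/-- The two reflection formulas turn the counting inequalities for `k` at `slope w k` into those for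
`l` at `1 - slope w k`. The extra `n` comes from the `n + 1` slopes equal to `0`. -/
theorem slope_add_slope (hw : ∀ i, 0 < w i) {k l : ℕ} (h : k + l = mu w + n) :
    slope w k + slope w l = 1 := by
  have h' : (k : ℤ) + l = mu w + n := by exact_mod_cast h
  rw [slope_eq_of_count hw (k := l) (t := 1 - slope w k)]
  · ring
  · rw [countLt_one_sub]
    linarith [lt_countLe_slope hw k]
  · rw [countLe_one_sub]
    linarith [countLt_slope_le hw k]

/-! ### Families indexed by `ℤⁿ` from commuting operators -/

section Hypergeometric

variable {n : ℕ} {V : Type} [AddCommGroup V] [Module ℂ V]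

/-- Evaluation of polynomials in two variables at two commuting endomorphisms. -/
def evalPair (Θ N : Module.End ℂ V) (h : Commute Θ N) : ℂ[X][X] →+* Module.End ℂ V :=
  Polynomial.eval₂RingHom' (Polynomial.aeval Θ : ℂ[X] →ₐ[ℂ] Module.End ℂ V).toRingHom N
    fun a => by
      induction a using Polynomial.induction_on' with
      | add p q hp hq => rw [map_add]; exact hp.add_left hq
      | monomial m c =>
        rw [AlgHom.toRingHom_eq_coe, RingHom.coe_coe, Polynomial.aeval_monomial]
        exact Commute.mul_left (Algebra.commutes c N) (h.pow_left m)

variable {Θ N q : Module.End ℂ V} (h : Commute Θ N)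

theorem evalPair_C (a : ℂ[X]) : evalPair Θ N h (Polynomial.C a) = Polynomial.aeval Θ a :=
  Polynomial.eval₂_C _ _

theorem evalPair_X : evalPair Θ N h Polynomial.X = N := Polynomial.eval₂_X _ _

theorem evalPair_C_X : evalPair Θ N h (Polynomial.C Polynomial.X) = Θ := by
  rw [evalPair_C, Polynomial.aeval_X]

/-- The hypothesis says `q (N + Θ) = N q`, so a polynomial in `N + Θ` loses its shift when `q`
passes through it. -/
theorem mul_evalPair_comp (hΘ : Commute Θ q) (hq : q * N = (N - Θ) * q) (p : ℂ[X][X]) :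
    q * evalPair Θ N h (p.comp (Polynomial.X + Polynomial.C Polynomial.X)) =
      evalPair Θ N h p * q := by
  have hC : ∀ a : ℂ[X], Commute (Polynomial.aeval Θ a) q := fun a => by
    induction a using Polynomial.induction_on' with
    | add p q hp hq => rw [map_add]; exact hp.add_left hq
    | monomial m c =>
      rw [Polynomial.aeval_monomial]
      exact Commute.mul_left (Algebra.commutes c q) (hΘ.pow_left m)
  induction p using Polynomial.induction_on with
  | C a => simpa [evalPair_C] using (hC a).eq.symm
  | add p₁ p₂ h₁ h₂ => simp only [Polynomial.add_comp, map_add, mul_add, add_mul, h₁, h₂]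
  | monomial m a ih =>
    rw [pow_succ, ← mul_assoc, Polynomial.mul_comp, Polynomial.X_comp, map_mul, ← mul_assoc, ih,
      map_mul _ _ Polynomial.X, map_add, evalPair_X, evalPair_C_X, mul_assoc, mul_assoc, mul_add,
      hq, ← hΘ.eq, ← add_mul, sub_add_cancel]

/-- `∏ᵢ ∏_{l < aᵢ} (wᵢ N + l θ)`. -/
def risingProd (w : Fin n → ℕ) (a : Fin n → ℕ) : ℂ[X][X] :=
  ∏ i, ∏ l ∈ Finset.range (a i),
    ((w i : ℂ[X][X]) * Polynomial.X + (l : ℂ[X][X]) * Polynomial.C Polynomial.X)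

theorem risingProd_zero (w : Fin n → ℕ) : risingProd w 0 = 1 := by simp [risingProd]

theorem risingProd_add_single (w a : Fin n → ℕ) (i : Fin n) :
    risingProd w (a + Pi.single i 1) =
      ((w i : ℂ[X][X]) * Polynomial.X + (a i : ℂ[X][X]) * Polynomial.C Polynomial.X) *
        risingProd w a := by
  rw [risingProd, risingProd, ← Finset.mul_prod_erase _ _ (Finset.mem_univ i),
    ← Finset.mul_prod_erase _ _ (Finset.mem_univ i), ← mul_assoc]
  congr 1
  · rw [Pi.add_apply, Pi.single_eq_same, Finset.prod_range_succ, mul_comm]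
  · refine Finset.prod_congr rfl fun j hj => ?_
    rw [Pi.add_apply, Pi.single_eq_of_ne (Finset.ne_of_mem_erase hj), add_zero]

/-- The factors with index `wᵢ + l` are `wᵢ X + (wᵢ + l) θ = wᵢ (X + θ) + l θ`: raising `a` by `w`
shifts the variable by `θ`. -/
theorem risingProd_add_weights (w a : Fin n → ℕ) :
    risingProd w (a + w) =
      (risingProd w a).comp (Polynomial.X + Polynomial.C Polynomial.X) * risingProd w w := by
  rw [risingProd, risingProd, risingProd, Polynomial.prod_comp, ← Finset.prod_mul_distrib]
  refine Finset.prod_congr rfl fun i _ => ?_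
  rw [Pi.add_apply, add_comm (a i), Finset.prod_range_add, Polynomial.prod_comp, mul_comm]
  congr 1
  refine Finset.prod_congr rfl fun l _ => ?_
  simp only [Polynomial.add_comp, Polynomial.mul_comp, Polynomial.natCast_comp,
    Polynomial.X_comp, Polynomial.C_comp]
  push_cast
  ring

/-- The vector attached to the monomial `u₀^{a₀} u^a`. -/
def monVec (q : Module.End ℂ V) (w : Fin n → ℕ) (e : V) (a₀ : ℕ) (a : Fin n → ℕ) : V :=
  (q ^ a₀) (evalPair Θ N h (risingProd w a) e)

variable (w : Fin n → ℕ) (e : V)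

theorem monVec_succ (a₀ : ℕ) (a : Fin n → ℕ) :
    monVec h q w e (a₀ + 1) a = q (monVec h q w e a₀ a) := by
  rw [monVec, pow_succ']; rfl

theorem pow_mul_operator (hΘ : Commute Θ q) (hq : q * N = (N - Θ) * q) (a₀ : ℕ) :
    q ^ a₀ * N = (N - (a₀ : Module.End ℂ V) * Θ) * q ^ a₀ := by
  induction a₀ with
  | zero => simp
  | succ a₀ ih =>
    have h1 : q * (N - (a₀ : Module.End ℂ V) * Θ) =
        (N - ((a₀ + 1 : ℕ) : Module.End ℂ V) * Θ) * q := by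
      rw [mul_sub, hq, ← mul_assoc, (Nat.cast_commute a₀ q).symm.eq, mul_assoc, ← hΘ.eq]
      push_cast
      noncomm_ring
    rw [pow_succ', mul_assoc, ih, ← mul_assoc, h1, mul_assoc]

/-- This is the model version of multiplication by `uᵢ`. Each of the `a₀` factors `q` that passes
`N` costs one `Θ`, so the coefficient of `Θ` is the true exponent of `uᵢ` in `u₀^{a₀} u^a`. -/
theorem monVec_add_single (hΘ : Commute Θ q) (hq : q * N = (N - Θ) * q) (a₀ : ℕ)
    (a : Fin n → ℕ) (i : Fin n) :
    monVec h q w e a₀ (a + Pi.single i 1) =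
      (w i : ℂ) • N (monVec h q w e a₀ a) +
        ((a i : ℂ) - (a₀ : ℂ) * (w i : ℂ)) • Θ (monVec h q w e a₀ a) := by
  have key : q ^ a₀ * ((w i : Module.End ℂ V) * N + (a i : Module.End ℂ V) * Θ) =
      ((w i : ℂ) • N + ((a i : ℂ) - (a₀ : ℂ) * (w i : ℂ)) • Θ) * q ^ a₀ := by
    rw [mul_add, ← mul_assoc, ← mul_assoc, (Nat.cast_commute (w i) (q ^ a₀)).symm.eq,
      (Nat.cast_commute (a i) (q ^ a₀)).symm.eq, mul_assoc, mul_assoc,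
      pow_mul_operator hΘ hq, ← (hΘ.pow_right a₀).eq]
    ext v
    simp only [LinearMap.add_apply, LinearMap.sub_apply, Module.End.mul_apply,
      LinearMap.smul_apply, Module.End.natCast_apply, ← Nat.cast_smul_eq_nsmul ℂ]
    module
  have := congrArg (fun f : Module.End ℂ V => f (evalPair Θ N h (risingProd w a) e)) key
  simp only [Module.End.mul_apply] at this
  rw [monVec, risingProd_add_single, map_mul, map_add, map_mul, map_mul, evalPair_X,
    evalPair_C_X, map_natCast, map_natCast, Module.End.mul_apply, this]
  rfl

/-- The relation `u₀ u^w = 1`, needed on every monomial, follows from its case on `e`: the product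
for `a + w` splits into a shifted factor and `risingProd w w`, and one `q` removes the shift and
then meets `risingProd w w`. -/
theorem monVec_add_weights (hΘ : Commute Θ q) (hq : q * N = (N - Θ) * q)
    (he : monVec h q w e 1 w = e) (a₀ : ℕ) (a : Fin n → ℕ) :
    monVec h q w e (a₀ + 1) (a + w) = monVec h q w e a₀ a := by
  rw [monVec, pow_one] at he
  have := congrArg (fun f : Module.End ℂ V => f (evalPair Θ N h (risingProd w w) e))
    (mul_evalPair_comp h hΘ hq (risingProd w a))
  simp only [Module.End.mul_apply] at this
  rw [monVec, pow_succ, risingProd_add_weights, map_mul, Module.End.mul_apply,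
    Module.End.mul_apply, this, he]
  rfl

theorem monVec_add_mul_weights (hΘ : Commute Θ q) (hq : q * N = (N - Θ) * q)
    (he : monVec h q w e 1 w = e) (a₀ : ℕ) (a : Fin n → ℕ) (c : ℕ) :
    monVec h q w e (a₀ + c) (a + c • w) = monVec h q w e a₀ a := by
  induction c with
  | zero => simp
  | succ c ih => rw [← add_assoc, succ_nsmul, ← add_assoc, monVec_add_weights h w e hΘ hq he, ih]

/-- Pairs `(a₀, a)` and `(a₀ + c, a + c w)` describe the same Laurent monomial. By periodicity the
vector depends only on the exponent `m = a - a₀ w`, so any choice of representatives works. -/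
theorem exists_monomial_family (hw : ∀ i, 0 < w i) (hΘ : Commute Θ q)
    (hq : q * N = (N - Θ) * q) (he : monVec h q w e 1 w = e) :
    ∃ v : (Fin n → ℤ) → V,
      (∀ (a₀ : ℕ) (a : Fin n → ℕ), v (fun i => (a i : ℤ) - (a₀ : ℤ) * (w i : ℤ)) = monVec h q w e a₀ a) ∧
      (∀ m i, v (m + Pi.single i 1) = (w i : ℂ) • N (v m) + (m i : ℂ) • Θ (v m)) ∧
      (∀ m, v (m - fun i => (w i : ℤ)) = q (v m)) := by
  have hwz : ∀ i, (1 : ℤ) ≤ w i := fun i => by exact_mod_cast hw i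
  have repr : ∀ m : Fin n → ℤ, ∃ (a₀ : ℕ) (a : Fin n → ℕ),
      m = fun i => (a i : ℤ) - (a₀ : ℤ) * (w i : ℤ) := fun m => by
    -- Since `wᵢ ≥ 1`, taking `a₀ = ∑ |mᵢ|` makes every `mᵢ + a₀ wᵢ` nonnegative.
    refine ⟨∑ i, (m i).natAbs, fun i => (m i + (∑ i, (m i).natAbs : ℕ) * (w i : ℤ)).toNat, ?_⟩
    funext i
    have h1 : ((m i).natAbs : ℤ) ≤ (∑ i, (m i).natAbs : ℕ) := by
      exact_mod_cast Finset.single_le_sum (f := fun i => (m i).natAbs)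
        (fun _ _ => Nat.zero_le _) (Finset.mem_univ i)
    have h2 : ((∑ i, (m i).natAbs : ℕ) : ℤ) ≤ (∑ i, (m i).natAbs : ℕ) * (w i : ℤ) :=
      le_mul_of_one_le_right (by positivity) (hwz i)
    rw [Int.toNat_of_nonneg (by omega)]
    ring
  choose c₀ c hc using repr
  have key : ∀ (a₀ : ℕ) (a : Fin n → ℕ), monVec h q w e (c₀ fun i => (a i : ℤ) - (a₀ : ℤ) * (w i : ℤ))
      (c fun i => (a i : ℤ) - (a₀ : ℤ) * (w i : ℤ)) = monVec h q w e a₀ a := fun a₀ a => by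
    have := hc fun i => (a i : ℤ) - (a₀ : ℤ) * (w i : ℤ)
    generalize c₀ (fun i => (a i : ℤ) - (a₀ : ℤ) * (w i : ℤ)) = d₀ at *
    generalize c (fun i => (a i : ℤ) - (a₀ : ℤ) * (w i : ℤ)) = d at *
    -- Both representatives are moved to the common power `a₀ + d₀` of `q`, where the remaining
    -- exponents agree.
    rw [← monVec_add_mul_weights h w e hΘ hq he d₀ d a₀,
      ← monVec_add_mul_weights h w e hΘ hq he a₀ a d₀, add_comm d₀ a₀]
    congr 1
    funext i
    have := congrFun this i
    simp only [Pi.add_apply, Pi.smul_apply, smul_eq_mul]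
    zify
    linarith
  refine ⟨fun m => monVec h q w e (c₀ m) (c m), key, fun m i => ?_, fun m => ?_⟩
  · obtain ⟨a₀, a, rfl⟩ : ∃ (a₀ : ℕ) (a : Fin n → ℕ), m = fun i => (a i : ℤ) - (a₀ : ℤ) * (w i : ℤ) :=
      ⟨_, _, hc m⟩
    have : (fun i => (a i : ℤ) - (a₀ : ℤ) * (w i : ℤ)) + Pi.single i 1 =
        fun j => ((a + Pi.single i 1 : Fin n → ℕ) j : ℤ) - (a₀ : ℤ) * (w j : ℤ) := by
      funext j
      rcases eq_or_ne j i with rfl | hj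
      · simp; ring
      · simp [Pi.single_eq_of_ne hj]
    beta_reduce
    rw [this, key, key, monVec_add_single h w e hΘ hq]
    push_cast
    rfl
  · obtain ⟨a₀, a, rfl⟩ : ∃ (a₀ : ℕ) (a : Fin n → ℕ), m = fun i => (a i : ℤ) - (a₀ : ℤ) * (w i : ℤ) :=
      ⟨_, _, hc m⟩
    have : ((fun i => (a i : ℤ) - (a₀ : ℤ) * (w i : ℤ)) - fun i => (w i : ℤ)) =
        fun j => (a j : ℤ) - ((a₀ + 1 : ℕ) : ℤ) * (w j : ℤ) := by
      funext j
      simp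
      ring
    beta_reduce
    rw [this, key, key, monVec_succ]

end Hypergeometric

/-! ### The free model of the Gauss-Manin system -/

section Model

theorem mu_pos {n : ℕ} (w : Fin n → ℕ) : 0 < mu w := by unfold mu; omega

theorem lt_mu {n : ℕ} {w : Fin n → ℕ} (hw : ∀ i, 0 < w i) : n < mu w := by
  have := Finset.sum_le_sum fun i (_ : i ∈ Finset.univ) => Nat.one_le_of_lt (hw i)
  simp only [Finset.sum_const, Finset.card_univ, Fintype.card_fin, smul_eq_mul, mul_one] at this
  unfold mu
  omega

/-- The factors `κ, x, 1, …, 1` of the cyclic shift. -/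
def shiftCoeff {n : ℕ} (w : Fin n → ℕ) (k : Fin (mu w)) : OX :=
  if (k : ℕ) = 0 then LaurentPolynomial.C (kappa w) else if (k : ℕ) = 1 then xX else 1

/-- The cyclic predecessor. -/
def prevIdx {n : ℕ} (w : Fin n → ℕ) (k : Fin (mu w)) : Fin (mu w) :=
  if (k : ℕ) = 0 then ⟨mu w - 1, Nat.sub_lt (mu_pos w) one_pos⟩ else ⟨k - 1, by omega⟩

/-- The linear map `e₀ ↦ x e₁`, `e_k ↦ e_{k+1}`, `e_{μ-1} ↦ κ e₀`. -/
def shiftMap {n : ℕ} (w : Fin n → ℕ) (B : Type) [CommRing B] [Algebra OX B] :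
    (Fin (mu w) → B) →ₗ[B] (Fin (mu w) → B) where
  toFun v k := algebraMap OX B (shiftCoeff w k) * v (prevIdx w k)
  map_add' v v' := by ext k; simp [mul_add]
  map_smul' c v := by ext k; simp [mul_left_comm]

/-- The exponents `0, α₁ - 1, …, α_{μ-1} - 1` of the connection in the direction of `x`. -/
def connExp {n : ℕ} (w : Fin n → ℕ) (k : ℕ) : ℂ := if k = 0 then 0 else (slope w k : ℂ) - 1

/-- The coefficient of the monomial in `ω_k`. -/
def omegaCoeff {n : ℕ} (w : Fin n → ℕ) (k : ℕ) : ℂ :=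
  ∏ i : Fin n, ((w i : ℂ) ^ multiIndex w k i.succ)⁻¹

/-- The exponent of the monomial in `ω_k`. -/
def omegaExp {n : ℕ} (w : Fin n → ℕ) (k : ℕ) : Fin n → ℤ :=
  fun i => (multiIndex w k i.succ : ℤ) - (multiIndex w k 0 : ℤ) * (w i : ℤ)

variable {n : ℕ} (w : Fin n → ℕ) (B : Type) [CommRing B] [Algebra OX B] [Algebra ℂ B]

/-- The standard basis vectors `e₀, …, e_{μ-1}`, continued by `e_μ = κ e₀`. -/
def stdVec (k : ℕ) : Fin (mu w) → B :=
  if h : k < mu w then Pi.single ⟨k, h⟩ 1 else kappa w • Pi.single ⟨0, mu_pos w⟩ 1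

variable {B}

/-- The action of `x u₀`, that is of `-θ ∇_{x ∂/∂x}`, on the model. -/
def opN (θ : B) (δ : Derivation ℂ B B) : Module.End ℂ (Fin (mu w) → B) where
  toFun v := shiftMap w B v - θ • (fun k : Fin (mu w) => connExp w k • v k + δ (v k))
  map_add' v v' := by
    ext k
    simp only [map_add, smul_add, Pi.add_apply, Pi.sub_apply, Pi.smul_apply, smul_eq_mul]
    ring
  map_smul' c v := by
    ext k
    simp only [shiftMap, LinearMap.coe_mk, AddHom.coe_mk, Pi.sub_apply,
      Pi.smul_apply, smul_eq_mul, Derivation.map_smul, RingHom.id_apply]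
    simp only [Algebra.smul_def]
    ring

theorem opN_apply (θ : B) (δ : Derivation ℂ B B) (v : Fin (mu w) → B) :
    opN w θ δ v = shiftMap w B v - θ • (fun k : Fin (mu w) => connExp w k • v k + δ (v k)) := rfl

theorem opN_smul (θ : B) (δ : Derivation ℂ B B) (f : B) (v : Fin (mu w) → B) :
    opN w θ δ (f • v) = f • opN w θ δ v - (θ * δ f) • v := by
  rw [opN_apply, opN_apply, map_smul]
  ext k
  simp only [Pi.sub_apply, Pi.smul_apply, smul_eq_mul, Derivation.leibniz]
  simp only [Algebra.smul_def]
  ring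

variable {w}

theorem shiftMap_stdVec_zero (hn : 0 < n) (hw : ∀ i, 0 < w i) :
    shiftMap w B (stdVec w B 0) = algebraMap OX B xX • stdVec w B 1 := by
  have := lt_mu hw
  ext ⟨k, hk⟩
  simp only [shiftMap, LinearMap.coe_mk, AddHom.coe_mk, stdVec, mu_pos w, dif_pos,
    (by omega : 1 < mu w), Pi.smul_apply, smul_eq_mul, Pi.single_apply, prevIdx, shiftCoeff]
  rcases k with _ | _ | k
  · simp [Fin.ext_iff]; omega
  · simp
  · simp [Fin.ext_iff]

theorem shiftMap_stdVec [IsScalarTower ℂ OX B] {k : ℕ} (h1 : 1 ≤ k) (hk : k < mu w) :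
    shiftMap w B (stdVec w B k) = stdVec w B (k + 1) := by
  have hC : algebraMap OX B (LaurentPolynomial.C (kappa w)) = algebraMap ℂ B (kappa w) :=
    (IsScalarTower.algebraMap_apply ℂ OX B _).symm
  ext ⟨j, hj⟩
  simp only [shiftMap, LinearMap.coe_mk, AddHom.coe_mk, stdVec, hk, dif_pos]
  rcases lt_or_eq_of_le (Nat.succ_le_of_lt hk) with h | h
  · simp only [h, dif_pos, Pi.single_apply, prevIdx, shiftCoeff, Nat.succ_eq_add_one] at *
    rcases j with _ | _ | j
    · have : mu w - 1 ≠ k := by omega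
      simp [Fin.ext_iff, this]
    · have : 0 ≠ k := by omega
      simp [Fin.ext_iff, this]; omega
    · simp [Fin.ext_iff]
  · simp only [Nat.succ_eq_add_one] at h
    simp only [h, lt_irrefl, dif_neg, not_false_eq_true, Pi.single_apply, prevIdx,
      shiftCoeff, Algebra.smul_def]
    rcases j with _ | _ | j
    · have : mu w - 1 = k := by omega
      simp [this, hC]
    · simp [Fin.ext_iff]; omega
    · simp [Fin.ext_iff]; omega

theorem opN_stdVec (θ : B) (δ : Derivation ℂ B B) {k : ℕ} (hk : k < mu w) :
    opN w θ δ (stdVec w B k) =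
      shiftMap w B (stdVec w B k) - (connExp w k) • θ • stdVec w B k := by
  rw [opN_apply]
  congr 1
  ext j
  simp only [stdVec, hk, dif_pos, Pi.smul_apply, Pi.single_apply, smul_eq_mul]
  split_ifs with h
  · simp [h, Algebra.smul_def, mul_comm]
  · simp

end Model

/-! ### The hypergeometric relation and the monomial family on the model -/

section Map

variable {n : ℕ} {w : Fin n → ℕ} {B : Type} [CommRing B] [Algebra OX B] [Algebra ℂ B]
  [IsScalarTower ℂ OX B] {θ : B} {δ : Derivation ℂ B B}

theorem xX_mul_inv : algebraMap OX B xX * algebraMap OX B (LaurentPolynomial.T (-1)) = 1 := by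
  rw [← map_mul, ← LaurentPolynomial.T_add]
  simp

theorem derivation_inv (hx : δ (algebraMap OX B xX) = algebraMap OX B xX) :
    δ (algebraMap OX B (LaurentPolynomial.T (-1))) =
      -algebraMap OX B (LaurentPolynomial.T (-1)) := by
  have h : δ (algebraMap OX B xX * algebraMap OX B (LaurentPolynomial.T (-1))) = 0 := by
    rw [xX_mul_inv, Derivation.map_one_eq_zero]
  rw [Derivation.leibniz, hx, smul_eq_mul, smul_eq_mul] at h
  linear_combination algebraMap OX B (LaurentPolynomial.T (-1)) * h -
    (δ (algebraMap OX B (LaurentPolynomial.T (-1))) +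
      algebraMap OX B (LaurentPolynomial.T (-1))) * xX_mul_inv (B := B)

/-- The action of `u₀` on the model. -/
def opQ (w : Fin n → ℕ) (θ : B) (δ : Derivation ℂ B B) : Module.End ℂ (Fin (mu w) → B) :=
  Algebra.lsmul ℂ ℂ _ (algebraMap OX B (LaurentPolynomial.T (-1))) * opN w θ δ

theorem opQ_apply (v : Fin (mu w) → B) : opQ w θ δ v =
    algebraMap OX B (LaurentPolynomial.T (-1)) • opN w θ δ v := rfl

theorem commute_opN (hθ : δ θ = 0) : Commute (Algebra.lsmul ℂ ℂ _ θ) (opN w θ δ) := by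
  refine LinearMap.ext fun v => ?_
  simp [opN_smul, hθ]

theorem commute_opQ (hθ : δ θ = 0) : Commute (Algebra.lsmul ℂ ℂ _ θ) (opQ w θ δ) :=
  Commute.mul_right (by rw [Commute, SemiconjBy, ← map_mul, ← map_mul, mul_comm])
    (commute_opN hθ)

/-- The commutation of `N` with the scalar `x⁻¹` produces the term `-θ δ(x⁻¹) = θ x⁻¹`, which is the
`Θ` subtracted here. -/
theorem opQ_mul_opN (hx : δ (algebraMap OX B xX) = algebraMap OX B xX) :
    opQ w θ δ * opN w θ δ = (opN w θ δ - Algebra.lsmul ℂ ℂ _ θ) * opQ w θ δ := by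
  refine LinearMap.ext fun v => ?_
  simp only [Module.End.mul_apply, LinearMap.sub_apply, opQ_apply, opN_smul, derivation_inv hx,
    Algebra.lsmul_coe, smul_smul]
  module

theorem omegaCoeff_succ {k : ℕ} {j : Fin n} (hj : nextIndex w (multiIndex w k) = j.succ) :
    omegaCoeff w (k + 1) = (w j : ℂ)⁻¹ * omegaCoeff w k := by
  rw [omegaCoeff, omegaCoeff, ← Finset.mul_prod_erase _ _ (Finset.mem_univ j),
    ← Finset.mul_prod_erase _ _ (Finset.mem_univ j), ← mul_assoc, multiIndex_succ, hj]
  congr 1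
  · rw [Pi.add_apply, Pi.single_eq_same, pow_succ, mul_inv, mul_comm]
  · refine Finset.prod_congr rfl fun i hi => ?_
    rw [Pi.add_apply, Pi.single_eq_of_ne
      (by simpa [Fin.succ_inj] using Finset.ne_of_mem_erase hi), add_zero]

theorem omegaCoeff_mu (hw : ∀ i, 0 < w i) : omegaCoeff w (mu w) = kappa w := by
  simp [omegaCoeff, kappa, multiIndex_mu hw, weights]

theorem kappa_ne_zero (hw : ∀ i, 0 < w i) : kappa w ≠ 0 :=
  Finset.prod_ne_zero_iff.mpr fun i _ =>
    inv_ne_zero (pow_ne_zero _ (Nat.cast_ne_zero.mpr (hw i).ne'))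

theorem connExp_eq (hw : ∀ i, 0 < w i) {k : ℕ} (h1 : 1 ≤ k) {j : Fin n}
    (hj : nextIndex w (multiIndex w k) = j.succ) :
    connExp w k = (w j : ℂ)⁻¹ * ((multiIndex w k j.succ : ℂ) - w j) := by
  have : (w j : ℂ) ≠ 0 := Nat.cast_ne_zero.mpr (hw j).ne'
  rw [connExp, if_neg (by omega), slope, hj]
  simp only [weights, Fin.cons_succ]
  push_cast
  field_simp

/-- Induction along the greedy path. Raising entry `j` contributes `wⱼ N + (a(k)ⱼ - wⱼ) θ`, and `N
e_k` contains `-connExp w k • θ e_k`; by `connExp_eq` the `θ`-terms cancel after division by `wⱼ`,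
leaving the pure shift. The last case `k = μ` closes the cycle. -/
theorem monVec_omega (hn : 0 < n) (hw : ∀ i, 0 < w i)
    (hx : δ (algebraMap OX B xX) = algebraMap OX B xX) (hθ : δ θ = 0) {k : ℕ} (h1 : 1 ≤ k)
    (hk : k ≤ mu w) :
    omegaCoeff w k • monVec (commute_opN (w := w) hθ) (opQ w θ δ) w (stdVec w B 0) 1
      (fun i => multiIndex w k i.succ) = stdVec w B k := by
  induction k, h1 using Nat.le_induction with
  | base =>
    have h0 : (fun i : Fin n => multiIndex w 1 i.succ) = 0 := by
      funext i; simp [multiIndex_one]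
    rw [h0, omegaCoeff, monVec, risingProd_zero, map_one, pow_one, opQ_apply, Module.End.one_apply,
      opN_stdVec _ _ (mu_pos w), shiftMap_stdVec_zero hn hw]
    rw [connExp, if_pos rfl, zero_smul, sub_zero, smul_smul, mul_comm, xX_mul_inv, one_smul]
    simp [multiIndex_one]
  | succ k h1 ih =>
    obtain ⟨j, hj⟩ := Fin.exists_succ_eq.mpr (nextIndex_ne_zero hw h1 hk)
    have hj := hj.symm
    have hwj : (w j : ℂ) ≠ 0 := Nat.cast_ne_zero.mpr (hw j).ne'
    have ha : (fun i : Fin n => multiIndex w (k + 1) i.succ) =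
        (fun i : Fin n => multiIndex w k i.succ) + Pi.single j 1 := by
      funext i
      simp [multiIndex_succ, hj, Pi.single_apply, Fin.succ_inj]
    have ih' := ih (by omega)
    rw [ha, monVec_add_single _ _ _ (commute_opQ hθ) (opQ_mul_opN hx), omegaCoeff_succ hj,
      mul_smul, smul_add, smul_comm _ (w j : ℂ), smul_comm _ (_ - _ : ℂ), ← (opN w θ δ).map_smul,
      ← (Algebra.lsmul ℂ ℂ (Fin (mu w) → B) θ).map_smul, ih', opN_stdVec _ _ (by omega), shiftMap_stdVec h1 (by omega),
      connExp_eq hw h1 hj, Algebra.lsmul_coe, smul_add, smul_smul,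
      inv_mul_cancel₀ hwj]
    simp only [Nat.cast_one, one_mul]
    module

/-- The vectors of the model attached to the monomials. -/
theorem exists_model_family (hn : 0 < n) (hw : ∀ i, 0 < w i)
    (hx : δ (algebraMap OX B xX) = algebraMap OX B xX) (hθ : δ θ = 0) :
    ∃ v : (Fin n → ℤ) → (Fin (mu w) → B),
      (∀ k < mu w, omegaCoeff w k • v (omegaExp w k) = stdVec w B k) ∧
      (∀ m i, v (m + Pi.single i 1) = (w i : ℂ) • opN w θ δ (v m) + (m i : ℂ) • θ • v m) ∧
      (∀ m, algebraMap OX B xX • v (m - fun i => (w i : ℤ)) = opN w θ δ (v m)) := by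
  -- The case `k = μ` of `monVec_omega` reads `κ • q (∏ …) e₀ = κ • e₀`; cancelling `κ` gives the
  -- periodicity hypothesis.
  have hper : monVec (commute_opN (w := w) hθ) (opQ w θ δ) w (stdVec w B 0) 1 w =
      stdVec w B 0 := by
    have h := monVec_omega hn hw hx hθ (mu_pos w) le_rfl
    have h0 : (fun i : Fin n => multiIndex w (mu w) i.succ) = w := by
      funext i; simp [multiIndex_mu hw, weights]
    rw [omegaCoeff_mu hw, h0] at h
    refine smul_right_injective _ (kappa_ne_zero hw) (h.trans ?_)
    simp [stdVec, mu_pos w]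
  obtain ⟨v, h1, h2, h3⟩ := exists_monomial_family _ w _ hw (commute_opQ hθ) (opQ_mul_opN hx) hper
  refine ⟨v, fun k hk => ?_, h2, fun m => ?_⟩
  · rcases Nat.eq_zero_or_pos k with rfl | hk0
    · have h0 : omegaExp w 0 = fun i => ((0 : Fin n → ℕ) i : ℤ) - ((0 : ℕ) : ℤ) * (w i : ℤ) := by
        funext i; simp [omegaExp, multiIndex]
      rw [h0, h1, monVec, risingProd_zero]
      simp [omegaCoeff, multiIndex]
    · have h0 : omegaExp w k =
          fun i => ((multiIndex w k i.succ : ℕ) : ℤ) - ((1 : ℕ) : ℤ) * (w i : ℤ) := by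
        funext i; simp [omegaExp, multiIndex_apply_zero hw hk0 hk.le]
      rw [h0, h1 1 fun i => multiIndex w k i.succ, monVec_omega hn hw hx hθ hk0 hk.le]
  · rw [h3, opQ_apply, smul_smul, xX_mul_inv, one_smul]

end Map

/-! ### The basis of the twisted de Rham quotient -/

section Quotient

variable {n : ℕ} (w : Fin n → ℕ) (B : Type) [CommRing B] [Algebra OX B]

theorem coeffDer_smul {M : Type} [AddCommMonoid M] {B : Type} [CommRing B] [Algebra ℂ B]
    (δ : Derivation ℂ B B) (f : B) (t : AddMonoidAlgebra B M) :
    coeffDer δ (f • t) = f • coeffDer δ t + δ f • t := by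
  induction t using AddMonoidAlgebra.induction_linear with
  | zero => simp
  | add t₁ t₂ h₁ h₂ => simp only [smul_add, map_add, h₁, h₂]; abel
  | single m c =>
    simp only [AddMonoidAlgebra.smul_single, coeffDer_single, Derivation.leibniz, smul_eq_mul,
      ← AddMonoidAlgebra.single_add, mul_comm c]

/-- The function `x u₀`. -/
def xMon : Torus n B := AddMonoidAlgebra.single (fun i => -(w i : ℤ)) (algebraMap OX B xX)

theorem uD_potential (i : Fin n) : uD B i (potential w B) =
    AddMonoidAlgebra.single (Pi.single i 1) 1 - (w i : B) • xMon w B := by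
  rw [potential, map_add, map_sum, uD, degDer_single, xMon, sub_eq_add_neg,
    AddMonoidAlgebra.smul_single, ← AddMonoidAlgebra.single_neg]
  simp only [degDer_single]
  congr 1
  · rw [Finset.sum_eq_single i]
    · simp
    · intro j _ hj; simp [Pi.single_eq_of_ne hj.symm]
    · simp
  · congr 1
    simp

variable {w B} {p q θ : B}

theorem uD_single (i : Fin n) (m : Fin n → ℤ) (c : B) :
    uD B i (AddMonoidAlgebra.single m c) = AddMonoidAlgebra.single m ((m i : B) * c) := by
  simp [uD, degDer_single]

theorem twistedD_single (i : Fin n) (g : Torus n B) : twistedD w B p q (Pi.single i g) =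
    p • uD B i g - q • (uD B i (potential w B) * g) := by
  rw [twistedD_apply, Finset.sum_eq_single i]
  · simp
  · intro j _ hj; simp [Pi.single_eq_of_ne hj]
  · simp

variable (w p q) in
/-- The class of an `n`-form. -/
def cls : Torus n B →ₗ[B] Torus n B ⧸ LinearMap.range (twistedD w B p q) := Submodule.mkQ _

/-- The twisted differential of the form with single component `c u^m` in direction `i` is zero in
the quotient, and the unit `q` can be cancelled from it. -/
theorem cls_relation (hq : IsUnit q) (hp : p = θ * q) (i : Fin n) (m : Fin n → ℤ) (c : B) :
    cls w p q (AddMonoidAlgebra.single (m + Pi.single i 1) c) =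
      (w i : B) • cls w p q (xMon w B * AddMonoidAlgebra.single m c) +
        (m i : B) • θ • cls w p q (AddMonoidAlgebra.single m c) := by
  have h : cls w p q (twistedD w B p q (Pi.single i (AddMonoidAlgebra.single m c))) = 0 :=
    (Submodule.Quotient.mk_eq_zero _).mpr ⟨_, rfl⟩
  have hpq : ∀ t : Torus n B, p • t = q • θ • t := fun t => by rw [hp, mul_smul, smul_comm]
  rw [twistedD_single, uD_potential, uD_single, hpq, ← smul_sub, map_smul, hq.smul_eq_zero, sub_mul, AddMonoidAlgebra.single_mul_single, one_mul,
    ← smul_eq_mul (m i : B) c, ← AddMonoidAlgebra.smul_single, map_sub, map_sub, map_smul,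
    map_smul, smul_mul_assoc, map_smul, add_comm (Pi.single i 1)] at h
  rw [smul_comm (m i : B) θ]
  rw [eq_comm, add_comm, ← sub_eq_zero, ← h]
  abel

variable [Algebra ℂ B]

variable (w B) in
/-- The form `ω_k`, with coefficients in `B`. -/
def omegaForm (k : ℕ) : Torus n B :=
  AddMonoidAlgebra.single (omegaExp w k) (algebraMap ℂ B (omegaCoeff w k))

variable (w p q) in
/-- The map from the model to the quotient with `e_k ↦ [ω_k]`. -/
def fromModel :
    (Fin (mu w) → B) →ₗ[B] Torus n B ⧸ LinearMap.range (twistedD w B p q) :=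
  Fintype.linearCombination B fun k => cls w p q (omegaForm w B k)

theorem xMon_mul_omegaForm_zero : xMon w B * omegaForm w B 0 =
    algebraMap OX B xX • omegaForm w B 1 := by
  rw [xMon, omegaForm, omegaForm, AddMonoidAlgebra.single_mul_single,
    AddMonoidAlgebra.smul_single]
  congr 1
  · funext i
    simp [omegaExp, (show multiIndex w 0 = 0 from rfl), multiIndex_one]
  · simp [omegaCoeff, (show multiIndex w 0 = 0 from rfl), multiIndex_one]

theorem omegaForm_mu (hw : ∀ i, 0 < w i) : omegaForm w B (mu w) = kappa w • omegaForm w B 0 := by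
  rw [omegaForm, omegaForm, AddMonoidAlgebra.smul_single, omegaCoeff_mu hw]
  congr 1
  · funext i
    simp [omegaExp, multiIndex, multiIndex_mu hw, weights]
  · simp [omegaCoeff, multiIndex, Algebra.smul_def]

theorem fromModel_stdVec (hw : ∀ i, 0 < w i) {k : ℕ} (hk : k ≤ mu w) :
    fromModel w p q (stdVec w B k) = cls w p q (omegaForm w B k) := by
  rcases lt_or_eq_of_le hk with h | rfl
  · simp [fromModel, stdVec, h, Fintype.linearCombination_apply_single]
  · rw [omegaForm_mu hw, stdVec, dif_neg (lt_irrefl _), ← algebraMap_smul B (kappa w),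
      ← algebraMap_smul B (kappa w) (omegaForm w B 0), map_smul, map_smul, fromModel,
      Fintype.linearCombination_apply_single, one_smul]

/-- For the greedy index `j`, the class of `u_j ω_k` is `wⱼ` times that of `ω_{k+1}`; `cls_relation`
is solved for `x u₀ ω_k`. -/
theorem cls_xMon_mul_omegaForm_succ (hw : ∀ i, 0 < w i) (hq : IsUnit q) (hp : p = θ * q) {k : ℕ}
    (h1 : 1 ≤ k) (hk : k < mu w) : cls w p q (xMon w B * omegaForm w B k) =
      cls w p q (omegaForm w B (k + 1)) -
        algebraMap ℂ B (connExp w k) • θ • cls w p q (omegaForm w B k) := by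
  obtain ⟨j, hj⟩ := Fin.exists_succ_eq.mpr (nextIndex_ne_zero hw h1 hk)
  have hj := hj.symm
  have hwj : (w j : ℂ) ≠ 0 := Nat.cast_ne_zero.mpr (hw j).ne'
  have h : omegaForm w B (k + 1) = algebraMap ℂ B (w j : ℂ)⁻¹ • AddMonoidAlgebra.single
      (omegaExp w k + Pi.single j 1) (algebraMap ℂ B (omegaCoeff w k)) := by
    rw [omegaForm, AddMonoidAlgebra.smul_single, omegaCoeff_succ hj, smul_eq_mul, map_mul]
    congr 1
    funext i
    simp only [omegaExp, multiIndex_succ, hj, Pi.add_apply, Pi.single_apply, Fin.succ_inj,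
      (Fin.succ_ne_zero j).symm, if_false]
    push_cast
    ring
  rw [h, map_smul, cls_relation hq hp, ← omegaForm, smul_add, smul_smul, smul_smul,
    connExp_eq hw h1 hj]
  have e1 : algebraMap ℂ B (w j : ℂ)⁻¹ * (w j : B) = 1 := by
    rw [← map_natCast (algebraMap ℂ B), ← map_mul, inv_mul_cancel₀ hwj, map_one]
  have e2 : ((omegaExp w k j : ℤ) : B) =
      algebraMap ℂ B ((multiIndex w k j.succ : ℂ) - w j) := by
    simp [omegaExp, multiIndex_apply_zero hw h1 hk.le]
  rw [e1, e2, one_smul, ← map_mul, add_sub_cancel_right]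

variable [IsScalarTower ℂ OX B] {δ : Derivation ℂ B B}

theorem cls_xMon_mul_omegaForm (hn : 0 < n) (hw : ∀ i, 0 < w i) (hq : IsUnit q)
    (hp : p = θ * q) {k : ℕ} (hk : k < mu w) : cls w p q (xMon w B * omegaForm w B k) =
      fromModel w p q (shiftMap w B (stdVec w B k) -
        algebraMap ℂ B (connExp w k) • θ • stdVec w B k) := by
  have := lt_mu hw
  rcases Nat.eq_zero_or_pos k with rfl | h1
  · rw [xMon_mul_omegaForm_zero, shiftMap_stdVec_zero hn hw, connExp, if_pos rfl, map_zero,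
      zero_smul, sub_zero, map_smul, map_smul, fromModel_stdVec hw (by omega)]
  · rw [cls_xMon_mul_omegaForm_succ hw hq hp h1 hk, shiftMap_stdVec h1 hk, map_sub, map_smul,
      map_smul, fromModel_stdVec hw hk.le, fromModel_stdVec hw hk]

theorem coeffDer_omegaForm (k : ℕ) : coeffDer δ (omegaForm w B k) = 0 := by
  rw [omegaForm, coeffDer_single, Derivation.map_algebraMap, AddMonoidAlgebra.single_zero]

theorem eq_sum_stdVec (v : Fin (mu w) → B) : v = ∑ k : Fin (mu w), v k • stdVec w B k := by
  ext j
  simp [stdVec, Pi.single_apply]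

theorem stdVec_eq_single (k : Fin (mu w)) : stdVec w B k = Pi.single k 1 := by
  simp [stdVec]

/-- `x u₀ - θ x ∂/∂x` maps exact forms to exact forms. -/
theorem xMon_mul_sub_mem (hx : δ (algebraMap OX B xX) = algebraMap OX B xX) (hθ : δ θ = 0)
    (hδq : δ q = 0) (hp : p = θ * q) {t : Torus n B}
    (ht : t ∈ LinearMap.range (twistedD w B p q)) :
    xMon w B * t - θ • coeffDer δ t ∈ LinearMap.range (twistedD w B p q) := by
  obtain ⟨β, rfl⟩ := ht
  -- The same operator applied to the primitive. The two defects, `p (uᵢ ∂ᵢ)(x u₀) βᵢ` and `θ q δ(uᵢ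
  -- ∂ᵢ F) βᵢ`, are equal because `p = θ q`.
  refine ⟨fun i => xMon w B * β i - θ • coeffDer δ (β i), ?_⟩
  rw [twistedD_apply, twistedD_apply, map_sum, Finset.mul_sum, Finset.smul_sum,
    ← Finset.sum_sub_distrib]
  refine Finset.sum_congr rfl fun i _ => ?_
  have h1 : coeffDer δ (uD B i (potential w B)) = -((w i : B) • xMon w B) := by
    rw [uD_potential, map_sub, coeffDer_single, coeffDer_smul, xMon, coeffDer_single, hx]
    simp
  have h2 : uD B i (xMon w B) = -((w i : B) • xMon w B) := by
    rw [xMon, uD_single, AddMonoidAlgebra.smul_single, ← AddMonoidAlgebra.single_neg]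
    simp
  have hδp : δ p = 0 := by rw [hp, Derivation.leibniz, hθ, hδq]; simp
  simp only [map_sub, Derivation.leibniz, Derivation.map_smul, coeffDer_smul, coeffDer_uD, hδq,
    hδp, hθ, h1, h2, smul_eq_mul, zero_smul, add_zero]
  simp only [hp, Algebra.smul_def, map_mul]
  ring

/-- Multiplication by `x u₀` alone does not descend to the quotient, but `x u₀ - θ δ` does. It
satisfies the same Leibniz rule as `opN`, so it suffices to compare the two on the `ω_k`, which `δ`
annihilates. -/
theorem cls_xMon_mul_sub (hn : 0 < n) (hw : ∀ i, 0 < w i)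
    (hx : δ (algebraMap OX B xX) = algebraMap OX B xX) (hθ : δ θ = 0)
    (hδq : δ q = 0) (hq : IsUnit q) (hp : p = θ * q) {t : Torus n B} {v : Fin (mu w) → B}
    (ht : cls w p q t = fromModel w p q v) :
    cls w p q (xMon w B * t - θ • coeffDer δ t) = fromModel w p q (opN w θ δ v) := by
  have h0 : ∀ v, fromModel w p q v = cls w p q (∑ k, v k • omegaForm w B k) := fun v => by
    simp [fromModel, Fintype.linearCombination_apply]
  have h1 : t - ∑ k, v k • omegaForm w B k ∈ LinearMap.range (twistedD w B p q) := by
    rw [h0] at ht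
    exact (Submodule.Quotient.eq _).mp ht
  have h2 := (Submodule.Quotient.mk_eq_zero _).mpr (xMon_mul_sub_mem hx hθ hδq hp h1)
  change cls w p q _ = 0 at h2
  have h3 : xMon w B * (t - ∑ k, v k • omegaForm w B k) -
      θ • coeffDer δ (t - ∑ k, v k • omegaForm w B k) = (xMon w B * t - θ • coeffDer δ t) -
        ∑ k, (v k • (xMon w B * omegaForm w B k) - (θ * δ (v k)) • omegaForm w B k) := by
    simp only [mul_sub, map_sub, map_sum, coeffDer_smul, coeffDer_omegaForm, Finset.mul_sum,
      smul_sub, Finset.smul_sum, Finset.sum_sub_distrib, mul_smul_comm, smul_zero, zero_add,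
      smul_smul]
    abel
  rw [h3, map_sub, sub_eq_zero] at h2
  rw [h2]
  conv_rhs => rw [eq_sum_stdVec v]
  rw [map_sum, map_sum, map_sum]
  refine Finset.sum_congr rfl fun k _ => ?_
  rw [map_sub, map_smul, map_smul, cls_xMon_mul_omegaForm hn hw hq hp k.2, opN_smul,
    opN_stdVec _ _ k.2, map_sub, map_smul, map_smul, fromModel_stdVec hw k.2.le,
    ← algebraMap_smul B (connExp w k)]
  simp only [map_sub, map_smul, fromModel_stdVec hw k.2.le]

/-- The exponents for which the two classes agree contain `0` and are stable under `+ eᵢ` and under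
`- w`, since both sides obey the same recursions. Every `m` has the form `-a₀ w + a` with `a ≥ 0`,
so these moves reach all of `ℤⁿ`. -/
theorem cls_single_eq_fromModel (hn : 0 < n) (hw : ∀ i, 0 < w i)
    (hx : δ (algebraMap OX B xX) = algebraMap OX B xX) (hθ : δ θ = 0)
    (hδq : δ q = 0) (hq : IsUnit q) (hp : p = θ * q) {v : (Fin n → ℤ) → (Fin (mu w) → B)}
    (h0 : ∀ k < mu w, omegaCoeff w k • v (omegaExp w k) = stdVec w B k)
    (h1 : ∀ m i, v (m + Pi.single i 1) = (w i : ℂ) • opN w θ δ (v m) + (m i : ℂ) • θ • v m)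
    (h2 : ∀ m, algebraMap OX B xX • v (m - fun i => (w i : ℤ)) = opN w θ δ (v m))
    (m : Fin n → ℤ) :
    cls w p q (AddMonoidAlgebra.single m 1) = fromModel w p q (v m) := by
  let S : Set (Fin n → ℤ) :=
    {m | cls w p q (AddMonoidAlgebra.single m 1) = fromModel w p q (v m)}
  have hN : ∀ m ∈ S, cls w p q (xMon w B * AddMonoidAlgebra.single m 1) =
      fromModel w p q (opN w θ δ (v m)) := fun m hm => by
    have := cls_xMon_mul_sub hn hw hx hθ hδq hq hp hm
    rwa [coeffDer_single, Derivation.map_one_eq_zero, AddMonoidAlgebra.single_zero, smul_zero,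
      sub_zero] at this
  have s0 : (0 : Fin n → ℤ) ∈ S := by
    have e : omegaExp w 0 = 0 := by funext i; simp [omegaExp, multiIndex]
    have c : omegaCoeff w 0 = 1 := by simp [omegaCoeff, multiIndex]
    have := h0 0 (mu_pos w)
    rw [e, c, one_smul] at this
    change cls w p q _ = _
    rw [this, fromModel_stdVec hw (Nat.zero_le _), omegaForm, e, c, map_one]
  have s1 : ∀ m ∈ S, ∀ i, m + Pi.single i 1 ∈ S := fun m hm i => by
    change cls w p q _ = _
    rw [cls_relation hq hp, hN m hm, h1, map_add, show cls w p q _ = _ from hm,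
      ← algebraMap_smul B (w i : ℂ), ← algebraMap_smul B (m i : ℂ), map_smul, map_smul, map_smul]
    simp
  have s2 : ∀ m ∈ S, (m - fun i => (w i : ℤ)) ∈ S := fun m hm => by
    have h := hN m hm
    rw [← h2, map_smul, xMon, AddMonoidAlgebra.single_mul_single,
      mul_comm, one_mul, ← mul_one (algebraMap OX B xX), ← smul_eq_mul,
      ← AddMonoidAlgebra.smul_single, map_smul, smul_eq_mul, mul_one] at h
    -- The recursion gives the equality for `m - w` only after multiplication by `x`, which is
    -- invertible.
    have hu : IsUnit (algebraMap OX B xX) := IsUnit.of_mul_eq_one _ xX_mul_inv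
    have e : ((fun i => -(w i : ℤ)) + m) = m - fun i => (w i : ℤ) := by
      funext i; simp; ring
    rw [e] at h
    exact hu.smul_left_cancel.mp h
  have s3 : ∀ a₀ : ℕ, (fun i => -((a₀ : ℤ) * (w i : ℤ))) ∈ S := fun a₀ => by
    induction a₀ with
    | zero => convert s0 using 1; funext i; simp
    | succ a₀ ih => convert s2 _ ih using 1; funext i; simp; ring
  have s4 : ∀ m ∈ S, ∀ i, ∀ c : ℕ, m + Pi.single i (c : ℤ) ∈ S := fun m hm i c => by
    induction c with
    | zero => simpa using hm
    | succ c ih =>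
      convert s1 _ ih i using 1
      rw [add_assoc, ← Pi.single_add]
      push_cast
      rfl
  have s5 : ∀ m ∈ S, ∀ a : Fin n → ℕ, ∀ s : Finset (Fin n),
      m + ∑ i ∈ s, Pi.single i (a i : ℤ) ∈ S := fun m hm a s => by
    induction s using Finset.induction_on with
    | empty => simpa using hm
    | insert i s hi ih =>
      rw [Finset.sum_insert hi, add_comm (Pi.single i _), ← add_assoc]
      exact s4 _ ih i _
  have s6 : ∀ m ∈ S, ∀ a : Fin n → ℕ, (m + fun i => (a i : ℤ)) ∈ S := fun m hm a => by
    have := s5 m hm a Finset.univ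
    rwa [Finset.univ_sum_single] at this
  let a₀ : ℕ := ∑ i, (m i).natAbs
  have hm := s6 _ (s3 a₀) fun i => (m i + (a₀ : ℤ) * (w i : ℤ)).toNat
  have e : ((fun i => -((a₀ : ℤ) * (w i : ℤ))) +
      fun i => (((m i + (a₀ : ℤ) * (w i : ℤ)).toNat : ℕ) : ℤ)) = m := by
    funext i
    have k1 : ((m i).natAbs : ℤ) ≤ a₀ := by
      exact_mod_cast Finset.single_le_sum (f := fun i => (m i).natAbs)
        (fun _ _ => Nat.zero_le _) (Finset.mem_univ i)
    have k2 : (a₀ : ℤ) ≤ a₀ * (w i : ℤ) :=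
      le_mul_of_one_le_right (by positivity) (by exact_mod_cast hw i)
    rw [Pi.add_apply, Int.toNat_of_nonneg (by omega)]
    ring
  rw [e] at hm
  exact hm

/-- The linear extension of a family indexed by the monomials. -/
def ofMonomials (v : (Fin n → ℤ) → (Fin (mu w) → B)) : Torus n B →ₗ[B] (Fin (mu w) → B) :=
  Finsupp.linearCombination B v ∘ₗ (AddMonoidAlgebra.coeffLinearEquiv B).toLinearMap

theorem ofMonomials_single (v : (Fin n → ℤ) → (Fin (mu w) → B)) (m : Fin n → ℤ) (c : B) :
    ofMonomials v (AddMonoidAlgebra.single m c) = c • v m := by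
  simp [ofMonomials, AddMonoidAlgebra.coeffLinearEquiv]

/-- On monomials the recursions `h1` and `h2` eliminate `N` and leave precisely the relation imposed
by an exact form. -/
theorem ofMonomials_twistedD (hp : p = θ * q) {v : (Fin n → ℤ) → (Fin (mu w) → B)}
    (h1 : ∀ m i, v (m + Pi.single i 1) = (w i : ℂ) • opN w θ δ (v m) + (m i : ℂ) • θ • v m)
    (h2 : ∀ m, algebraMap OX B xX • v (m - fun i => (w i : ℤ)) = opN w θ δ (v m))
    (β : Fin n → Torus n B) : ofMonomials v (twistedD w B p q β) = 0 := by
  rw [twistedD_apply, map_sum]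
  refine Finset.sum_eq_zero fun i _ => ?_
  generalize β i = g
  induction g using AddMonoidAlgebra.induction_linear with
  | zero => simp
  | add g₁ g₂ k₁ k₂ =>
    rw [map_add, mul_add, smul_add, smul_add, add_sub_add_comm, map_add, k₁, k₂, add_zero]
  | single m c =>
    have e : ((fun i => -(w i : ℤ)) + m) = m - fun i => (w i : ℤ) := by
      funext i; simp; ring
    rw [uD_single, uD_potential, xMon, sub_mul, smul_mul_assoc,
      AddMonoidAlgebra.single_mul_single, AddMonoidAlgebra.single_mul_single, map_sub, map_smul,
      map_smul, map_sub, map_smul, ofMonomials_single, ofMonomials_single, ofMonomials_single,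
      add_comm (Pi.single i 1), h1, e, mul_comm (algebraMap OX B xX), mul_smul c, h2,
      ← algebraMap_smul B (w i : ℂ), ← algebraMap_smul B (m i : ℂ), map_natCast, map_intCast, hp]
    module

/-- The map out of the quotient given by the model family and `fromModel` are mutually inverse: one
composite is checked on the `e_k`, the other on monomials. -/
theorem exists_basis_omegaForm (hn : 0 < n) (hw : ∀ i, 0 < w i)
    (hx : δ (algebraMap OX B xX) = algebraMap OX B xX) (hθ : δ θ = 0)
    (hδq : δ q = 0) (hq : IsUnit q) (hp : p = θ * q) :
    ∃ b : Module.Basis (Fin (mu w)) B (Torus n B ⧸ LinearMap.range (twistedD w B p q)),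
      ∀ v, b.equivFun.symm v = fromModel w p q v := by
  obtain ⟨v, h0, h1, h2⟩ := exists_model_family hn hw hx hθ
  have hR : LinearMap.range (twistedD w B p q) ≤ LinearMap.ker (ofMonomials v) := by
    rintro _ ⟨β, rfl⟩
    exact ofMonomials_twistedD hp h1 h2 β
  let φ := Submodule.liftQ _ (ofMonomials v) hR
  have hφ : ∀ t, φ (cls w p q t) = ofMonomials v t := fun t => rfl
  let e : (Torus n B ⧸ LinearMap.range (twistedD w B p q)) ≃ₗ[B] (Fin (mu w) → B) :=
    LinearEquiv.ofLinearMap φ (fromModel w p q)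
      (by
        refine LinearMap.ext fun x => ?_
        rw [LinearMap.comp_apply, LinearMap.id_apply, eq_sum_stdVec x, map_sum, map_sum]
        refine Finset.sum_congr rfl fun k _ => ?_
        rw [map_smul, map_smul, fromModel_stdVec hw k.2.le, hφ, omegaForm, ofMonomials_single,
          algebraMap_smul, h0 k k.2])
      (by
        refine LinearMap.ext fun y => ?_
        obtain ⟨t, rfl⟩ := Submodule.Quotient.mk_surjective _ y
        change fromModel w p q (ofMonomials v t) = cls w p q t
        induction t using AddMonoidAlgebra.induction_linear with
        | zero => simp
        | add g₁ g₂ k₁ k₂ => simp only [map_add, k₁, k₂]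
        | single m c =>
          rw [ofMonomials_single, map_smul,
            ← cls_single_eq_fromModel hn hw hx hθ hδq hq hp h0 h1 h2, ← map_smul,
            AddMonoidAlgebra.smul_single, smul_eq_mul, mul_one])
  refine ⟨Module.Basis.ofEquivFun e, fun x => ?_⟩
  rw [Module.Basis.equivFun_ofEquivFun]
  rfl

end Quotient

/-! ### Coordinates on the Brieskorn lattice and the Gauss-Manin system -/

section Coordinates

/-- The vector field `x ∂/∂x`. -/
def eulerX : Derivation ℂ OX OX := degDer ℂ (AddMonoidHom.id ℤ)

theorem eulerX_xX : eulerX xX = xX := by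
  change degDer ℂ (AddMonoidHom.id ℤ) (AddMonoidAlgebra.single 1 1) = _
  rw [degDer_single]
  simp only [AddMonoidHom.id_apply, Int.cast_one, mul_one]
  rfl

/-- `x ∂/∂x` on `ℂ[x, x⁻¹, θ]`. -/
def eulerXθ : Derivation ℂ OXθ OXθ :=
  (PolynomialModule.equivPolynomialSelf.toLinearMap.compDer : _ →ₗ[OXθ] _) eulerX.mapCoeffs

theorem eulerXθ_C (f : OX) : eulerXθ (Polynomial.C f) = Polynomial.C (eulerX f) := by
  simp [eulerXθ]

theorem eulerXθ_X : eulerXθ Polynomial.X = 0 := by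
  simp [eulerXθ]

theorem vfDer_C (ξ : Derivation ℂ OX OX) (f : OX) :
    vfDer ξ (LaurentPolynomial.C f) = LaurentPolynomial.C (ξ f) := coeffDer_single _ _ _

theorem vfDer_T (ξ : Derivation ℂ OX OX) (k : ℤ) :
    vfDer ξ (LaurentPolynomial.T k) = 0 := by
  change coeffDer ξ (AddMonoidAlgebra.single k (1 : OX)) = 0
  rw [coeffDer_single]; simp

/-- The logarithmic coefficient `ξ(x) / x` of a vector field. -/
def logCoeff (ξ : Derivation ℂ OX OX) : OX := LaurentPolynomial.T (-1) * ξ xX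

theorem xX_mul_T : xX * (LaurentPolynomial.T (-1) : OX) = 1 := by
  rw [← LaurentPolynomial.T_add]; simp

theorem apply_xX (ξ : Derivation ℂ OX OX) : ξ xX = logCoeff ξ * xX := by
  rw [logCoeff]
  linear_combination -(ξ xX) * xX_mul_T

variable {n : ℕ} {w : Fin n → ℕ}

theorem T_mul_tau : (LaurentPolynomial.T 1 : OXθθ) * tau = 1 := by
  rw [← LaurentPolynomial.T_add]; simp

theorem isUnit_tau : IsUnit tau := LaurentPolynomial.isUnit_T _

theorem exists_basis_G0 (hn : 0 < n) (hw : ∀ i, 0 < w i) :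
    ∃ b : Module.Basis (Fin (mu w)) OXθ (G0 w),
      ∀ v, b.equivFun.symm v = fromModel w Polynomial.X 1 v :=
  exists_basis_omegaForm (δ := eulerXθ) (θ := Polynomial.X) hn hw
    (by
      change eulerXθ (Polynomial.C xX) = Polynomial.C xX
      rw [eulerXθ_C, eulerX_xX])
    eulerXθ_X (Derivation.map_one_eq_zero _) isUnit_one (mul_one _).symm

theorem exists_basis_G (hn : 0 < n) (hw : ∀ i, 0 < w i) :
    ∃ b : Module.Basis (Fin (mu w)) OXθθ (G w),
      ∀ v, b.equivFun.symm v = fromModel w 1 tau v :=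
  exists_basis_omegaForm (δ := vfDer eulerX) (θ := LaurentPolynomial.T 1) hn hw
    (by
      change vfDer eulerX (LaurentPolynomial.C xX) = LaurentPolynomial.C xX
      rw [vfDer_C, eulerX_xX])
    (vfDer_T _ _) (vfDer_T _ _) isUnit_tau T_mul_tau.symm

theorem cls_omegaForm_G0 (k : ℕ) : cls w Polynomial.X 1 (omegaForm w OXθ k) = omega w k := rfl

theorem toG_omega (k : ℕ) : toG w (omega w k) = cls w 1 tau (omegaForm w OXθθ k) := by
  change cls w 1 tau (AddMonoidAlgebra.mapRingHom _ (Polynomial.toLaurent : OXθ →+* OXθθ)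
    (omegaForm w OXθ k)) = _
  rw [omegaForm, omegaForm, AddMonoidAlgebra.mapRingHom_single,
    IsScalarTower.algebraMap_apply ℂ OX OXθ]
  congr 2
  exact (Polynomial.toLaurent_C _).trans (IsScalarTower.algebraMap_apply ℂ OX OXθθ _).symm

theorem toG_fromModel (v : Fin (mu w) → OXθ) : toG w (fromModel w Polynomial.X 1 v) =
    fromModel w 1 tau fun k => Polynomial.toLaurent (v k) := by
  simp only [fromModel, Fintype.linearCombination_apply, map_sum]
  refine Finset.sum_congr rfl fun k _ => ?_
  rw [map_smulₛₗ, cls_omegaForm_G0, toG_omega]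

theorem descend_cls (δ : Derivation ℂ OXθθ OXθθ) (h : Torus n OXθθ)
    (hh : ∀ i, uD OXθθ i h = coeffDer δ (tau • uD OXθθ i (potential w OXθθ)))
    (t : Torus n OXθθ) :
    descend w δ h hh (cls w 1 tau t) = cls w 1 tau (coeffDer δ t - h * t) := rfl

theorem descend_smul (δ : Derivation ℂ OXθθ OXθθ) (h : Torus n OXθθ)
    (hh : ∀ i, uD OXθθ i h = coeffDer δ (tau • uD OXθθ i (potential w OXθθ)))
    (f : OXθθ) (ε : G w) :
    descend w δ h hh (f • ε) = δ f • ε + f • descend w δ h hh ε := by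
  obtain ⟨t, rfl⟩ := Submodule.Quotient.mk_surjective _ ε
  change descend w δ h hh (f • cls w 1 tau t) =
    δ f • cls w 1 tau t + f • descend w δ h hh (cls w 1 tau t)
  rw [← (cls w 1 tau).map_smul, descend_cls, descend_cls, coeffDer_smul, mul_smul_comm,
    ← (cls w 1 tau).map_smul, ← (cls w 1 tau).map_smul, ← (cls w 1 tau).map_add, smul_sub]
  congr 1
  abel

theorem nablaX_smul (ξ : Derivation ℂ OX OX) (f : OXθθ) (ε : G w) :
    nablaX w ξ (f • ε) = vfDer ξ f • ε + f • nablaX w ξ ε := descend_smul _ _ _ _ _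

theorem nablaτ_smul (f : OXθθ) (ε : G w) :
    nablaτ w (f • ε) = dτ f • ε + f • nablaτ w ε := descend_smul _ _ _ _ _

theorem nablaX_cls_omegaForm (hn : 0 < n) (hw : ∀ i, 0 < w i) (ξ : Derivation ℂ OX OX) {k : ℕ}
    (hk : k < mu w) : nablaX w ξ (cls w 1 tau (omegaForm w OXθθ k)) =
      fromModel w 1 tau (LaurentPolynomial.C (logCoeff ξ) •
        (connExp w k • stdVec w OXθθ k - tau • shiftMap w OXθθ (stdVec w OXθθ k))) := by
  have h : coeffDer (vfDer ξ) (potential w OXθθ) =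
      LaurentPolynomial.C (logCoeff ξ) • xMon w OXθθ := by
    rw [potential, map_add, map_sum, coeffDer_single, xMon, AddMonoidAlgebra.smul_single]
    simp only [coeffDer_single, Derivation.map_one_eq_zero, AddMonoidAlgebra.single_zero,
      Finset.sum_const_zero, zero_add]
    congr 1
    change vfDer ξ (LaurentPolynomial.C xX) = _ * LaurentPolynomial.C xX
    rw [vfDer_C, apply_xX, map_mul]
  rw [nablaX, descend_cls, coeffDer_omegaForm, h, zero_sub, smul_mul_assoc, smul_mul_assoc,
    map_neg, map_smul, map_smul,
    cls_xMon_mul_omegaForm hn hw isUnit_tau T_mul_tau.symm hk, ← map_smul, ← map_smul, ← map_neg]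
  congr 1
  ext1 j
  simp only [Pi.neg_apply, Pi.smul_apply, Pi.sub_apply, smul_eq_mul]
  simp only [Algebra.smul_def]
  linear_combination LaurentPolynomial.C (logCoeff ξ) *
    algebraMap ℂ OXθθ (connExp w k) * stdVec w OXθθ k j * T_mul_tau

/-- The spectral numbers `k - μ α_k`. -/
def specNum (w : Fin n → ℕ) (k : ℕ) : ℂ := k - mu w * (slope w k : ℂ)

theorem sum_omegaExp (k : ℕ) :
    ∑ i, omegaExp w k i = k - (multiIndex w k 0 : ℤ) * mu w := by
  have h : ((∑ i, multiIndex w k i : ℕ) : ℤ) = k := by rw [sum_multiIndex]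
  rw [Fin.sum_univ_succ] at h
  push_cast at h
  simp only [omegaExp, Finset.sum_sub_distrib, ← Finset.mul_sum, mu]
  push_cast
  linear_combination h

theorem specNum_eq (hw : ∀ i, 0 < w i) {k : ℕ} (hk : k < mu w) :
    specNum w k = ((∑ i, omegaExp w k i : ℤ) : ℂ) - mu w * connExp w k := by
  rw [sum_omegaExp, specNum, connExp]
  rcases Nat.eq_zero_or_pos k with rfl | h1
  · simp [slope_eq_zero hw (Nat.zero_le n), show multiIndex w 0 = 0 from rfl]
  · rw [multiIndex_apply_zero hw h1 hk.le, if_neg (by omega)]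
    push_cast
    ring

theorem potential_mul_single (m : Fin n → ℤ) (c : OXθθ) :
    potential w OXθθ * AddMonoidAlgebra.single m c =
      ∑ i, AddMonoidAlgebra.single (m + Pi.single i 1) c +
        xMon w OXθθ * AddMonoidAlgebra.single m c := by
  rw [potential, add_mul, Finset.sum_mul, xMon]
  simp only [AddMonoidAlgebra.single_mul_single, one_mul, add_comm]

/-- Since `F u^m = ∑ uᵢ u^m + x u₀ u^m`, summing `cls_relation` over `i` makes the coefficient of `x
u₀ u^m` equal to `1 + ∑ wᵢ = μ`. Inserting `x u₀ ω_k = shift - θ connExp` leaves `∑ mᵢ - μ connExp`,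
which is `specNum`. -/
theorem nablaτ_cls_omegaForm (hn : 0 < n) (hw : ∀ i, 0 < w i) {k : ℕ} (hk : k < mu w) :
    nablaτ w (cls w 1 tau (omegaForm w OXθθ k)) =
      -fromModel w 1 tau ((mu w : OXθθ) • shiftMap w OXθθ (stdVec w OXθθ k) +
        specNum w k • (LaurentPolynomial.T 1 : OXθθ) • stdVec w OXθθ k) := by
  rw [nablaτ, descend_cls, coeffDer_omegaForm, zero_sub, map_neg, omegaForm,
    potential_mul_single, map_add, map_sum]
  simp only [cls_relation isUnit_tau T_mul_tau.symm]
  rw [Finset.sum_add_distrib, ← Finset.sum_smul, ← Finset.sum_smul, ← omegaForm,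
    cls_xMon_mul_omegaForm hn hw isUnit_tau T_mul_tau.symm hk, ← fromModel_stdVec hw hk.le,
    ← map_smul, ← map_smul, ← map_smul, ← map_add, ← map_add, specNum_eq hw hk]
  congr 2
  ext1 j
  have h1 : ((mu w : ℕ) : OXθθ) = 1 + ∑ i, (w i : OXθθ) := by simp [mu]
  simp only [Pi.add_apply, Pi.smul_apply, Pi.sub_apply, smul_eq_mul]
  simp only [Algebra.smul_def, map_sub, map_mul, map_intCast, map_natCast, map_sum, Int.cast_sum,
    h1]
  ring

theorem fromModel_eq_sum (hw : ∀ i, 0 < w i) (v : Fin (mu w) → OXθθ) :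
    fromModel w 1 tau v = ∑ k, v k • cls w 1 tau (omegaForm w OXθθ k) := by
  conv_lhs => rw [eq_sum_stdVec v, map_sum]
  exact Finset.sum_congr rfl fun k _ => by rw [map_smul, fromModel_stdVec hw k.2.le]

theorem nablaX_fromModel (hn : 0 < n) (hw : ∀ i, 0 < w i) (ξ : Derivation ℂ OX OX)
    (v : Fin (mu w) → OXθθ) : nablaX w ξ (fromModel w 1 tau v) =
      fromModel w 1 tau fun k => vfDer ξ (v k) + LaurentPolynomial.C (logCoeff ξ) *
        (connExp w k • v k - tau * shiftMap w OXθθ v k) := by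
  have h : (fun k : Fin (mu w) => vfDer ξ (v k) + LaurentPolynomial.C (logCoeff ξ) *
      (connExp w k • v k - tau * shiftMap w OXθθ v k)) =
      ∑ k : Fin (mu w), (vfDer ξ (v k) • stdVec w OXθθ k +
        v k • LaurentPolynomial.C (logCoeff ξ) •
          (connExp w k • stdVec w OXθθ k - tau • shiftMap w OXθθ (stdVec w OXθθ k))) := by
    have h1 : shiftMap w OXθθ v = ∑ k : Fin (mu w), v k • shiftMap w OXθθ (stdVec w OXθθ k) := by
      conv_lhs => rw [eq_sum_stdVec v, map_sum]
      simp only [map_smul]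
    ext1 j
    rw [h1]
    simp only [Finset.sum_apply, Pi.add_apply, Pi.smul_apply, Pi.sub_apply, smul_eq_mul,
      Finset.sum_add_distrib, mul_sub, Finset.sum_sub_distrib, Finset.mul_sum, stdVec_eq_single,
      Pi.single_apply, mul_ite, mul_one, mul_zero, smul_ite, smul_zero, Finset.sum_ite_eq,
      Finset.mem_univ, if_true, mul_left_comm (v _)]
    simp only [Algebra.smul_def]
    ring_nf
  rw [h, fromModel_eq_sum hw, map_sum, map_sum]
  refine Finset.sum_congr rfl fun k _ => ?_
  rw [nablaX_smul, nablaX_cls_omegaForm hn hw ξ k.2, map_add,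
    (fromModel w 1 tau).map_smul (vfDer ξ (v k)),
    (fromModel w 1 tau).map_smul (v k), fromModel_stdVec hw k.2.le]

theorem nablaτ_fromModel (hn : 0 < n) (hw : ∀ i, 0 < w i) (v : Fin (mu w) → OXθθ) :
    nablaτ w (fromModel w 1 tau v) =
      fromModel w 1 tau fun k => dτ (v k) -
        ((mu w : OXθθ) * shiftMap w OXθθ v k + specNum w k • (LaurentPolynomial.T 1 * v k)) := by
  have h : (fun k : Fin (mu w) => dτ (v k) -
      ((mu w : OXθθ) * shiftMap w OXθθ v k + specNum w k • (LaurentPolynomial.T 1 * v k))) =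
      ∑ k : Fin (mu w), (dτ (v k) • stdVec w OXθθ k -
        v k • ((mu w : OXθθ) • shiftMap w OXθθ (stdVec w OXθθ k) +
        specNum w k • (LaurentPolynomial.T 1 : OXθθ) • stdVec w OXθθ k)) := by
    have h1 : shiftMap w OXθθ v = ∑ k : Fin (mu w), v k • shiftMap w OXθθ (stdVec w OXθθ k) := by
      conv_lhs => rw [eq_sum_stdVec v, map_sum]
      simp only [map_smul]
    ext1 j
    rw [h1]
    simp only [Finset.sum_apply, Pi.add_apply, Pi.sub_apply, Pi.smul_apply, smul_eq_mul,
      Finset.sum_add_distrib, mul_add, Finset.sum_sub_distrib, Finset.mul_sum,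
      stdVec_eq_single, Pi.single_apply, mul_ite, mul_one, mul_zero, smul_ite, smul_zero,
      Finset.sum_ite_eq, Finset.mem_univ, if_true, mul_left_comm (v _)]
    simp only [Algebra.smul_def]
    ring_nf
  rw [h, fromModel_eq_sum hw, map_sum, map_sum]
  refine Finset.sum_congr rfl fun k _ => ?_
  rw [nablaτ_smul, nablaτ_cls_omegaForm hn hw k.2, map_sub,
    (fromModel w 1 tau).map_smul (dτ (v k)),
    (fromModel w 1 tau).map_smul (v k), fromModel_stdVec hw k.2.le, smul_neg, sub_eq_add_neg]

end Coordinates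

/-! ### Duality on the model -/

section Duality

variable {n : ℕ} {w : Fin n → ℕ}

/-- The involution of the index set that pairs `k` with `n - k` and with `μ + n - k`. -/
def dualIdx (h : n < mu w) (k : Fin (mu w)) : Fin (mu w) :=
  if _ : (k : ℕ) ≤ n then ⟨n - k, by omega⟩ else ⟨mu w + n - k, by omega⟩

theorem dualIdx_val (h : n < mu w) (k : Fin (mu w)) : (dualIdx h k : ℕ) =
    if (k : ℕ) ≤ n then n - (k : ℕ) else mu w + n - (k : ℕ) := by
  unfold dualIdx; split_ifs <;> rfl

theorem prevIdx_val (k : Fin (mu w)) : (prevIdx w k : ℕ) =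
    if (k : ℕ) = 0 then mu w - 1 else (k : ℕ) - 1 := by
  unfold prevIdx; split_ifs <;> rfl

theorem dualIdx_involutive (h : n < mu w) : Function.Involutive (dualIdx h) := fun k => by
  have := k.2
  rw [Fin.ext_iff, dualIdx_val, dualIdx_val]
  split_ifs <;> omega

/-- The involution is `k ↦ n - k` modulo `μ`, so it conjugates the cyclic predecessor to the
successor. -/
theorem prevIdx_dualIdx_prevIdx (h : n < mu w) (k : Fin (mu w)) :
    prevIdx w (dualIdx h (prevIdx w k)) = dualIdx h k := by
  have := k.2
  rw [Fin.ext_iff, prevIdx_val, dualIdx_val, dualIdx_val, prevIdx_val]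
  split_ifs <;> omega

theorem prevIdx_bijective : Function.Bijective (prevIdx w) := by
  refine Finite.injective_iff_bijective.mp fun j k h => ?_
  have := j.2
  have := k.2
  rw [Fin.ext_iff, prevIdx_val, prevIdx_val] at h
  rw [Fin.ext_iff]
  split_ifs at h <;> omega

/-- The non-zero entry of the Gram matrix in row `k`. -/
def dualCoeff (w : Fin n → ℕ) (k : Fin (mu w)) : OX :=
  if (k : ℕ) = 0 ∨ (k : ℕ) = n then LaurentPolynomial.T (-1)
  else if (k : ℕ) < n then LaurentPolynomial.T (-2)
  else LaurentPolynomial.C (kappa w) * LaurentPolynomial.T (-1)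

theorem gramX_eq (h : n < mu w) (i j : Fin (mu w)) :
    gramX w i j = if j = dualIdx h i then dualCoeff w i else 0 := by
  have := i.2
  have := j.2
  simp only [gramX, dualCoeff, Fin.ext_iff, dualIdx_val]
  split_ifs <;> first | omega | rfl

theorem dualCoeff_dualIdx (h : n < mu w) (k : Fin (mu w)) :
    dualCoeff w (dualIdx h k) = dualCoeff w k := by
  have := k.2
  simp only [dualCoeff, dualIdx_val]
  split_ifs <;> first | omega | rfl

theorem isUnit_dualCoeff (hw : ∀ i, 0 < w i) (k : Fin (mu w)) : IsUnit (dualCoeff w k) := by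
  unfold dualCoeff
  split_ifs
  · exact LaurentPolynomial.isUnit_T _
  · exact LaurentPolynomial.isUnit_T _
  · exact ((kappa_ne_zero hw).isUnit.map LaurentPolynomial.C).mul (LaurentPolynomial.isUnit_T _)

/-- Self-adjointness of the shift, entry by entry; this explains the prescribed values of `S`. The
factor `x` in `e₀ ↦ x e₁` turns `x⁻¹` into `x⁻²` for the interior pairs with sum `n`, and the factor
`κ` in `e_{μ-1} ↦ κ e₀` produces `κ x⁻¹` for the pairs with sum `μ + n`. -/
theorem shiftCoeff_mul_dualCoeff (hn : 0 < n) (h : n < mu w) (k : Fin (mu w)) :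
    shiftCoeff w k * dualCoeff w k =
      shiftCoeff w (dualIdx h (prevIdx w k)) * dualCoeff w (prevIdx w k) := by
  have := k.2
  have e : xX * (LaurentPolynomial.T (-2) : OX) = LaurentPolynomial.T (-1) := by
    rw [← LaurentPolynomial.T_add]; norm_num
  simp only [shiftCoeff, dualCoeff, dualIdx_val, prevIdx_val]
  split_ifs <;> first | omega | ring1 | rw [e, one_mul]

/-- The multiplication by `x u₀` is self-adjoint. -/
theorem sum_shiftMap_mul {B : Type} [CommRing B] [Algebra OX B] (hn : 0 < n) (h : n < mu w)
    (v v' : Fin (mu w) → B) :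
    ∑ k, shiftMap w B v k * v' (dualIdx h k) * algebraMap OX B (dualCoeff w k) =
      ∑ k, v k * shiftMap w B v' (dualIdx h k) * algebraMap OX B (dualCoeff w k) := by
  rw [← prevIdx_bijective.sum_comp fun k =>
    v k * shiftMap w B v' (dualIdx h k) * algebraMap OX B (dualCoeff w k)]
  refine Finset.sum_congr rfl fun k _ => ?_
  have := congrArg (algebraMap OX B) (shiftCoeff_mul_dualCoeff hn h k)
  rw [map_mul, map_mul] at this
  simp only [shiftMap, LinearMap.coe_mk, AddHom.coe_mk, prevIdx_dualIdx_prevIdx]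
  linear_combination v (prevIdx w k) * v' (dualIdx h k) * this

theorem connExp_of_le (hw : ∀ i, 0 < w i) {k : ℕ} (h1 : 1 ≤ k) (hk : k ≤ n) :
    connExp w k = -1 := by
  rw [connExp, if_neg (by omega), slope_eq_zero hw hk]
  simp

theorem slope_add_slope_complex (hw : ∀ i, 0 < w i) {k l : ℕ} (h : k + l = mu w + n) :
    (slope w k : ℂ) + (slope w l : ℂ) = 1 := by
  exact_mod_cast slope_add_slope hw h

theorem connExp_add (hw : ∀ i, 0 < w i) {k l : ℕ} (hk : 1 ≤ k) (hl : 1 ≤ l)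
    (h : k + l = mu w + n) : connExp w k + connExp w l = -1 := by
  rw [connExp, connExp, if_neg (by omega), if_neg (by omega)]
  linear_combination slope_add_slope_complex hw h

/-- For indices at most `n` the slopes vanish and the indices add up to `n`; otherwise the indices
add up to `μ + n` and the slopes to `1`. -/
theorem specNum_add (hw : ∀ i, 0 < w i) (h : n < mu w) (k : Fin (mu w)) :
    specNum w k + specNum w (dualIdx h k) = n := by
  have := k.2
  rw [dualIdx_val]
  split_ifs with hk
  · rw [specNum, specNum, slope_eq_zero hw hk, slope_eq_zero hw (Nat.sub_le n k)]
    push_cast [hk]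
    ring
  · have e : ((mu w + n - (k : ℕ) : ℕ) : ℂ) = mu w + n - k := by
      rw [Nat.cast_sub (by omega)]; push_cast; ring
    have := slope_add_slope_complex hw
      (show (k : ℕ) + (mu w + n - (k : ℕ)) = mu w + n by omega)
    rw [specNum, specNum, e]
    linear_combination -(mu w : ℂ) * this

theorem apply_T_neg_one (ξ : Derivation ℂ OX OX) :
    ξ (LaurentPolynomial.T (-1)) = -(logCoeff ξ * LaurentPolynomial.T (-1)) := by
  have h : ξ (xX * LaurentPolynomial.T (-1)) = 0 := by
    rw [xX_mul_T, Derivation.map_one_eq_zero]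
  rw [Derivation.leibniz, apply_xX, smul_eq_mul, smul_eq_mul] at h
  linear_combination LaurentPolynomial.T (-1) * h -
    (ξ (LaurentPolynomial.T (-1)) + logCoeff ξ * LaurentPolynomial.T (-1)) * xX_mul_T

/-- Each Gram entry is a constant times a power of `x`. Flatness of the pairing asks that this power
be the sum of the two connection exponents: `-1` at the ends `0` and `n`, `-2` strictly between
them, and `-1` beyond `n` by the symmetry of the slopes. -/
theorem apply_dualCoeff (hn : 0 < n) (hw : ∀ i, 0 < w i) (h : n < mu w)
    (ξ : Derivation ℂ OX OX) (k : Fin (mu w)) : ξ (dualCoeff w k) =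
      (connExp w k + connExp w (dualIdx h k)) • (logCoeff ξ * dualCoeff w k) := by
  have := k.2
  have e2 : (LaurentPolynomial.T (-2) : OX) =
      LaurentPolynomial.T (-1) * LaurentPolynomial.T (-1) := by
    rw [← LaurentPolynomial.T_add]; norm_num
  rw [dualIdx_val, dualCoeff]
  by_cases h0 : (k : ℕ) = 0
  · simp only [h0, true_or, if_true, Nat.zero_le, Nat.sub_zero]
    rw [connExp_of_le hw hn le_rfl, connExp, if_pos rfl, apply_T_neg_one]
    simp
  by_cases h1 : (k : ℕ) = n
  · simp only [h1, or_true, if_true, le_refl, Nat.sub_self]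
    rw [connExp_of_le hw hn le_rfl, connExp, if_pos rfl, apply_T_neg_one]
    simp
  by_cases h2 : (k : ℕ) < n
  · simp only [h0, h1, or_self, h2, h2.le, if_true, if_false]
    rw [connExp_of_le hw (by omega) h2.le, connExp_of_le hw (by omega) (Nat.sub_le _ _), e2,
      Derivation.leibniz, apply_T_neg_one]
    simp only [smul_eq_mul, add_smul, neg_smul, one_smul]
    ring
  · simp only [h0, h1, or_self, h2, if_false, show ¬ (k : ℕ) ≤ n by omega]
    rw [connExp_add hw (by omega) (by omega) (by omega), ← LaurentPolynomial.smul_eq_C_mul,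
      Derivation.map_smul, apply_T_neg_one, mul_smul_comm]
    module

end Duality

/-! ### The Frobenius type structure on the model -/

section Transport

variable {O E E' : Type} [CommRing O] [Algebra ℂ O] [AddCommGroup E] [Module O E] [Module ℂ E]
  [IsScalarTower ℂ O E] [AddCommGroup E'] [Module O E'] [Module ℂ E'] [IsScalarTower ℂ O E']

/-- Frobenius type structures are transported by isomorphisms. -/
theorem IsFrobeniusTypeStructure.transport {R0 Rinf : E →ₗ[O] E}
    {Φ : Derivation ℂ O O →ₗ[O] (E →ₗ[O] E)} {D : Derivation ℂ O O →ₗ[O] (E →ₗ[ℂ] E)}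
    {g : E →ₗ[O] E →ₗ[O] O} {r : ℂ} (h : IsFrobeniusTypeStructure R0 Rinf Φ D g r)
    (e : E' ≃ₗ[O] E) {R0' Rinf' : E' →ₗ[O] E'} {Φ' : Derivation ℂ O O →ₗ[O] (E' →ₗ[O] E')}
    {D' : Derivation ℂ O O →ₗ[O] (E' →ₗ[ℂ] E')} {g' : E' →ₗ[O] E' →ₗ[O] O}
    (hR0 : ∀ x, e (R0' x) = R0 (e x)) (hRinf : ∀ x, e (Rinf' x) = Rinf (e x))
    (hΦ : ∀ ξ x, e (Φ' ξ x) = Φ ξ (e x)) (hD : ∀ ξ x, e (D' ξ x) = D ξ (e x))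
    (hg : ∀ x y, g' x y = g (e x) (e y)) :
    IsFrobeniusTypeStructure R0' Rinf' Φ' D' g' r where
  free := have := h.free; Module.Free.of_equiv e.symm
  finite := have := h.finite; Module.Finite.equiv e.symm
  leibniz ξ f x := e.injective (by simp [hD, h.leibniz])
  symm x y := by rw [hg, hg, h.symm]
  nondegenerate := by
    refine ⟨fun x y hxy => e.injective (h.nondegenerate.1 (LinearMap.ext fun z => ?_)),
      fun φ => ?_⟩
    · have := LinearMap.congr_fun hxy (e.symm z)
      simpa [hg] using this
    · obtain ⟨x, hx⟩ := h.nondegenerate.2 (φ ∘ₗ e.symm.toLinearMap)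
      refine ⟨e.symm x, LinearMap.ext fun z => ?_⟩
      rw [hg, e.apply_symm_apply, hx]
      simp
  flat ξ ζ x := e.injective (by simp [hD, h.flat])
  flat_Rinf ξ x := e.injective (by simp [hD, hRinf, h.flat_Rinf])
  higgs ξ ζ x := e.injective (by rw [hΦ, hΦ, hΦ, hΦ, h.higgs])
  comm_R0 ξ x := e.injective (by simp [hΦ, hR0, h.comm_R0])
  flat_Φ ξ ζ x := e.injective (by simp [hΦ, hD, h.flat_Φ])
  deriv_R0 ξ x := e.injective (by simp [hΦ, hD, hR0, hRinf, h.deriv_R0])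
  flat_g ξ x y := by simp [hg, hD, h.flat_g]
  adjoint_Φ ξ x y := by simp [hg, hΦ, h.adjoint_Φ]
  adjoint_R0 x y := by simp [hg, hR0, h.adjoint_R0]
  adjoint_Rinf x y := by simp only [hg, hRinf, h.adjoint_Rinf]

/-- The transport of a connection. -/
def transportConnection (D : Derivation ℂ O O →ₗ[O] (E →ₗ[ℂ] E)) (e : E' ≃ₗ[O] E) :
    Derivation ℂ O O →ₗ[O] (E' →ₗ[ℂ] E') where
  toFun ξ := (e.symm.toLinearMap.restrictScalars ℂ) ∘ₗ D ξ ∘ₗ (e.toLinearMap.restrictScalars ℂ)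
  map_add' ξ ζ := by ext x; simp
  map_smul' f ξ := by ext x; simp

end Transport

/-! ### The tuple on the free module and its axioms -/

section ModelStructure

variable {n : ℕ} (w : Fin n → ℕ)

theorem logCoeff_add (ξ ζ : Derivation ℂ OX OX) :
    logCoeff (ξ + ζ) = logCoeff ξ + logCoeff ζ := by
  simp [logCoeff, mul_add]

theorem logCoeff_smul (f : OX) (ξ : Derivation ℂ OX OX) :
    logCoeff (f • ξ) = f * logCoeff ξ := by
  simp [logCoeff, mul_left_comm]

theorem logCoeff_bracket (ξ ζ : Derivation ℂ OX OX) :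
    logCoeff ⁅ξ, ζ⁆ = ξ (logCoeff ζ) - ζ (logCoeff ξ) := by
  have h : ∀ ξ ζ : Derivation ℂ OX OX, ξ (logCoeff ζ) =
      LaurentPolynomial.T (-1) * ξ (ζ xX) - logCoeff ζ * logCoeff ξ := fun ξ ζ => by
    rw [logCoeff, Derivation.leibniz, apply_T_neg_one, smul_eq_mul, smul_eq_mul]
    ring
  rw [h, h, logCoeff, Derivation.commutator_apply]
  ring

/-- `R₀` on the model. -/
def modelR0 : (Fin (mu w) → OX) →ₗ[OX] (Fin (mu w) → OX) := (mu w : OX) • shiftMap w OX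

/-- `R_∞` on the model. -/
def modelRinf : (Fin (mu w) → OX) →ₗ[OX] (Fin (mu w) → OX) where
  toFun v k := specNum w k • v k
  map_add' v v' := by ext1 k; simp
  map_smul' f v := by ext1 k; simp

/-- The Higgs field on the model. -/
def modelΦ : Derivation ℂ OX OX →ₗ[OX] ((Fin (mu w) → OX) →ₗ[OX] (Fin (mu w) → OX)) where
  toFun ξ := -(logCoeff ξ • shiftMap w OX)
  map_add' ξ ζ := by rw [logCoeff_add, add_smul, neg_add]
  map_smul' f ξ := by rw [logCoeff_smul, mul_smul, RingHom.id_apply, smul_neg]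

/-- The flat connection on the model. -/
def modelD : Derivation ℂ OX OX →ₗ[OX] ((Fin (mu w) → OX) →ₗ[ℂ] (Fin (mu w) → OX)) where
  toFun ξ :=
    { toFun := fun v k => ξ (v k) + connExp w k • (logCoeff ξ * v k)
      map_add' := fun v v' => by
        ext1 k
        simp only [Pi.add_apply, map_add, mul_add, smul_add]
        abel
      map_smul' := fun c v => by
        ext1 k
        simp [smul_comm c] }
  map_add' ξ ζ := by
    refine LinearMap.ext fun v => funext fun k => ?_
    simp only [LinearMap.coe_mk, AddHom.coe_mk, LinearMap.add_apply, Pi.add_apply, logCoeff_add,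
      Derivation.add_apply, add_mul, smul_add]
    abel
  map_smul' f ξ := by
    refine LinearMap.ext fun v => funext fun k => ?_
    simp only [LinearMap.coe_mk, AddHom.coe_mk, LinearMap.smul_apply, Pi.smul_apply,
      logCoeff_smul, Derivation.smul_apply, RingHom.id_apply, smul_eq_mul, mul_assoc, mul_add,
      mul_smul_comm]

variable {w}

/-- The metric on the model. -/
def modelMetric (h : n < mu w) :
    (Fin (mu w) → OX) →ₗ[OX] (Fin (mu w) → OX) →ₗ[OX] OX :=
  LinearMap.mk₂ OX (fun v v' => ∑ k, v k * v' (dualIdx h k) * dualCoeff w k)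
    (fun v₁ v₂ v' => by simp [add_mul, Finset.sum_add_distrib])
    (fun f v v' => by simp [mul_assoc, Finset.mul_sum])
    (fun v v₁ v₂ => by simp [mul_add, add_mul, Finset.sum_add_distrib])
    (fun f v v' => by
      simp only [Pi.smul_apply, smul_eq_mul, Finset.mul_sum]
      exact Finset.sum_congr rfl fun k _ => by ring)

theorem modelMetric_apply (h : n < mu w) (v v' : Fin (mu w) → OX) :
    modelMetric h v v' = ∑ k, v k * v' (dualIdx h k) * dualCoeff w k := rfl

theorem modelMetric_shiftMap (hn : 0 < n) (h : n < mu w) (v v' : Fin (mu w) → OX) :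
    modelMetric h (shiftMap w OX v) v' = modelMetric h v (shiftMap w OX v') :=
  sum_shiftMap_mul (B := OX) hn h v v'

theorem modelD_apply (ξ : Derivation ℂ OX OX) (v : Fin (mu w) → OX) (k : Fin (mu w)) :
    modelD w ξ v k = ξ (v k) + connExp w k • (logCoeff ξ * v k) := rfl

theorem modelRinf_apply (v : Fin (mu w) → OX) (k : Fin (mu w)) :
    modelRinf w v k = specNum w k • v k := rfl

theorem modelΦ_apply (ξ : Derivation ℂ OX OX) (v : Fin (mu w) → OX) :
    modelΦ w ξ v = -(logCoeff ξ • shiftMap w OX v) := rfl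

theorem shiftMap_apply (v : Fin (mu w) → OX) (k : Fin (mu w)) :
    shiftMap w OX v k = shiftCoeff w k * v (prevIdx w k) := rfl

/-- The shift coefficients are constants, except for one factor `x`, so the commutator multiplies
component `k` of the shift by a complex number times `logCoeff ξ`. Written with spectral numbers,
this number is what `D(R₀) + Φ = [R_∞, Φ]` requires, as `R₀` is `μ` times the shift. -/
theorem mul_commutator_modelD_shiftMap (hn : 0 < n) (hw : ∀ i, 0 < w i)
    (ξ : Derivation ℂ OX OX) (v : Fin (mu w) → OX) (k : Fin (mu w)) :
    modelD w ξ (shiftMap w OX v) k - shiftMap w OX (modelD w ξ v) k =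
      ((mu w : ℂ)⁻¹ * (1 - specNum w k + specNum w (prevIdx w k))) •
        (logCoeff ξ * shiftMap w OX v k) := by
  have hμ : (mu w : ℂ) ≠ 0 := Nat.cast_ne_zero.mpr (mu_pos w).ne'
  have h1 : ξ (shiftCoeff w k) =
      (if (k : ℕ) = 1 then (1 : ℂ) else 0) • (logCoeff ξ * shiftCoeff w k) := by
    unfold shiftCoeff
    split_ifs with h h' h'
    · omega
    · rw [zero_smul]; exact Derivation.map_algebraMap _ _
    · rw [one_smul, apply_xX]
    · rw [zero_smul, Derivation.map_one_eq_zero]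
  -- Away from `k = 0, 1` both sides equal `α_k - α_{k-1}`. At `k = 1` the derivative of the factor
  -- `x` cancels the jump from exponent `0` to `-1`; at `k = 0` the predecessor is `μ - 1`, and both
  -- sides are `1 - α_{μ-1}`.
  have h2 : (mu w : ℂ)⁻¹ * (1 - specNum w k + specNum w (prevIdx w k)) =
      (if (k : ℕ) = 1 then (1 : ℂ) else 0) + connExp w k - connExp w (prevIdx w k) := by
    rw [inv_mul_eq_iff_eq_mul₀ hμ]
    have hμ1 := lt_mu hw
    have := k.2
    rw [prevIdx_val]
    simp only [specNum, connExp]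
    by_cases h0 : (k : ℕ) = 0
    · rw [if_pos h0, if_neg (by omega), if_pos h0, if_neg (by omega), h0,
        slope_eq_zero hw (Nat.zero_le n)]
      push_cast [show 1 ≤ mu w from mu_pos w]
      ring
    by_cases h1 : (k : ℕ) = 1
    · simp only [h1]
      rw [slope_eq_zero hw hn]
      simp [slope_eq_zero hw (Nat.zero_le n)]
    · rw [if_neg h0, if_neg h1, if_neg h0, if_neg (by omega)]
      push_cast [show 1 ≤ (k : ℕ) by omega]
      ring
  rw [h2, modelD_apply, shiftMap_apply, shiftMap_apply, modelD_apply, Derivation.leibniz, h1]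
  simp only [smul_eq_mul, Algebra.smul_def, map_add, map_sub]
  ring

theorem isFrobeniusTypeStructure_model (hn : 0 < n) (hw : ∀ i, 0 < w i) (h : n < mu w) :
    IsFrobeniusTypeStructure (modelR0 w) (modelRinf w) (modelΦ w) (modelD w) (modelMetric h)
      (n : ℂ) where
  free := inferInstance
  finite := inferInstance
  leibniz ξ f v := by
    ext1 k
    simp only [modelD_apply, Pi.add_apply, Pi.smul_apply, smul_eq_mul, Derivation.leibniz]
    simp only [Algebra.smul_def]
    ring
  symm v v' := by
    rw [modelMetric_apply, modelMetric_apply, ← (dualIdx_involutive h).bijective.sum_comp]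
    refine Finset.sum_congr rfl fun k _ => ?_
    rw [dualIdx_involutive h, dualCoeff_dualIdx, mul_comm (v _)]
  nondegenerate := by
    -- Each row of the Gram matrix has one nonzero entry, a unit, so the components of `v` are
    -- recovered by pairing with standard vectors.
    have key : ∀ v k, modelMetric h v (Pi.single (dualIdx h k) 1) = v k * dualCoeff w k :=
      fun v k => by
        rw [modelMetric_apply, Finset.sum_eq_single k]
        · simp
        · intro j _ hj
          rw [Pi.single_eq_of_ne ((dualIdx_involutive h).injective.ne hj)]
          simp
        · simp
    refine ⟨fun v v' hv => funext fun k => ?_, fun φ => ?_⟩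
    · have := LinearMap.congr_fun hv (Pi.single (dualIdx h k) 1)
      rw [key, key] at this
      exact (isUnit_dualCoeff hw k).mul_right_cancel this
    · choose u hu using fun k => isUnit_dualCoeff hw k
      refine ⟨fun k => φ (Pi.single (dualIdx h k) 1) * ((u k)⁻¹ : OXˣ), ?_⟩
      refine LinearMap.pi_ext' fun j => LinearMap.ext_ring ?_
      change modelMetric h _ (Pi.single j 1) = φ (Pi.single j 1)
      rw [← dualIdx_involutive h j, key, mul_assoc, ← hu, Units.inv_mul, mul_one,
        dualIdx_involutive h]
  flat ξ ζ v := by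
    ext1 k
    simp only [modelD_apply, Pi.sub_apply, logCoeff_bracket, Derivation.commutator_apply, map_add,
      Derivation.map_smul, Derivation.leibniz, smul_eq_mul]
    simp only [Algebra.smul_def]
    ring
  flat_Rinf ξ v := by
    ext1 k
    simp only [modelD_apply, modelRinf_apply, Derivation.map_smul]
    simp only [Algebra.smul_def]
    ring
  higgs ξ ζ v := by
    simp only [modelΦ_apply, map_neg, map_smul]
    rw [smul_neg, smul_neg, smul_comm]
  comm_R0 ξ v := by
    simp only [modelΦ_apply, modelR0, LinearMap.smul_apply, map_neg, map_smul, smul_neg]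
    rw [smul_comm]
  flat_Φ ξ ζ v := by
    ext1 k
    have e : ∀ (ξ : Derivation ℂ OX OX) (f : OX) (v : Fin (mu w) → OX),
        modelD w ξ (f • v) k = ξ f * v k + f * modelD w ξ v k := fun ξ f v => by
      simp only [modelD_apply, Pi.smul_apply, smul_eq_mul, Derivation.leibniz]
      simp only [Algebra.smul_def]
      ring
    have h1 := mul_commutator_modelD_shiftMap hn hw ξ v k
    have h2 := mul_commutator_modelD_shiftMap hn hw ζ v k
    simp only [modelΦ_apply, map_neg, Pi.sub_apply, Pi.neg_apply, e, logCoeff_bracket,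
      Pi.smul_apply, smul_eq_mul]
    rw [Algebra.smul_def] at h1 h2
    -- The commutator is proportional to `logCoeff ξ`, so its contributions are symmetric in `ξ, ζ`
    -- and cancel. Only the derivatives of the logarithmic coefficients survive, and they form the
    -- bracket.
    linear_combination -logCoeff ζ * h1 + logCoeff ξ * h2
  deriv_R0 ξ v := by
    ext1 k
    have hμ : (mu w : ℂ) ≠ 0 := Nat.cast_ne_zero.mpr (mu_pos w).ne'
    have h1 := mul_commutator_modelD_shiftMap hn hw ξ v k
    have h2 : modelD w ξ ((mu w : OX) • shiftMap w OX v) k =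
        (mu w : OX) * modelD w ξ (shiftMap w OX v) k := by
      rw [Nat.cast_smul_eq_nsmul, map_nsmul, Pi.smul_apply, nsmul_eq_mul]
    have h3 : (mu w : OX) * algebraMap ℂ OX
        ((mu w : ℂ)⁻¹ * (1 - specNum w k + specNum w (prevIdx w k))) =
          1 - algebraMap ℂ OX (specNum w k) + algebraMap ℂ OX (specNum w (prevIdx w k)) := by
      rw [← map_natCast (algebraMap ℂ OX), ← map_mul, mul_inv_cancel_left₀ hμ]
      simp only [map_add, map_sub, map_one]
    have h4 : shiftMap w OX (modelRinf w v) k =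
        algebraMap ℂ OX (specNum w (prevIdx w k)) * shiftMap w OX v k := by
      rw [shiftMap_apply, shiftMap_apply, modelRinf_apply, Algebra.smul_def]
      ring
    simp only [modelΦ_apply, modelR0, LinearMap.smul_apply, Pi.add_apply, Pi.sub_apply,
      Pi.neg_apply, Pi.smul_apply, h2, smul_eq_mul, modelRinf_apply, h4]
    rw [Algebra.smul_def] at h1 ⊢
    linear_combination (mu w : OX) * h1 + logCoeff ξ * shiftMap w OX v k * h3
  flat_g ξ v v' := by
    rw [modelMetric_apply, modelMetric_apply, modelMetric_apply, map_sum,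
      ← Finset.sum_add_distrib]
    refine Finset.sum_congr rfl fun k _ => ?_
    simp only [modelD_apply, Derivation.leibniz, apply_dualCoeff hn hw h, smul_eq_mul,
      Algebra.smul_def, map_add]
    ring
  adjoint_Φ ξ v v' := by
    simp only [modelΦ_apply, map_neg, map_smul, LinearMap.neg_apply, LinearMap.smul_apply,
      modelMetric_shiftMap hn h]
  adjoint_R0 v v' := by
    simp only [modelR0, map_smul, LinearMap.smul_apply, modelMetric_shiftMap hn h]
  adjoint_Rinf v v' := by
    rw [modelMetric_apply, modelMetric_apply, modelMetric_apply, ← Finset.sum_add_distrib,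
      Finset.smul_sum]
    refine Finset.sum_congr rfl fun k _ => ?_
    rw [← specNum_add hw h k]
    simp only [modelRinf_apply, Algebra.smul_def, map_add]
    ring

end ModelStructure

/-! ### Calculus in `ℂ[x, x⁻¹, θ, θ⁻¹]` -/

section Laurent

theorem coeff_T_mul (k d : ℤ) (p : OXθθ) :
    ((LaurentPolynomial.T k : OXθθ) * p).coeff d = p.coeff (d - k) := by
  rw [LaurentPolynomial.T, AddMonoidAlgebra.coeff_single_mul_eq_mul_coeff (d - k), one_mul]
  intro m _
  constructor <;> intro h <;> omega

theorem coeff_C_mul (f : OX) (d : ℤ) (p : OXθθ) :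
    ((LaurentPolynomial.C f : OXθθ) * p).coeff d = f * p.coeff d := by
  rw [← LaurentPolynomial.smul_eq_C_mul]
  rfl

theorem coeff_vfDer (ξ : Derivation ℂ OX OX) (p : OXθθ) (d : ℤ) :
    (vfDer ξ p).coeff d = ξ (p.coeff d) := by
  simp [vfDer, coeffDer]

theorem dθ_C_mul_T (f : OX) (k : ℤ) :
    dθ (LaurentPolynomial.C f * LaurentPolynomial.T k) =
      (k : OXθθ) * (LaurentPolynomial.C f * LaurentPolynomial.T (k - 1)) := by
  change (LaurentPolynomial.T (-1) : OXθθ) * degDer OX (AddMonoidHom.id ℤ)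
    (LaurentPolynomial.C f * LaurentPolynomial.T k) = _
  rw [← LaurentPolynomial.single_eq_C_mul_T, degDer_single, AddMonoidHom.id_apply,
    LaurentPolynomial.single_eq_C_mul_T, LaurentPolynomial.T_sub]
  simp only [map_mul, map_intCast]
  ring

theorem dθ_T (k : ℤ) : dθ (LaurentPolynomial.T k) =
    (k : OXθθ) * LaurentPolynomial.T (k - 1) := by
  simpa using dθ_C_mul_T 1 k

theorem dτ_apply (p : OXθθ) : dτ p = -(LaurentPolynomial.T 2 * dθ p) := rfl

theorem T_neg_two_mul_dτ (p : OXθθ) : LaurentPolynomial.T (-2) * dτ p = -dθ p := by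
  have h : (LaurentPolynomial.T (-2) : OXθθ) * LaurentPolynomial.T 2 = 1 := by
    rw [← LaurentPolynomial.T_add]; simp
  rw [dτ_apply]
  linear_combination -(dθ p) * h

theorem coeff_tau_mul_dτ (p : OXθθ) (d : ℤ) : (tau * dτ p).coeff d = -((d : OX) * p.coeff d) := by
  induction p using LaurentPolynomial.induction_on' with
  | add p q hp hq =>
    rw [map_add, mul_add, AddMonoidAlgebra.coeff_add, AddMonoidAlgebra.coeff_add,
      Finsupp.add_apply, Finsupp.add_apply, hp, hq]
    ring
  | C_mul_T k f =>
    have h : tau * dτ (LaurentPolynomial.C f * LaurentPolynomial.T k) =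
        -(AddMonoidAlgebra.single k ((k : OX) * f) : OXθθ) := by
      have e : (LaurentPolynomial.T k : OXθθ) =
          tau * LaurentPolynomial.T 2 * LaurentPolynomial.T (k - 1) := by
        rw [← LaurentPolynomial.T_add, ← LaurentPolynomial.T_add]
        congr 1
        ring
      rw [dτ_apply, dθ_C_mul_T, LaurentPolynomial.single_eq_C_mul_T, map_mul, map_intCast, e]
      ring
    rw [h, ← LaurentPolynomial.single_eq_C_mul_T]
    simp only [AddMonoidAlgebra.coeff_neg, AddMonoidAlgebra.coeff_single, Finsupp.neg_apply,
      Finsupp.single_apply]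
    split_ifs with h
    · rw [h]
    · simp

theorem dτ_toLaurent (p : OXθ) : dτ (Polynomial.toLaurent p) =
    -Polynomial.toLaurent (Polynomial.X ^ 2 * Polynomial.derivative p) := by
  induction p using Polynomial.induction_on' with
  | add p q hp hq =>
    simp only [map_add, mul_add, neg_add, hp, hq]
  | monomial m a =>
    rw [← Polynomial.C_mul_X_pow_eq_monomial, Polynomial.toLaurent_C_mul_X_pow, dτ_apply,
      dθ_C_mul_T, Polynomial.derivative_C_mul_X_pow]
    rcases m with _ | m
    · simp
    · simp only [map_mul, Polynomial.toLaurent_C, Polynomial.toLaurent_X_pow, map_natCast,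
        Nat.add_sub_cancel]
      push_cast
      rw [add_sub_cancel_right]
      ring

theorem conjθθ_C (f : OX) : conjθθ (LaurentPolynomial.C f) = LaurentPolynomial.C f :=
  LaurentPolynomial.eval₂_C _ _ _

theorem conjθθ_T_one : conjθθ (LaurentPolynomial.T 1) = -LaurentPolynomial.T 1 := by
  rw [conjθθ, LaurentPolynomial.eval₂_T]
  simp

theorem conjθθ_T_neg_one : conjθθ (LaurentPolynomial.T (-1)) = -LaurentPolynomial.T (-1) := by
  have h : conjθθ (LaurentPolynomial.T 1 * LaurentPolynomial.T (-1)) = 1 := by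
    rw [← LaurentPolynomial.T_add]; simp
  rw [map_mul, conjθθ_T_one] at h
  have e : (LaurentPolynomial.T 1 : OXθθ) * LaurentPolynomial.T (-1) = 1 := T_mul_tau
  linear_combination -LaurentPolynomial.T (-1) * h -
    (conjθθ (LaurentPolynomial.T (-1))) * e

theorem conjθθ_T_neg_two : conjθθ (LaurentPolynomial.T (-2)) = LaurentPolynomial.T (-2) := by
  have h : (LaurentPolynomial.T (-2) : OXθθ) =
      LaurentPolynomial.T (-1) * LaurentPolynomial.T (-1) := by
    rw [← LaurentPolynomial.T_add]; norm_num
  rw [h, map_mul, conjθθ_T_neg_one]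
  ring

/-- A multiplicative form of induction on Laurent polynomials. -/
theorem laurent_induction {M : OXθθ → Prop} (p : OXθθ) (hC : ∀ f, M (LaurentPolynomial.C f))
    (hT : M (LaurentPolynomial.T 1)) (hT' : M (LaurentPolynomial.T (-1)))
    (hadd : ∀ p q, M p → M q → M (p + q)) (hmul : ∀ p q, M p → M q → M (p * q)) : M p := by
  refine LaurentPolynomial.induction_on p hC (hadd _ _) (fun k f h => ?_) (fun k f h => ?_)
  · rw [LaurentPolynomial.T_add, ← mul_assoc]; exact hmul _ _ h hT
  · rw [LaurentPolynomial.T_sub, ← mul_assoc]; exact hmul _ _ h hT'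

theorem dθ_conjθθ (p : OXθθ) : dθ (conjθθ p) = -conjθθ (dθ p) := by
  induction p using laurent_induction with
  | hC f =>
    have := dθ_C_mul_T f 0
    rw [LaurentPolynomial.T_zero, mul_one, Int.cast_zero, zero_mul] at this
    rw [conjθθ_C, this, map_zero, neg_zero]
  | hT => rw [conjθθ_T_one, map_neg, dθ_T]; simp
  | hT' =>
    rw [conjθθ_T_neg_one, map_neg, dθ_T]
    simp [conjθθ_T_neg_two]
  | hadd p q hp hq => rw [map_add, map_add, map_add, hp, hq, map_add, neg_add]
  | hmul p q hp hq =>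
    simp only [map_mul, Derivation.leibniz, hp, hq, smul_eq_mul, map_add]
    ring

theorem vfDer_conjθθ (ξ : Derivation ℂ OX OX) (p : OXθθ) :
    vfDer ξ (conjθθ p) = conjθθ (vfDer ξ p) := by
  induction p using laurent_induction with
  | hC f => rw [conjθθ_C, vfDer_C, conjθθ_C]
  | hT => rw [conjθθ_T_one, map_neg, vfDer_T, neg_zero, map_zero]
  | hT' => rw [conjθθ_T_neg_one, map_neg, vfDer_T, neg_zero, map_zero]
  | hadd p q hp hq => simp only [map_add, hp, hq]
  | hmul p q hp hq =>
    simp only [map_mul, Derivation.leibniz, hp, hq, smul_eq_mul, map_add]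

theorem conjθ_C (f : OX) : conjθ (Polynomial.C f) = Polynomial.C f := by simp [conjθ]

theorem conjθ_X : conjθ Polynomial.X = -Polynomial.X := by simp [conjθ]

theorem conjθ_conjθ (p : OXθ) : conjθ (conjθ p) = p := by
  have : conjθ.comp conjθ = RingHom.id OXθ :=
    Polynomial.ringHom_ext (fun f => by simp [conjθ_C]) (by simp [conjθ_X])
  exact RingHom.congr_fun this p

theorem coeff_zero_conjθ (p : OXθ) : (conjθ p).coeff 0 = p.coeff 0 := by
  rw [Polynomial.coeff_zero_eq_eval_zero, Polynomial.coeff_zero_eq_eval_zero]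
  simp [conjθ, Polynomial.eval_comp]

theorem conjθθ_toLaurent (p : OXθ) :
    conjθθ (Polynomial.toLaurent p) = Polynomial.toLaurent (conjθ p) := by
  have : conjθθ.comp (Polynomial.toLaurent : OXθ →+* OXθθ) =
      (Polynomial.toLaurent : OXθ →+* OXθθ).comp conjθ :=
    Polynomial.ringHom_ext (fun f => by simp [conjθ_C, conjθθ_C])
      (by simp [conjθ_X, conjθθ_T_one])
  exact RingHom.congr_fun this p

theorem coeff_zero_toLaurent (p : OXθ) : (Polynomial.toLaurent p).coeff 0 = p.coeff 0 := by
  induction p using Polynomial.induction_on' with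
  | add p q hp hq => simp only [map_add, AddMonoidAlgebra.coeff_add, Finsupp.add_apply, hp, hq,
      Polynomial.coeff_add]
  | monomial m a =>
    rw [← Polynomial.C_mul_X_pow_eq_monomial, Polynomial.toLaurent_C_mul_X_pow,
      ← LaurentPolynomial.single_eq_C_mul_T, AddMonoidAlgebra.coeff_single, Finsupp.single_apply,
      Polynomial.coeff_C_mul_X_pow]
    simp [eq_comm]

end Laurent

/-! ### The form `S` in coordinates -/

section Form

variable {n : ℕ} {w : Fin n → ℕ}

theorem formS_eq (h : n < mu w) (b : Module.Basis (Fin (mu w)) OXθ (G0 w)) (ε η : G0 w) :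
    formS w b ε η = (∑ k, b.repr ε k * conjθ (b.repr η (dualIdx h k)) *
      Polynomial.C (dualCoeff w k)) * Polynomial.X ^ n := by
  rw [formS, sesqForm, Finset.sum_mul]
  refine Finset.sum_congr rfl fun k _ => ?_
  rw [Finset.sum_eq_single (dualIdx h k)]
  · rw [gramX_eq h, if_pos rfl]; ring
  · intro j _ hj; rw [gramX_eq h, if_neg hj]; simp
  · simp

theorem formSG_eq (h : n < mu w) (b : Module.Basis (Fin (mu w)) OXθθ (G w)) (ε η : G w) :
    formSG w b ε η = (∑ k, b.repr ε k * conjθθ (b.repr η (dualIdx h k)) *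
      algebraMap OX OXθθ (dualCoeff w k)) * LaurentPolynomial.T n := by
  rw [formSG, sesqForm, Finset.sum_mul]
  refine Finset.sum_congr rfl fun k _ => ?_
  rw [Finset.sum_eq_single (dualIdx h k)]
  · rw [gramX_eq h, if_pos rfl, ← mul_assoc]; rfl
  · intro j _ hj; rw [gramX_eq h, if_neg hj]; simp
  · simp

/-- The involution of the indices exchanges the two arguments up to conjugation; the sign
compensates for the conjugate of `θⁿ`. -/
theorem formS_swap (h : n < mu w) (b : Module.Basis (Fin (mu w)) OXθ (G0 w)) (ε η : G0 w) :
    formS w b η ε = (-1) ^ n * conjθ (formS w b ε η) := by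
  have e1 : (-Polynomial.X : OXθ) ^ n = (-1) ^ n * Polynomial.X ^ n := by
    rw [← mul_pow]; congr 1; ring
  have e2 : (-1 : OXθ) ^ n * (-1) ^ n = 1 := by
    have : (-1 : OXθ) * -1 = 1 := by ring
    rw [← mul_pow, this, one_pow]
  have e3 : ∀ s : OXθ, (-1) ^ n * (s * ((-1) ^ n * Polynomial.X ^ n)) = s * Polynomial.X ^ n :=
    fun s => by linear_combination s * Polynomial.X ^ n * e2
  rw [formS_eq h, formS_eq h, map_mul, map_pow, conjθ_X, e1, e3, map_sum, ← (dualIdx_involutive h).bijective.sum_comp]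
  congr 1
  refine Finset.sum_congr rfl fun k _ => ?_
  rw [dualIdx_involutive h, dualCoeff_dualIdx, map_mul, map_mul, conjθ_conjθ, conjθ_C]
  ring

theorem formS_nondegenerate (hw : ∀ i, 0 < w i) (h : n < mu w)
    (b : Module.Basis (Fin (mu w)) OXθ (G0 w)) (φ : G0 w →ₛₗ[conjθ] OXθ) :
    ∃! ε, ∀ η, formS w b ε η = Polynomial.X ^ n * φ η := by
  have hX : IsLeftRegular ((Polynomial.X : OXθ) ^ n) :=
    (Polynomial.isRegular_X_pow n).left
  have key : ∀ ε k, formS w b ε (b (dualIdx h k)) =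
      Polynomial.X ^ n * (b.repr ε k * Polynomial.C (dualCoeff w k)) := fun ε k => by
    rw [formS_eq h, mul_comm, Finset.sum_eq_single k]
    · simp
    · intro j _ hj
      rw [b.repr_self, Finsupp.single_eq_of_ne ((dualIdx_involutive h).injective.ne hj)]
      simp
    · simp
  choose u hu using fun k => isUnit_dualCoeff hw k
  -- Coordinate `k` is forced by testing against the basis vector dual to `k`, after division by the
  -- unit Gram entry.
  refine ⟨b.equivFun.symm fun k => φ (b (dualIdx h k)) * Polynomial.C (((u k)⁻¹ : OXˣ) : OX),
    fun η => ?_, fun ε hε => ?_⟩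
  · rw [formS_eq h, mul_comm]
    congr 1
    conv_rhs => rw [← b.sum_repr η, map_sum, ← (dualIdx_involutive h).bijective.sum_comp]
    refine Finset.sum_congr rfl fun k _ => ?_
    have e : (Polynomial.C (((u k)⁻¹ : OXˣ) : OX) : OXθ) * Polynomial.C (dualCoeff w k) = 1 := by
      rw [← hu, ← map_mul, Units.inv_mul, map_one]
    rw [← b.equivFun_apply, b.equivFun.apply_symm_apply, map_smulₛₗ, smul_eq_mul]
    linear_combination φ (b (dualIdx h k)) * conjθ (b.repr η (dualIdx h k)) * e
  · rw [LinearEquiv.eq_symm_apply]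
    ext1 k
    have h1 := (key ε k).symm.trans (hε (b (dualIdx h k)))
    have h2 := hX h1
    have e : (Polynomial.C (dualCoeff w k) : OXθ) * Polynomial.C (((u k)⁻¹ : OXˣ) : OX) = 1 := by
      rw [← hu, ← map_mul, Units.mul_inv, map_one]
    rw [← h2, mul_assoc, e, mul_one, b.equivFun_apply]

theorem coeff_formS (h : n < mu w) (b : Module.Basis (Fin (mu w)) OXθ (G0 w)) (ε η : G0 w) :
    (formS w b ε η).coeff n = modelMetric h (fun k => (b.repr ε k).coeff 0)
      (fun k => (b.repr η k).coeff 0) := by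
  rw [formS_eq h, Polynomial.coeff_mul_X_pow', if_pos le_rfl, Nat.sub_self,
    Polynomial.finsetSum_coeff, modelMetric_apply]
  refine Finset.sum_congr rfl fun k _ => ?_
  rw [Polynomial.mul_coeff_zero, Polynomial.mul_coeff_zero, coeff_zero_conjθ,
    Polynomial.coeff_C_zero]

theorem conjθθ_shiftMap (v : Fin (mu w) → OXθθ) (k : Fin (mu w)) :
    conjθθ (shiftMap w OXθθ v k) = shiftMap w OXθθ (fun j => conjθθ (v j)) k := by
  change conjθθ (LaurentPolynomial.C (shiftCoeff w k) * v (prevIdx w k)) =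
    LaurentPolynomial.C (shiftCoeff w k) * conjθθ (v (prevIdx w k))
  rw [map_mul, conjθθ_C]

theorem conjθθ_algebraMap (c : ℂ) : conjθθ (algebraMap ℂ OXθθ c) = algebraMap ℂ OXθθ c :=
  conjθθ_C (algebraMap ℂ OX c)

/-- The diagonal terms match the derivative of the Gram entries by `apply_dualCoeff`. The shift
terms carry `τ`, whose conjugate is `-τ`, so they cancel in the sum because the shift is
self-adjoint. -/
theorem formSG_flat_X (hn : 0 < n) (hw : ∀ i, 0 < w i) (h : n < mu w)
    (b : Module.Basis (Fin (mu w)) OXθθ (G w))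
    (hb : ∀ v, b.equivFun.symm v = fromModel w 1 tau v) (ξ : Derivation ℂ OX OX) (ε η : G w) :
    vfDer ξ (formSG w b ε η) =
      formSG w b (nablaX w ξ ε) η + formSG w b ε (nablaX w ξ η) := by
  obtain ⟨v, rfl⟩ := b.equivFun.symm.surjective ε
  obtain ⟨v', rfl⟩ := b.equivFun.symm.surjective η
  rw [hb, hb, nablaX_fromModel hn hw, nablaX_fromModel hn hw, ← hb, ← hb, ← hb, ← hb,
    formSG_eq h, formSG_eq h, formSG_eq h]
  simp only [← Module.Basis.equivFun_apply, LinearEquiv.apply_symm_apply]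
  rw [Derivation.leibniz, vfDer_T, smul_zero, zero_add, smul_eq_mul, ← add_mul, mul_comm]
  congr 1
  have key := sum_shiftMap_mul hn h v fun k => conjθθ (v' k)
  -- Termwise the identity holds only up to the defect of self-adjointness, which vanishes after
  -- summation by `key`.
  have e : ∀ k, vfDer ξ (v k * conjθθ (v' (dualIdx h k)) * algebraMap OX OXθθ (dualCoeff w k)) =
      ((vfDer ξ (v k) + LaurentPolynomial.C (logCoeff ξ) *
          (connExp w k • v k - tau * shiftMap w OXθθ v k)) * conjθθ (v' (dualIdx h k)) *
          algebraMap OX OXθθ (dualCoeff w k) +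
        v k * conjθθ (vfDer ξ (v' (dualIdx h k)) + LaurentPolynomial.C (logCoeff ξ) *
          (connExp w (dualIdx h k) • v' (dualIdx h k) -
            tau * shiftMap w OXθθ v' (dualIdx h k))) * algebraMap OX OXθθ (dualCoeff w k)) +
      LaurentPolynomial.C (logCoeff ξ) * tau *
        (shiftMap w OXθθ v k * conjθθ (v' (dualIdx h k)) * algebraMap OX OXθθ (dualCoeff w k) -
        v k * shiftMap w OXθθ (fun k => conjθθ (v' k)) (dualIdx h k) *
          algebraMap OX OXθθ (dualCoeff w k)) := fun k => by
    have e1 : vfDer ξ (algebraMap OX OXθθ (dualCoeff w k)) =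
        (algebraMap ℂ OXθθ (connExp w k) + algebraMap ℂ OXθθ (connExp w (dualIdx h k))) *
          (LaurentPolynomial.C (logCoeff ξ) * algebraMap OX OXθθ (dualCoeff w k)) := by
      change vfDer ξ (LaurentPolynomial.C _) = _
      rw [vfDer_C, apply_dualCoeff hn hw h, Algebra.smul_def, map_mul, map_mul, map_add, map_add]
      rfl
    have e2 : conjθθ tau = -tau := conjθθ_T_neg_one
    simp only [Derivation.leibniz, e1, vfDer_conjθθ, smul_eq_mul, map_add, map_mul, map_sub,
      conjθθ_C, e2, Algebra.smul_def, conjθθ_algebraMap, conjθθ_shiftMap]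
    ring
  rw [map_sum, Finset.sum_congr rfl fun k _ => e k, Finset.sum_add_distrib,
    Finset.sum_add_distrib, ← Finset.mul_sum, Finset.sum_sub_distrib, key, sub_self, mul_zero,
    add_zero]

theorem nablaθ_fromModel (hn : 0 < n) (hw : ∀ i, 0 < w i) (v : Fin (mu w) → OXθθ) :
    nablaθ w (fromModel w 1 tau v) =
      fromModel w 1 tau fun k => dθ (v k) + (LaurentPolynomial.T (-2) *
        ((mu w : OXθθ) * shiftMap w OXθθ v k) + specNum w k • (tau * v k)) := by
  change -((LaurentPolynomial.T (-2) : OXθθ) • nablaτ w (fromModel w 1 tau v)) = _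
  rw [nablaτ_fromModel hn hw, ← map_smul, ← map_neg]
  congr 1
  ext1 k
  have e : tau = (LaurentPolynomial.T (-2) : OXθθ) * LaurentPolynomial.T 1 := by
    rw [← LaurentPolynomial.T_add]; norm_num
  simp only [Pi.neg_apply, Pi.smul_apply, smul_eq_mul, mul_sub, T_neg_two_mul_dτ, e]
  simp only [Algebra.smul_def]
  ring

/-- The derivative of `θⁿ` contributes `n τ`, matched by the spectral numbers of dual indices. The
shift term has the even factor `θ⁻²`, but the sign in `nablaθCheck` makes its two occurrences cancel
by self-adjointness. -/
theorem formSG_flat_θ (hn : 0 < n) (hw : ∀ i, 0 < w i) (h : n < mu w)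
    (b : Module.Basis (Fin (mu w)) OXθθ (G w))
    (hb : ∀ v, b.equivFun.symm v = fromModel w 1 tau v) (ε η : G w) :
    dθ (formSG w b ε η) =
      formSG w b (nablaθ w ε) η + formSG w b ε (nablaθCheck w η) := by
  obtain ⟨v, rfl⟩ := b.equivFun.symm.surjective ε
  obtain ⟨v', rfl⟩ := b.equivFun.symm.surjective η
  rw [nablaθCheck, LinearMap.neg_apply, hb, hb, nablaθ_fromModel hn hw, nablaθ_fromModel hn hw,
    ← map_neg, ← hb, ← hb, ← hb, ← hb, formSG_eq h, formSG_eq h, formSG_eq h]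
  simp only [← Module.Basis.equivFun_apply, LinearEquiv.apply_symm_apply]
  have eT : (LaurentPolynomial.T ((n : ℤ) - 1) : OXθθ) = tau * LaurentPolynomial.T n := by
    rw [← LaurentPolynomial.T_add, sub_eq_neg_add]
  rw [Derivation.leibniz, dθ_T, eT, smul_eq_mul, smul_eq_mul, ← add_mul]
  have key := sum_shiftMap_mul hn h v fun k => conjθθ (v' k)
  have e : ∀ k, dθ (v k * conjθθ (v' (dualIdx h k)) * algebraMap OX OXθθ (dualCoeff w k)) =
      ((dθ (v k) + (LaurentPolynomial.T (-2) * ((mu w : OXθθ) * shiftMap w OXθθ v k) +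
          specNum w k • (tau * v k))) * conjθθ (v' (dualIdx h k)) *
          algebraMap OX OXθθ (dualCoeff w k) +
        v k * conjθθ ((-fun k : Fin (mu w) => dθ (v' k) + (LaurentPolynomial.T (-2) *
          ((mu w : OXθθ) * shiftMap w OXθθ v' k) + specNum w k • (tau * v' k))) (dualIdx h k)) *
            algebraMap OX OXθθ (dualCoeff w k)) -
      LaurentPolynomial.T (-2) * (mu w : OXθθ) *
        (shiftMap w OXθθ v k * conjθθ (v' (dualIdx h k)) * algebraMap OX OXθθ (dualCoeff w k) -
        v k * shiftMap w OXθθ (fun k => conjθθ (v' k)) (dualIdx h k) *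
          algebraMap OX OXθθ (dualCoeff w k)) -
      ((n : ℤ) : OXθθ) * tau *
        (v k * conjθθ (v' (dualIdx h k)) * algebraMap OX OXθθ (dualCoeff w k)) := fun k => by
    have e1 : dθ (algebraMap OX OXθθ (dualCoeff w k)) = 0 := by
      have := dθ_C_mul_T (dualCoeff w k) 0
      rw [LaurentPolynomial.T_zero, mul_one, Int.cast_zero, zero_mul] at this
      exact this
    have e2 : conjθθ tau = -tau := conjθθ_T_neg_one
    have e3 := congrArg (algebraMap ℂ OXθθ) (specNum_add hw h k)
    rw [map_add, map_natCast] at e3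
    simp only [Derivation.leibniz, e1, dθ_conjθθ, smul_eq_mul, map_add, map_mul, map_neg,
      Pi.neg_apply, conjθθ_T_neg_two, e2, Algebra.smul_def, conjθθ_algebraMap, conjθθ_shiftMap,
      map_natCast, Int.cast_natCast]
    linear_combination (-tau * v k * conjθθ (v' (dualIdx h k)) *
      algebraMap OX OXθθ (dualCoeff w k)) * e3
  rw [map_sum, Finset.sum_congr rfl fun k _ => e k, Finset.sum_sub_distrib,
    Finset.sum_sub_distrib, Finset.sum_add_distrib, ← Finset.mul_sum, ← Finset.mul_sum,
    Finset.sum_sub_distrib, key]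
  ring

end Form

/-! ### The restrictions of the trivial bundle to `θ = 0` and `τ = 0` -/

section Restrictions

variable {n : ℕ} {w : Fin n → ℕ}

/-- The values at `θ = 0` of the coordinates of a section. -/
def valueZero (b : Module.Basis (Fin (mu w)) OXθ (G0 w)) :
    G0 w →ₛₗ[(Polynomial.constantCoeff : OXθ →+* OX)] (Fin (mu w) → OX) where
  toFun ε k := (b.repr ε k).coeff 0
  map_add' ε η := by ext1 k; simp
  map_smul' p ε := by ext1 k; simp [Polynomial.mul_coeff_zero]

theorem ker_valueZero (b : Module.Basis (Fin (mu w)) OXθ (G0 w)) :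
    LinearMap.ker (valueZero b) =
      Ideal.span {(Polynomial.X : OXθ)} • (⊤ : Submodule OXθ (G0 w)) := by
  ext ε
  rw [Submodule.ideal_span_singleton_smul, LinearMap.mem_ker, Submodule.mem_smul_pointwise_iff_exists]
  constructor
  · intro hε
    have : ∀ k, ∃ q, b.repr ε k = Polynomial.X * q := fun k =>
      Polynomial.X_dvd_iff.mpr (congrFun hε k)
    choose q hq using this
    refine ⟨b.equivFun.symm q, trivial, ?_⟩
    rw [← map_smul, LinearEquiv.symm_apply_eq]
    ext1 k
    rw [b.equivFun_apply, hq]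
    rfl
  · rintro ⟨η, -, rfl⟩
    ext1 k
    simp [valueZero, Polynomial.mul_coeff_zero]

/-- The trivialization of `E`. -/
def trivZero (b : Module.Basis (Fin (mu w)) OXθ (G0 w)) : E0 w ≃ₗ[OX] (Fin (mu w) → OX) :=
  LinearEquiv.ofBijective
    { toFun := Submodule.liftQ _ (valueZero b) (ker_valueZero b).ge
      map_add' := map_add _
      map_smul' := fun f x => by
        rw [← algebraMap_smul OXθ f x, map_smulₛₗ]
        simp }
    (by
      constructor
      · exact (injective_iff_map_eq_zero
          (Submodule.liftQ _ (valueZero b) (ker_valueZero b).ge)).mpr fun x hx => by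
            obtain ⟨ε, rfl⟩ := Submodule.Quotient.mk_surjective _ x
            rw [Submodule.Quotient.mk_eq_zero, ← ker_valueZero b]
            exact hx
      · intro v
        refine ⟨cls0 w (b.equivFun.symm fun k => Polynomial.C (v k)), ?_⟩
        change valueZero b _ = v
        ext1 k
        change (b.equivFun (b.equivFun.symm fun k => Polynomial.C (v k)) k).coeff 0 = v k
        rw [LinearEquiv.apply_symm_apply, Polynomial.coeff_C_zero])

theorem trivZero_cls0 (b : Module.Basis (Fin (mu w)) OXθ (G0 w)) (ε : G0 w) :
    trivZero b (cls0 w ε) = fun k => (b.repr ε k).coeff 0 := rfl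

/-- Since `τ = θ⁻¹`, polynomials in `τ` are the Laurent polynomials without positive powers of `θ`.
Conversely, expanding each coordinate into monomials `f τ^p` displays the section as a combination
of the generators. -/
theorem mem_Ginf_iff (b : Module.Basis (Fin (mu w)) OXθθ (G w))
    (hb : ∀ k, b k = toG w (omega w k)) (s : G w) :
    s ∈ Ginf w ↔ ∀ k, ∀ d : ℤ, 0 < d → (b.repr s k).coeff d = 0 := by
  have hpow : ∀ p : ℕ, (tau : OXθθ) ^ p = LaurentPolynomial.T (-(p : ℤ)) := fun p => by
    rw [LaurentPolynomial.T_pow]; simp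
  constructor
  · intro hs
    induction hs using Submodule.span_induction with
    | mem x hx =>
      obtain ⟨⟨p, j⟩, rfl⟩ := hx
      intro k d hd
      beta_reduce
      rw [← hb, map_smul, b.repr_self, Finsupp.smul_apply, Finsupp.single_apply, hpow]
      split_ifs
      · rw [smul_eq_mul, coeff_T_mul, AddMonoidAlgebra.one_def, AddMonoidAlgebra.coeff_single,
          Finsupp.single_eq_of_ne (by omega)]
      · simp
    | zero => simp
    | add x y _ _ hx hy => intro k d hd; simp [hx k d hd, hy k d hd]
    | smul f x _ hx =>
      intro k d hd
      have : (b.repr (f • x) k).coeff d = f • (b.repr x k).coeff d := by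
        rw [← algebraMap_smul OXθθ f x, map_smul, Finsupp.smul_apply, smul_eq_mul]
        exact coeff_C_mul _ _ _
      rw [this, hx k d hd, smul_zero]
  · intro h
    rw [← b.sum_repr s]
    refine Submodule.sum_mem _ fun k _ => ?_
    rw [← AddMonoidAlgebra.sum_coeff_single (b.repr s k), Finsupp.sum, Finset.sum_smul]
    refine Submodule.sum_mem _ fun d hd => ?_
    have hd0 : d ≤ 0 := by
      by_contra! hd'
      exact Finsupp.mem_support_iff.mp hd (h k d hd')
    obtain ⟨p, rfl⟩ := Int.exists_eq_neg_ofNat hd0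
    rw [LaurentPolynomial.single_eq_C_mul_T, ← hpow, mul_smul, hb,
      show LaurentPolynomial.C ((b.repr s k).coeff (-(p : ℤ))) =
        algebraMap OX OXθθ ((b.repr s k).coeff (-(p : ℤ))) from rfl, algebraMap_smul]
    exact Submodule.smul_mem _ _ (Submodule.subset_span ⟨(p, k), rfl⟩)

/-- The values at `τ = 0` of the coordinates of a section. -/
def valueInf (b : Module.Basis (Fin (mu w)) OXθθ (G w)) :
    Ginf w →ₗ[OX] (Fin (mu w) → OX) where
  toFun s k := (b.repr (s : G w) k).coeff 0
  map_add' s t := by ext1 k; simp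
  map_smul' f s := by
    ext1 k
    rw [Submodule.coe_smul, ← algebraMap_smul OXθθ f (s : G w), map_smul, Finsupp.smul_apply,
      smul_eq_mul]
    exact coeff_C_mul _ _ _

theorem ker_valueInf (b : Module.Basis (Fin (mu w)) OXθθ (G w))
    (hb : ∀ k, b k = toG w (omega w k)) : LinearMap.ker (valueInf b) =
      ((Ginf w).map ((tau • LinearMap.id : G w →ₗ[OXθθ] G w).restrictScalars OX)).submoduleOf
        (Ginf w) := by
  ext ⟨s, hs⟩
  rw [LinearMap.mem_ker, Submodule.submoduleOf, Submodule.mem_comap, Submodule.mem_map]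
  have hs' := (mem_Ginf_iff b hb s).mp hs
  constructor
  · intro h0
    -- The preimage under `τ` is `θ s`; it stays in `G_∞` because the coordinates of `s` have no
    -- term of degree `0`.
    refine ⟨(LaurentPolynomial.T 1 : OXθθ) • s, (mem_Ginf_iff b hb _).mpr fun k d hd => ?_, ?_⟩
    · rw [map_smul, Finsupp.smul_apply, smul_eq_mul, coeff_T_mul]
      rcases eq_or_lt_of_le (show (0 : ℤ) ≤ d - 1 by omega) with h | h
      · rw [← h]; exact congrFun h0 k
      · exact hs' k _ h
    · change tau • (LaurentPolynomial.T 1 : OXθθ) • s = s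
      rw [smul_smul, mul_comm, T_mul_tau, one_smul]
  · rintro ⟨t, ht, hts⟩
    change tau • t = s at hts
    ext1 k
    change (b.repr s k).coeff 0 = 0
    rw [← hts, map_smul, Finsupp.smul_apply, smul_eq_mul, coeff_T_mul]
    exact (mem_Ginf_iff b hb t).mp ht k _ (by norm_num)

theorem valueInf_surjective (b : Module.Basis (Fin (mu w)) OXθθ (G w))
    (hb : ∀ k, b k = toG w (omega w k)) : Function.Surjective (valueInf b) := fun v => by
  have h : ∀ k, b.repr (b.equivFun.symm fun k => LaurentPolynomial.C (v k)) k =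
      AddMonoidAlgebra.single 0 (v k) := fun k => by
    rw [← b.equivFun_apply, LinearEquiv.apply_symm_apply]
    rfl
  refine ⟨⟨b.equivFun.symm fun k => LaurentPolynomial.C (v k),
    (mem_Ginf_iff b hb _).mpr fun k d hd => ?_⟩, ?_⟩
  · rw [h, AddMonoidAlgebra.coeff_single, Finsupp.single_eq_of_ne (by omega)]
  · ext1 k
    change (b.repr (b.equivFun.symm fun k => LaurentPolynomial.C (v k)) k).coeff 0 = v k
    rw [h, AddMonoidAlgebra.coeff_single, Finsupp.single_eq_same]

/-- The trivialization of `E_∞`. -/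
def trivInf (b : Module.Basis (Fin (mu w)) OXθθ (G w))
    (hb : ∀ k, b k = toG w (omega w k)) : Einf w ≃ₗ[OX] (Fin (mu w) → OX) :=
  (Submodule.quotEquivOfEq _ _ (ker_valueInf b hb).symm).trans
    ((valueInf b).quotKerEquivOfSurjective (valueInf_surjective b hb))

theorem trivInf_clsInf (b : Module.Basis (Fin (mu w)) OXθθ (G w))
    (hb : ∀ k, b k = toG w (omega w k)) (s : Ginf w) :
    trivInf b hb (clsInf w s) = fun k => (b.repr (s : G w) k).coeff 0 := rfl

theorem repr_toG {b : Module.Basis (Fin (mu w)) OXθ (G0 w)}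
    {bG : Module.Basis (Fin (mu w)) OXθθ (G w)}
    (hb : ∀ v, b.equivFun.symm v = fromModel w Polynomial.X 1 v)
    (hbG : ∀ v, bG.equivFun.symm v = fromModel w 1 tau v) (ε : G0 w) (k : Fin (mu w)) :
    bG.repr (toG w ε) k = Polynomial.toLaurent (b.repr ε k) := by
  obtain ⟨v, rfl⟩ := b.equivFun.symm.surjective ε
  rw [hb, toG_fromModel, ← hb, ← hbG, ← b.equivFun_apply, ← bG.equivFun_apply,
    LinearEquiv.apply_symm_apply, LinearEquiv.apply_symm_apply]

theorem formSG_toG (h : n < mu w) {b : Module.Basis (Fin (mu w)) OXθ (G0 w)}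
    {bG : Module.Basis (Fin (mu w)) OXθθ (G w)}
    (hb : ∀ v, b.equivFun.symm v = fromModel w Polynomial.X 1 v)
    (hbG : ∀ v, bG.equivFun.symm v = fromModel w 1 tau v) (ε η : G0 w) :
    formSG w bG (toG w ε) (toG w η) = Polynomial.toLaurent (formS w b ε η) := by
  rw [formSG_eq h, formS_eq h, map_mul, Polynomial.toLaurent_X_pow, map_sum]
  congr 1
  refine Finset.sum_congr rfl fun k _ => ?_
  rw [repr_toG hb hbG, repr_toG hb hbG, conjθθ_toLaurent, map_mul, map_mul,
    Polynomial.toLaurent_C]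
  rfl

end Restrictions

/-! ### The connection operators on the two lattices and their values on the fibres -/

section Operators

variable {n : ℕ} {w : Fin n → ℕ}

theorem shiftMap_toLaurent (v : Fin (mu w) → OXθ) (k : Fin (mu w)) :
    shiftMap w OXθθ (fun k => Polynomial.toLaurent (v k)) k =
      Polynomial.toLaurent (shiftMap w OXθ v k) := by
  change LaurentPolynomial.C (shiftCoeff w k) * Polynomial.toLaurent (v (prevIdx w k)) =
    Polynomial.toLaurent (Polynomial.C (shiftCoeff w k) * v (prevIdx w k))
  rw [map_mul, Polynomial.toLaurent_C]

theorem coeff_zero_shiftMap (v : Fin (mu w) → OXθ) (k : Fin (mu w)) :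
    (shiftMap w OXθ v k).coeff 0 = shiftMap w OX (fun k => (v k).coeff 0) k :=
  Polynomial.coeff_C_mul _

theorem coeff_shiftMap (v : Fin (mu w) → OXθθ) (k : Fin (mu w)) (d : ℤ) :
    (shiftMap w OXθθ v k).coeff d = shiftMap w OX (fun k => (v k).coeff d) k :=
  coeff_C_mul _ _ _

theorem toLaurent_algebraMap (c : ℂ) :
    Polynomial.toLaurent (algebraMap ℂ OXθ c) = algebraMap ℂ OXθθ c := by
  rw [IsScalarTower.algebraMap_apply ℂ OX OXθ]
  exact (Polynomial.toLaurent_C _).trans (IsScalarTower.algebraMap_apply ℂ OX OXθθ _).symm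

theorem exists_R0_lift (hn : 0 < n) (hw : ∀ i, 0 < w i)
    {b : Module.Basis (Fin (mu w)) OXθ (G0 w)}
    (hb : ∀ v, b.equivFun.symm v = fromModel w Polynomial.X 1 v) (ε : G0 w) :
    ∃ ε', toG w ε' = (LaurentPolynomial.T 2 : OXθθ) • nablaθ w (toG w ε) ∧
      trivZero b (cls0 w ε') = modelR0 w (trivZero b (cls0 w ε)) := by
  obtain ⟨v, rfl⟩ := b.equivFun.symm.surjective ε
  -- These are the coordinates of `-∇_{∂τ} = θ² ∇_{∂θ}`. At `θ = 0` only `μ` times the shift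
  -- survives.
  refine ⟨b.equivFun.symm fun k => Polynomial.X ^ 2 * Polynomial.derivative (v k) +
    ((mu w : OXθ) * shiftMap w OXθ v k + specNum w k • (Polynomial.X * v k)), ?_, ?_⟩
  · have h : ∀ x : G w, (LaurentPolynomial.T 2 : OXθθ) •
        -((LaurentPolynomial.T (-2) : OXθθ) • x) = -x := fun x => by
      rw [smul_neg, smul_smul, ← LaurentPolynomial.T_add]
      simp
    change _ = (LaurentPolynomial.T 2 : OXθθ) •
      -((LaurentPolynomial.T (-2) : OXθθ) • nablaτ w _)
    rw [h, hb, hb, toG_fromModel, toG_fromModel, nablaτ_fromModel hn hw, ← map_neg]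
    congr 1
    ext1 k
    rw [Pi.neg_apply, dτ_toLaurent, shiftMap_toLaurent, map_add, map_add, map_mul _ (mu w : OXθ),
      map_natCast, Algebra.smul_def, Algebra.smul_def, map_mul _ (algebraMap ℂ OXθ _),
      toLaurent_algebraMap, map_mul _ Polynomial.X, Polynomial.toLaurent_X]
    ring
  · rw [trivZero_cls0, trivZero_cls0]
    ext1 k
    simp only [← b.equivFun_apply, LinearEquiv.apply_symm_apply]
    rw [Polynomial.coeff_add, Polynomial.coeff_add, Polynomial.coeff_smul,
      Polynomial.mul_coeff_zero, Polynomial.mul_coeff_zero, Polynomial.mul_coeff_zero,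
      coeff_zero_shiftMap]
    simp [modelR0]

theorem exists_Φ_lift (hn : 0 < n) (hw : ∀ i, 0 < w i)
    {b : Module.Basis (Fin (mu w)) OXθ (G0 w)}
    (hb : ∀ v, b.equivFun.symm v = fromModel w Polynomial.X 1 v) (ξ : Derivation ℂ OX OX)
    (ε : G0 w) :
    ∃ ε', toG w ε' = (LaurentPolynomial.T 1 : OXθθ) • nablaX w ξ (toG w ε) ∧
      trivZero b (cls0 w ε') = modelΦ w ξ (trivZero b (cls0 w ε)) := by
  obtain ⟨v, rfl⟩ := b.equivFun.symm.surjective ε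
  have hξ : ∀ p : OXθ, ∃ q : OXθ, vfDer ξ (Polynomial.toLaurent p) = Polynomial.toLaurent q :=
    fun p => by
      induction p using Polynomial.induction_on' with
      | add p q hp hq =>
        obtain ⟨p', hp⟩ := hp
        obtain ⟨q', hq⟩ := hq
        exact ⟨p' + q', by simp only [map_add, hp, hq]⟩
      | monomial m a =>
        refine ⟨Polynomial.C (ξ a) * Polynomial.X ^ m, ?_⟩
        rw [← Polynomial.C_mul_X_pow_eq_monomial, Polynomial.toLaurent_C_mul_X_pow,
          Polynomial.toLaurent_C_mul_X_pow, Derivation.leibniz, vfDer_T, vfDer_C, smul_zero,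
          zero_add, smul_eq_mul, mul_comm]
  choose q hq using fun k => hξ (v k)
  -- Multiplying the matrix of `∇_ξ` by `θ` cancels the `τ` in front of the shift, so the
  -- coordinates are polynomial in `θ`, and at `θ = 0` only the shift remains.
  refine ⟨b.equivFun.symm fun k => Polynomial.X * q k + Polynomial.C (logCoeff ξ) *
    (connExp w k • (Polynomial.X * v k) - shiftMap w OXθ v k), ?_, ?_⟩
  · rw [hb, hb, toG_fromModel, toG_fromModel, nablaX_fromModel hn hw, ← map_smul]
    congr 1
    ext1 k
    rw [Pi.smul_apply, hq, shiftMap_toLaurent, map_add, map_mul _ Polynomial.X, map_mul,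
      map_sub, Algebra.smul_def, Algebra.smul_def, map_mul _ (algebraMap ℂ OXθ _),
      map_mul _ Polynomial.X, toLaurent_algebraMap, Polynomial.toLaurent_X, Polynomial.toLaurent_C,
      smul_eq_mul]
    linear_combination (LaurentPolynomial.C (logCoeff ξ) *
      Polynomial.toLaurent (shiftMap w OXθ v k)) * T_mul_tau
  · rw [trivZero_cls0, trivZero_cls0]
    ext1 k
    simp only [← b.equivFun_apply, LinearEquiv.apply_symm_apply]
    rw [Polynomial.coeff_add, Polynomial.mul_coeff_zero, Polynomial.coeff_C_mul,
      Polynomial.coeff_sub, Polynomial.coeff_smul, Polynomial.mul_coeff_zero,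
      coeff_zero_shiftMap, modelΦ_apply]
    simp

theorem exists_Rinf_lift (hn : 0 < n) (hw : ∀ i, 0 < w i)
    {b : Module.Basis (Fin (mu w)) OXθθ (G w)}
    (hb : ∀ v, b.equivFun.symm v = fromModel w 1 tau v)
    (hbω : ∀ k, b k = toG w (omega w k)) (s : Ginf w) :
    ∃ s' : Ginf w, (s' : G w) = -(tau • nablaτ w s) ∧
      trivInf b hbω (clsInf w s') = modelRinf w (trivInf b hbω (clsInf w s)) := by
  obtain ⟨s, hs⟩ := s
  obtain ⟨v, rfl⟩ := b.equivFun.symm.surjective s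
  have hv : ∀ k, b.repr (b.equivFun.symm v) k = v k := fun k => by
    rw [← b.equivFun_apply, LinearEquiv.apply_symm_apply]
  rw [mem_Ginf_iff b hbω] at hs
  simp only [hv] at hs
  -- In degree `d ≥ 0` the shift term, multiplied by `τ`, involves coefficients of degree `d + 1 >
  -- 0`, which vanish on `G_∞`. The formula for `d > 0` gives stability of `G_∞`, and `d = 0` gives
  -- the residue.
  have hco : ∀ k, ∀ d : ℤ, 0 ≤ d →
      (b.repr (-(tau • nablaτ w (b.equivFun.symm v))) k).coeff d =
        (d : OX) * (v k).coeff d + specNum w k • (v k).coeff d := fun k d hd => by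
    rw [hb, nablaτ_fromModel hn hw, ← map_smul, ← map_neg, ← hb, ← b.equivFun_apply,
      LinearEquiv.apply_symm_apply, Pi.neg_apply, Pi.smul_apply, smul_eq_mul]
    have e : -(tau * (dτ (v k) - ((mu w : OXθθ) * shiftMap w OXθθ v k +
        specNum w k • (LaurentPolynomial.T 1 * v k)))) =
        -(tau * dτ (v k)) + (tau * (LaurentPolynomial.C (mu w : OX) * shiftMap w OXθθ v k) +
          LaurentPolynomial.C (algebraMap ℂ OX (specNum w k)) * v k) := by
      rw [Algebra.smul_def, map_natCast,
        show algebraMap ℂ OXθθ (specNum w k) =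
          LaurentPolynomial.C (algebraMap ℂ OX (specNum w k)) from rfl]
      linear_combination LaurentPolynomial.C (algebraMap ℂ OX (specNum w k)) * v k * T_mul_tau
    have e0 : shiftMap w OX (fun k => (v k).coeff (d - -1)) k = 0 := by
      rw [show (fun k => (v k).coeff (d - -1)) = 0 from
        funext fun k => hs k _ (by omega), map_zero, Pi.zero_apply]
    rw [e, AddMonoidAlgebra.coeff_add, AddMonoidAlgebra.coeff_add, AddMonoidAlgebra.coeff_neg,
      Finsupp.add_apply, Finsupp.add_apply, Finsupp.neg_apply, coeff_tau_mul_dτ, coeff_T_mul,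
      coeff_C_mul, coeff_C_mul, coeff_shiftMap, e0, Algebra.smul_def, mul_zero, zero_add, neg_neg]
  refine ⟨⟨-(tau • nablaτ w (b.equivFun.symm v)), (mem_Ginf_iff b hbω _).mpr fun k d hd => ?_⟩,
    rfl, ?_⟩
  · rw [hco k d hd.le, hs k d hd]
    simp
  · rw [trivInf_clsInf, trivInf_clsInf]
    ext1 k
    rw [hco k 0 le_rfl, modelRinf_apply, hv]
    simp

theorem exists_D_lift (hn : 0 < n) (hw : ∀ i, 0 < w i)
    {b : Module.Basis (Fin (mu w)) OXθθ (G w)}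
    (hb : ∀ v, b.equivFun.symm v = fromModel w 1 tau v)
    (hbω : ∀ k, b k = toG w (omega w k)) (ξ : Derivation ℂ OX OX) (s : Ginf w) :
    ∃ s' : Ginf w, (s' : G w) = nablaX w ξ s ∧
      trivInf b hbω (clsInf w s') = modelD w ξ (trivInf b hbω (clsInf w s)) := by
  obtain ⟨s, hs⟩ := s
  obtain ⟨v, rfl⟩ := b.equivFun.symm.surjective s
  have hv : ∀ k, b.repr (b.equivFun.symm v) k = v k := fun k => by
    rw [← b.equivFun_apply, LinearEquiv.apply_symm_apply]
  rw [mem_Ginf_iff b hbω] at hs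
  simp only [hv] at hs
  -- As for `R_∞`, the factor `τ` removes the shift from all nonnegative degrees; degree `0` leaves
  -- the model connection.
  have hco : ∀ k, ∀ d : ℤ, 0 ≤ d →
      (b.repr (nablaX w ξ (b.equivFun.symm v)) k).coeff d =
        ξ ((v k).coeff d) + connExp w k • (logCoeff ξ * (v k).coeff d) := fun k d hd => by
    rw [hb, nablaX_fromModel hn hw, ← hb, ← b.equivFun_apply, LinearEquiv.apply_symm_apply]
    have e : connExp w k • v k - tau * shiftMap w OXθθ v k =
        LaurentPolynomial.C (algebraMap ℂ OX (connExp w k)) * v k -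
          tau * shiftMap w OXθθ v k := by
      rw [Algebra.smul_def]; rfl
    have e0 : shiftMap w OX (fun k => (v k).coeff (d - -1)) k = 0 := by
      rw [show (fun k => (v k).coeff (d - -1)) = 0 from
        funext fun k => hs k _ (by omega), map_zero, Pi.zero_apply]
    rw [e, AddMonoidAlgebra.coeff_add, Finsupp.add_apply, coeff_vfDer, coeff_C_mul,
      AddMonoidAlgebra.coeff_sub, Finsupp.sub_apply, coeff_C_mul, coeff_T_mul, coeff_shiftMap, e0,
      Algebra.smul_def, sub_zero, mul_left_comm]
  refine ⟨⟨nablaX w ξ (b.equivFun.symm v), (mem_Ginf_iff b hbω _).mpr fun k d hd => ?_⟩,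
    rfl, ?_⟩
  · rw [hco k d hd.le, hs k d hd]
    simp
  · rw [trivInf_clsInf, trivInf_clsInf]
    ext1 k
    rw [hco k 0 le_rfl, modelD_apply, hv]

end Operators

end BrieskornLattice

end

/-! ### The main theorem -/

open BrieskornLattice in
theorem corollary4p1 (n : ℕ) (hn : 0 < n) (w : Fin n → ℕ) (hw : ∀ i, 0 < w i) :
    -- `ω` is a basis of `G₀` and (through `G₀ → G`) of `G`
    ∃ (b : Module.Basis (Fin (mu w)) OXθ (G0 w)) (bG : Module.Basis (Fin (mu w)) OXθθ (G w)),
      (∀ k, b k = omega w k) ∧ (∀ k, bG k = toG w (omega w k)) ∧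
      -- `S` is symmetric
      (∀ i j : Fin (mu w), formS w b (omega w i) (omega w j) = formS w b (omega w j) (omega w i)) ∧
      (∀ ε η, formS w b η ε = (-1) ^ n * conjθ (formS w b ε η)) ∧
      -- `S` has values in `ℂ[x, x⁻¹, θ] θⁿ` and `θ⁻ⁿ S` is nondegenerate
      (∀ ε η, (Polynomial.X : OXθ) ^ n ∣ formS w b ε η) ∧
      (∀ φ : G0 w →ₛₗ[conjθ] OXθ, ∃! ε, ∀ η, formS w b ε η = Polynomial.X ^ n * φ η) ∧
      -- `S` is `∇`-flat
      (∀ ε η, formSG w bG (toG w ε) (toG w η) = Polynomial.toLaurent (formS w b ε η)) ∧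
      (∀ ε η, dθ (formSG w bG ε η) =
        formSG w bG (nablaθ w ε) η + formSG w bG ε (nablaθCheck w η)) ∧
      (∀ ξ ε η, vfDer ξ (formSG w bG ε η) =
        formSG w bG (nablaX w ξ ε) η + formSG w bG ε (nablaX w ξ η)) ∧
      -- the canonical isomorphism of the two restrictions of the trivial bundle, and the tuple
      ∃ (can : E0 w ≃ₗ[OX] Einf w)
        (R0 Rinf : E0 w →ₗ[OX] E0 w)
        (Φ : Derivation ℂ OX OX →ₗ[OX] (E0 w →ₗ[OX] E0 w))
        (D : Derivation ℂ OX OX →ₗ[OX] (E0 w →ₗ[ℂ] E0 w))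
        (g : E0 w →ₗ[OX] E0 w →ₗ[OX] OX),
        (∀ (ε : G0 w) (h : toG w ε ∈ Ginf w), can (cls0 w ε) = clsInf w ⟨toG w ε, h⟩) ∧
        -- `R₀[ε] = [θ² ∇_{∂θ} ε]`
        (∀ ε, ∃ ε', toG w ε' = (LaurentPolynomial.T 2 : OXθθ) • nablaθ w (toG w ε) ∧
          R0 (cls0 w ε) = cls0 w ε') ∧
        -- `Φ_ξ[ε] = [θ ∇_ξ ε]`
        (∀ ξ ε, ∃ ε', toG w ε' = (LaurentPolynomial.T 1 : OXθθ) • nablaX w ξ (toG w ε) ∧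
          Φ ξ (cls0 w ε) = cls0 w ε') ∧
        -- `g([ε], [η])` is the coefficient of `θⁿ` in `S(ε, η)`
        (∀ ε η, g (cls0 w ε) (cls0 w η) = (formS w b ε η).coeff n) ∧
        -- `R_∞[s] = [-τ ∇_{∂τ} s]`
        (∀ s : Ginf w, ∃ s' : Ginf w, (s' : G w) = -(tau • nablaτ w s) ∧
          can (Rinf (can.symm (clsInf w s))) = clsInf w s') ∧
        -- `D_ξ[s] = [∇_ξ s]`
        (∀ ξ, ∀ s : Ginf w, ∃ s' : Ginf w, (s' : G w) = nablaX w ξ s ∧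
          can (D ξ (can.symm (clsInf w s))) = clsInf w s') ∧
        IsFrobeniusTypeStructure R0 Rinf Φ D g (n : ℂ) := by
  have h : n < mu w := lt_mu hw
  obtain ⟨b, hb⟩ := exists_basis_G0 hn hw
  obtain ⟨bG, hbG⟩ := exists_basis_G hn hw
  have hbω : ∀ k, b k = omega w k := fun k => by
    rw [← cls_omegaForm_G0, ← fromModel_stdVec hw k.2.le, stdVec_eq_single, ← hb,
      LinearEquiv.eq_symm_apply]
    ext1 j
    simp [Pi.single_apply, eq_comm]
  have hbGω : ∀ k, bG k = toG w (omega w k) := fun k => by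
    rw [toG_omega, ← fromModel_stdVec hw k.2.le, stdVec_eq_single, ← hbG,
      LinearEquiv.eq_symm_apply]
    ext1 j
    simp [Pi.single_apply, eq_comm]
  let e0 := trivZero b
  let eI := trivInf bG hbGω
  have hc : ∀ y, e0 ((e0.trans eI.symm).symm y) = eI y := fun y => e0.apply_symm_apply _
  -- The canonical isomorphism compares the two trivializations by `ω`, and all operators and the
  -- metric on `E` are pulled back from the model through `e0`.
  refine ⟨b, bG, hbω, hbGω, fun i j => ?_, formS_swap h b, fun ε η => ?_,
    formS_nondegenerate hw h b, formSG_toG h hb hbG, formSG_flat_θ hn hw h bG hbG,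
    formSG_flat_X hn hw h bG hbG, e0.trans eI.symm, e0.symm.conj (modelR0 w),
    e0.symm.conj (modelRinf w), e0.symm.conj.toLinearMap ∘ₗ modelΦ w,
    transportConnection (modelD w) e0, (modelMetric h).compl₁₂ e0.toLinearMap e0.toLinearMap,
    fun ε hε => ?_, fun ε => ?_, fun ξ ε => ?_, fun ε η => ?_, fun s => ?_, fun ξ s => ?_, ?_⟩
  · have key : ∀ i j : Fin (mu w), formS w b (omega w i) (omega w j) =
        Polynomial.C (gramX w i j) * Polynomial.X ^ n := fun i j => by
      rw [← hbω, ← hbω, formS, sesqForm, Finset.sum_eq_single i, Finset.sum_eq_single j]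
      · simp
      · intro l _ hl; simp [Finsupp.single_eq_of_ne hl]
      · simp
      · intro l _ hl; simp [Finsupp.single_eq_of_ne hl]
      · simp
    have hsymm : gramX w i j = gramX w j i := by
      rw [gramX_eq h, gramX_eq h]
      by_cases hij : j = dualIdx h i
      · rw [if_pos hij, if_pos (by rw [hij, dualIdx_involutive h]), hij, dualCoeff_dualIdx]
      · rw [if_neg hij, if_neg fun hji => hij (by rw [hji, dualIdx_involutive h])]
    rw [key, key, hsymm]
  · rw [formS_eq h]
    exact Dvd.intro_left _ rfl
  -- A section of both lattices has the same coordinates in both bases, and both restrictions read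
  -- off their terms of degree `0` in `θ`.
  · rw [LinearEquiv.trans_apply, LinearEquiv.symm_apply_eq, trivInf_clsInf, trivZero_cls0]
    ext1 k
    rw [repr_toG hb hbG, coeff_zero_toLaurent]
  · obtain ⟨ε', h1, h2⟩ := exists_R0_lift hn hw hb ε
    exact ⟨ε', h1, (LinearEquiv.symm_apply_eq e0).mpr h2.symm⟩
  · obtain ⟨ε', h1, h2⟩ := exists_Φ_lift hn hw hb ξ ε
    exact ⟨ε', h1, (LinearEquiv.symm_apply_eq e0).mpr h2.symm⟩
  · exact (coeff_formS h b ε η).symm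
  · obtain ⟨s', h1, h2⟩ := exists_Rinf_lift hn hw hbG hbGω s
    refine ⟨s', h1, (LinearEquiv.symm_apply_eq eI).mpr (.trans ?_ h2.symm)⟩
    change e0 (e0.symm (modelRinf w (e0 ((e0.trans eI.symm).symm _)))) = _
    rw [e0.apply_symm_apply, hc]
  · obtain ⟨s', h1, h2⟩ := exists_D_lift hn hw hbG hbGω ξ s
    refine ⟨s', h1, (LinearEquiv.symm_apply_eq eI).mpr (.trans ?_ h2.symm)⟩
    change e0 (e0.symm (modelD w ξ (e0 ((e0.trans eI.symm).symm _)))) = _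
    rw [e0.apply_symm_apply, hc]
  · exact (isFrobeniusTypeStructure_model hn hw h).transport e0
      (fun x => by simp [LinearEquiv.conj_apply]) (fun x => by simp [LinearEquiv.conj_apply])
      (fun ξ x => by simp [LinearEquiv.conj_apply])
      (fun ξ x => by simp [transportConnection]) (fun x y => rfl)
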